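/- Let $\mathbb{K}$ be a commutative unital ring and let $\mathrm{DGCat}$ be the category of small dg categories over $\mathbb{K}$ (cohomological grading, $d(g\circ f)=d(g)\circ f+(-1)^{|g|}g\circ d(f)$) and dg functors. Consider the following dg categories. - $\emptyset$ is the empty dg category, $\mathbb{K}$ is the dg category with a single object $\ast$ and endomorphism algebra $\mathbb{K}$ in degree $0$, and $\mathbb{K}\coprod\mathbb{K}$ is the discrete dg category with two objects $\ast_1,\ast_2$. - For $n\in\mathbb{Z}$, $\mathcal{S}(n)$ has objects $1,2$, with $\mathcal{S}(n)(i,i)=\mathbb{K}\,\mathrm{Id}_i$, $\mathcal{S}(n)(2,1)=0$ and $\mathcal{S}(n)(1,2)=\mathbb{K}u$, where $|u|=-n$ and $d(u)=0$. - For $n\in\mathbb{Z}$, $\mathcal{D}(n)$ has objects $1,2$, with $\mathcal{D}(n)(i,i)=\mathbb{K}\,\mathrm{Id}_i$, $\mathcal{D}(n)(2,1)=0$ and $\mathcal{D}(n)(1,2)=\mathbb{K}t\oplus\mathbb{K}dt$, where $|t|=-n$, $|dt|=1-n$, $d(t)=dt$ and $d(dt)=0$. - $\mathcal{K}$ has objects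 $1,2$ and is freely generated, as a graded $\mathbb{K}$-linear category, by $f\colon 1\to 2$ and $g\colon 2\to 1$ of degree $0$, $h_1\colon 1\to 1$ and $h_2\colon 2\to 2$ of degree $-1$, and $r\colon 1\to 2$ of degree $-2$; its differential is determined by $d(f)=d(g)=0$, $d(h_1)=g\circ f-\mathrm{Id}_1$, $d(h_2)=f\circ g-\mathrm{Id}_2$ and $d(r)=h_2\circ f-f\circ h_1$. Let $\iota_n\colon\mathcal{S}(n)\to\mathcal{D}(n+1)$ be given by $i\mapsto i$ and $u\mapsto dt$, let $\rho_n\colon\mathbb{K}\coprod\mathbb{K}\to\mathcal{D}(n)$ be given by $\ast_i\mapsto i$, and let $\sigma\colon\mathbb{K}\to\mathcal{K}$ be given by $\ast\mapsto 1$. Put $$\mathcal{I}=\{\emptyset\to\mathbb{K}\}\cup\{\iota_n\mid n\in\mathbb{Z}\},\qquad \mathcal{J}=\{\sigma\}\cup\{\rho_n\mid n\in\mathbb{Z}\}.$$ For a class $\mathcal{S}$ of morphisms, let $\mathcal{S}\text{-cell}$ be the class of morphisms $X_0\to\mathrm{colim}_{i\ge 0}X_i$ arising from sequences $X_0\to X_1\to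 X_2\to\cdots$ in which every $X_i\to X_{i+1}$ is a pushout of a small coproduct of elements of $\mathcal{S}$. A dg functor $F\colon\mathcal{C}\to\mathcal{D}$ is a quasi-equivalence if $\mathcal{C}(X,Y)\to\mathcal{D}(FX,FY)$ is a quasi-isomorphism for all objects $X,Y$ of $\mathcal{C}$, and $H^0(F)\colon H^0(\mathcal{C})\to H^0(\mathcal{D})$ is essentially surjective. **Proposition.** Every morphism in $\mathcal{J}\text{-cell}$ belongs to $\mathcal{I}\text{-cell}$ and is a quasi-equivalence. In particular, for every small dg category $\mathcal{C}$, every $n\in\mathbb{Z}$ and all dg functors $\mathbb{K}\coprod\mathbb{K}\to\mathcal{C}$ and $\mathbb{K}\to\mathcal{C}$, the pushout $\mathcal{C}\to\mathcal{C}_1$ of $\rho_n$ along the former and the pushout $\mathcal{C}\to\mathcal{C}_2$ of $\sigma$ along the latter are quasi-equivalences. -/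

import Mathlib

open CategoryTheory

universe u

/-- A dg category structure over `K` on a `K`-linear category: every Hom module is the direct sum of
its homogeneous parts `gr X Y n` (`n : ℤ`), and carries a differential of degree `1`; identities are
homogeneous of degree `0`, and composition is compatible with the grading and satisfies the Leibniz
rule `d (g ∘ f) = d g ∘ f + (-1) ^ |g| g ∘ d f`. (In Mathlib's notation `f ≫ g` is `g ∘ f`.) -/
class DGCategory (K : Type u) [CommRing K] (C : Type u) [Category.{u} C] [Preadditive C]
    [Linear K C] where
  /-- the homogeneous part of degree `n` of the Hom complex -/
  gr (X Y : C) (n : ℤ) : Submodule K (X ⟶ Y)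
  isInternal (X Y : C) : DirectSum.IsInternal (gr X Y)
  /-- the differential of the Hom complex -/
  d (X Y : C) : (X ⟶ Y) →ₗ[K] (X ⟶ Y)
  d_mem {X Y : C} {n : ℤ} {f : X ⟶ Y} (hf : f ∈ gr X Y n) : d X Y f ∈ gr X Y (n + 1)
  d_d {X Y : C} (f : X ⟶ Y) : d X Y (d X Y f) = 0
  id_mem (X : C) : 𝟙 X ∈ gr X X 0
  comp_mem {X Y Z : C} {p q : ℤ} {f : X ⟶ Y} {g : Y ⟶ Z} (hf : f ∈ gr X Y p)
    (hg : g ∈ gr Y Z q) : f ≫ g ∈ gr X Z (p + q)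
  d_comp {X Y Z : C} {q : ℤ} (f : X ⟶ Y) {g : Y ⟶ Z} (hg : g ∈ gr Y Z q) :
    d X Z (f ≫ g) = f ≫ d Y Z g + q.negOnePow • (d X Y f ≫ g)

/-- A small dg category over `K`. -/
structure DGCat (K : Type u) [CommRing K] : Type (u + 1) where
  Obj : Type u
  [category : Category.{u} Obj]
  [preadditive : Preadditive Obj]
  [linear : Linear K Obj]
  [dg : DGCategory K Obj]

namespace DGCat

attribute [instance] DGCat.category DGCat.preadditive DGCat.linear DGCat.dg

variable {K : Type u} [CommRing K]

/-- The homogeneous morphisms of degree `n`. -/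
abbrev gr (C : DGCat K) (X Y : C.Obj) (n : ℤ) : Submodule K (X ⟶ Y) :=
  DGCategory.gr X Y n

/-- The differential on the Hom complex from `X` to `Y`. -/
abbrev d (C : DGCat K) (X Y : C.Obj) : (X ⟶ Y) →ₗ[K] (X ⟶ Y) :=
  DGCategory.d X Y

end DGCat

section Functors

variable {K : Type u} [CommRing K]

/-- A dg functor: a `K`-linear functor which preserves degrees and commutes with differentials. -/
@[ext]
structure DGFunctor (C D : DGCat K) extends C.Obj ⥤ D.Obj where
  map_add {X Y : C.Obj} (f g : X ⟶ Y) : map (f + g) = map f + map g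
  map_smul {X Y : C.Obj} (r : K) (f : X ⟶ Y) : map (r • f) = r • map f
  map_mem {X Y : C.Obj} {n : ℤ} {f : X ⟶ Y} (hf : f ∈ C.gr X Y n) :
    map f ∈ D.gr (obj X) (obj Y) n
  map_d {X Y : C.Obj} (f : X ⟶ Y) : map (C.d X Y f) = D.d (obj X) (obj Y) (map f)

/-- The category of small dg categories and dg functors. -/
instance : Category (DGCat K) where
  Hom C D := DGFunctor C D
  id C :=
    { toFunctor := 𝟭 C.Obj
      map_add := fun _ _ => rfl
      map_smul := fun _ _ => rfl
      map_mem := fun hf => hf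
      map_d := fun _ => rfl }
  comp F G :=
    { toFunctor := F.toFunctor ⋙ G.toFunctor
      map_add := fun f g => by simp [F.map_add, G.map_add]
      map_smul := fun r f => by simp [F.map_smul, G.map_smul]
      map_mem := fun hf => G.map_mem (F.map_mem hf)
      map_d := fun f => by simp [F.map_d, G.map_d] }

end Functors

/-! ### Cohomology, the homotopy category, quasi-equivalences -/

section Cohomology

variable {K : Type u} [CommRing K]

namespace DGCat

variable (C : DGCat K)

/-- `Z^n` of the Hom complex: the closed morphisms of degree `n`. -/
def cocycles (X Y : C.Obj) (n : ℤ) : Submodule K (X ⟶ Y) :=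
  C.gr X Y n ⊓ LinearMap.ker (C.d X Y)

/-- `B^n` of the Hom complex. -/
def coboundaries (X Y : C.Obj) (n : ℤ) : Submodule K (X ⟶ Y) :=
  (C.gr X Y (n - 1)).map (C.d X Y)

/-- `H^n` of the Hom complex. -/
abbrev Cohomology (X Y : C.Obj) (n : ℤ) : Type u :=
  C.cocycles X Y n ⧸ (C.coboundaries X Y n).submoduleOf (C.cocycles X Y n)

variable {C}

theorem id_mem_cocycles (X : C.Obj) : 𝟙 X ∈ C.cocycles X X 0 := by
  refine ⟨DGCategory.id_mem (K := K) X, ?_⟩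
  have h := DGCategory.d_comp (K := K) (𝟙 X) (DGCategory.id_mem (K := K) X)
  simpa using h

theorem comp_mem_cocycles {X Y Z : C.Obj} {f : X ⟶ Y} {g : Y ⟶ Z} (hf : f ∈ C.cocycles X Y 0)
    (hg : g ∈ C.cocycles Y Z 0) : f ≫ g ∈ C.cocycles X Z 0 := by
  refine ⟨by simpa using DGCategory.comp_mem (K := K) hf.1 hg.1, ?_⟩
  have h := DGCategory.d_comp (K := K) f hg.1
  have h1 : DGCategory.d (K := K) X Y f = 0 := hf.2
  have h2 : DGCategory.d (K := K) Y Z g = 0 := hg.2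
  simpa [h1, h2] using h

theorem comp_sub_comp_mem_coboundaries {X Y Z : C.Obj} {f f' : X ⟶ Y} {g g' : Y ⟶ Z}
    (hf' : f' ∈ C.cocycles X Y 0) (hg : g ∈ C.cocycles Y Z 0)
    (h₁ : f - f' ∈ C.coboundaries X Y 0) (h₂ : g - g' ∈ C.coboundaries Y Z 0) :
    f ≫ g - f' ≫ g' ∈ C.coboundaries X Z 0 := by
  obtain ⟨h, hh, eh⟩ := h₁
  obtain ⟨k, hk, ek⟩ := h₂
  have hf0 : DGCategory.d (K := K) X Y f' = 0 := hf'.2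
  have hg0 : DGCategory.d (K := K) Y Z g = 0 := hg.2
  refine ⟨h ≫ g + f' ≫ k, add_mem ?_ ?_, ?_⟩
  · simpa using DGCategory.comp_mem (K := K) hh hg.1
  · simpa using DGCategory.comp_mem (K := K) hf'.1 hk
  · have e1 := DGCategory.d_comp (K := K) h hg.1
    have e2 := DGCategory.d_comp (K := K) f' hk
    simp only [hg0, hf0, Limits.comp_zero, Limits.zero_comp, smul_zero, add_zero, zero_add,
      Int.negOnePow_zero, one_smul] at e1 e2
    change DGCategory.d (K := K) X Y h = _ at eh
    change DGCategory.d (K := K) Y Z k = _ at ek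
    change DGCategory.d (K := K) X Z _ = _
    rw [_root_.map_add, e1, e2, eh, ek]
    simp

variable (C) in
/-- The homotopy category `H^0(C)`: the objects of `C`, with `H^0` of the Hom complexes as
morphisms. -/
structure H0 where
  obj : C.Obj

instance : Category.{u} (H0 C) where
  Hom X Y := C.Cohomology X.obj Y.obj 0
  id X := Submodule.Quotient.mk ⟨𝟙 X.obj, id_mem_cocycles X.obj⟩
  comp {X Y Z} := Quotient.map₂
    (fun f g => ⟨f.1 ≫ g.1, comp_mem_cocycles f.2 g.2⟩) (by
      intro f f' hf g g' hg
      have hf' := (Submodule.quotientRel_def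
        ((C.coboundaries X.obj Y.obj 0).submoduleOf (C.cocycles X.obj Y.obj 0))).1 hf
      have hg' := (Submodule.quotientRel_def
        ((C.coboundaries Y.obj Z.obj 0).submoduleOf (C.cocycles Y.obj Z.obj 0))).1 hg
      exact (Submodule.quotientRel_def
        ((C.coboundaries X.obj Z.obj 0).submoduleOf (C.cocycles X.obj Z.obj 0))).2
        (comp_sub_comp_mem_coboundaries f'.2 g.2 hf' hg'))
  id_comp f := by
    induction f using Quotient.inductionOn
    exact congrArg (Quotient.mk _) (Subtype.ext (Category.id_comp _))
  comp_id f := by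
    induction f using Quotient.inductionOn
    exact congrArg (Quotient.mk _) (Subtype.ext (Category.comp_id _))
  assoc f g h := by
    induction f using Quotient.inductionOn
    induction g using Quotient.inductionOn
    induction h using Quotient.inductionOn
    exact congrArg (Quotient.mk _) (Subtype.ext (Category.assoc _ _ _))

end DGCat

namespace DGFunctor

variable {C D : DGCat K} (F : DGFunctor C D)

/-- The linear map on Hom modules induced by a dg functor. -/
def mapHom (X Y : C.Obj) : (X ⟶ Y) →ₗ[K] (F.obj X ⟶ F.obj Y) where
  toFun f := F.map f
  map_add' := F.map_add
  map_smul' := F.map_smul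

theorem map_mem_cocycles {X Y : C.Obj} {n : ℤ} {f : X ⟶ Y} (hf : f ∈ C.cocycles X Y n) :
    F.map f ∈ D.cocycles (F.obj X) (F.obj Y) n := by
  refine ⟨F.map_mem hf.1, ?_⟩
  have h : C.d X Y f = 0 := hf.2
  have h' := F.map_d f
  rw [h] at h'
  exact h'.symm.trans (_root_.map_zero (F.mapHom X Y))

theorem map_mem_coboundaries {X Y : C.Obj} {n : ℤ} {f : X ⟶ Y}
    (hf : f ∈ C.coboundaries X Y n) : F.map f ∈ D.coboundaries (F.obj X) (F.obj Y) n := by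
  obtain ⟨h, hh, rfl⟩ := hf
  exact ⟨F.map h, F.map_mem hh, (F.map_d h).symm⟩

/-- The map induced on `H^n` of the Hom complexes by a dg functor. -/
def cohomologyMap (X Y : C.Obj) (n : ℤ) :
    C.Cohomology X Y n →ₗ[K] D.Cohomology (F.obj X) (F.obj Y) n :=
  Submodule.mapQ _ _ ((F.mapHom X Y).restrict fun _ hf => F.map_mem_cocycles hf)
    fun _ hf => F.map_mem_coboundaries hf

/-- The functor `H^0(F) : H^0(C) ⥤ H^0(D)`. -/
def h0 : C.H0 ⥤ D.H0 where
  obj X := ⟨F.obj X.obj⟩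
  map {X Y} f := F.cohomologyMap X.obj Y.obj 0 f
  map_id X := congrArg (Quotient.mk _) (Subtype.ext (F.map_id X.obj))
  map_comp f g := by
    induction f using Quotient.inductionOn
    induction g using Quotient.inductionOn
    exact congrArg (Quotient.mk _) (Subtype.ext (F.map_comp _ _))

/-- `F` induces quasi-isomorphisms on all Hom complexes. -/
def QuasiFullyFaithful : Prop :=
  ∀ (X Y : C.Obj) (n : ℤ), Function.Bijective (F.cohomologyMap X Y n)

/-- `F` is quasi-fully faithful and `H^0(F)` is dense (essentially surjective). -/
def IsQuasiEquivalence : Prop :=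
  F.QuasiFullyFaithful ∧ F.h0.EssSurj

end DGFunctor

/-- The class of quasi-equivalences between small dg categories. -/
def quasiEquivalences (K : Type u) [CommRing K] : MorphismProperty (DGCat K) :=
  fun _ _ F => DGFunctor.IsQuasiEquivalence F

end Cohomology

/-! ### Dg categories on graded quivers -/

/-- A graded quiver. -/
class GradedQuiver (V : Type u) extends Quiver.{u} V where
  /-- the degree of an arrow -/
  deg {a b : V} : (a ⟶ b) → ℤ

namespace GradedQuiver

variable (K : Type u) [CommRing K] {V : Type u} [GradedQuiver V]

/-- The `K`-linearization of the path category of the quiver `V`. -/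
abbrev PathCat (V : Type u) [GradedQuiver V] : Type u := Free K (Paths V)

/-- A vertex as an object of the path category. -/
abbrev pt (a : V) : PathCat K V := Free.of K ((Paths.of V).obj a)

/-- A path as a morphism of the linearized path category. -/
noncomputable abbrev ofPath {a b : V} (p : Quiver.Path a b) : pt K a ⟶ pt K b :=
  (Free.embedding K (Paths V)).map p

/-- An arrow as a morphism of the linearized path category. -/
noncomputable abbrev ofArr {a b : V} (e : a ⟶ b) : pt K a ⟶ pt K b :=
  ofPath K (Quiver.Hom.toPath (V := V) e)

/-- The degree of a path, the sum of the degrees of its arrows. -/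
def pathDeg {a : V} : {b : V} → Quiver.Path a b → ℤ
  | _, .nil => 0
  | _, .cons p e => pathDeg p + deg e

/-- The homogeneous morphisms of degree `n`: the span of the paths of degree `n`. -/
def gr (X Y : PathCat K V) (n : ℤ) : Submodule K (X ⟶ Y) :=
  Finsupp.supported K K {p : Quiver.Path (V := V) X Y | pathDeg p = n}

variable {K}

/-- The extension of a map on arrows to paths by the Leibniz rule
`d (e ∘ p) = d e ∘ p + (-1) ^ |e| e ∘ d p`. -/
noncomputable def dPath (δ : ∀ ⦃a b : V⦄, (a ⟶ b) → (pt K a ⟶ pt K b)) {a : V} :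
    {b : V} → Quiver.Path a b → (pt K a ⟶ pt K b)
  | _, .nil => 0
  | _, .cons p e => ofPath K p ≫ δ e + (deg e).negOnePow • (dPath δ p ≫ ofArr K e)

/-- The `K`-linear derivation of the path category extending a map given on arrows. -/
noncomputable def dLin (δ : ∀ ⦃a b : V⦄, (a ⟶ b) → (pt K a ⟶ pt K b))
    (X Y : PathCat K V) : (X ⟶ Y) →ₗ[K] (X ⟶ Y) :=
  Finsupp.linearCombination K fun p : Quiver.Path (V := V) X Y => dPath δ p

variable (δ : ∀ ⦃a b : V⦄, (a ⟶ b) → (pt K a ⟶ pt K b))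

theorem ofPath_nil (a : V) : ofPath K (Quiver.Path.nil : Quiver.Path a a) = 𝟙 (pt K a) := rfl

theorem ofPath_comp {a b c : V} (p : Quiver.Path a b) (q : Quiver.Path b c) :
    ofPath K (p.comp q) = ofPath K p ≫ ofPath K q :=
  (Free.embedding K (Paths V)).map_comp p q

theorem ofPath_cons {a b c : V} (p : Quiver.Path a b) (e : b ⟶ c) :
    ofPath K (p.cons e) = ofPath K p ≫ ofArr K e :=
  ofPath_comp p (Quiver.Hom.toPath (V := V) e)

theorem pathDeg_comp {a b c : V} (p : Quiver.Path a b) (q : Quiver.Path b c) :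
    pathDeg (p.comp q) = pathDeg p + pathDeg q := by
  induction q with
  | nil => simp [pathDeg]
  | cons q e ih => simp [pathDeg, ih, add_assoc]

theorem ofPath_mem {a b : V} (p : Quiver.Path a b) :
    ofPath K p ∈ gr K (pt K a) (pt K b) (pathDeg p) :=
  Finsupp.single_mem_supported K _ rfl

theorem ofArr_mem {a b : V} (e : a ⟶ b) :
    ofArr K e ∈ gr K (pt K a) (pt K b) (deg e) := by
  have h := ofPath_mem (K := K) (Quiver.Hom.toPath (V := V) e)
  rwa [show pathDeg (Quiver.Hom.toPath (V := V) e) = deg e from zero_add _] at h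

/-- Induction on homogeneous morphisms of the linearized path category. -/
theorem gr_induction {a b : V} {n : ℤ} {P : (pt K a ⟶ pt K b) → Prop}
    (h0 : P 0) (hadd : ∀ f g, P f → P g → P (f + g)) (hsmul : ∀ (r : K) f, P f → P (r • f))
    (hp : ∀ p : Quiver.Path a b, pathDeg p = n → P (ofPath K p))
    {f : pt K a ⟶ pt K b} (hf : f ∈ gr K (pt K a) (pt K b) n) : P f := by
  have h : f ∈ Submodule.span K
      ((fun p : Quiver.Path (V := V) a b => ofPath K p) '' {p | pathDeg p = n}) := by
    have := hf
    unfold gr at this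
    rw [Finsupp.supported_eq_span_single] at this
    exact this
  refine Submodule.span_induction ?_ h0 (fun f g _ _ => hadd f g) (fun r f _ => hsmul r f) h
  rintro _ ⟨p, hp', rfl⟩
  exact hp p hp'

/-- Induction on morphisms of the linearized path category. -/
theorem hom_induction {a b : V} {P : (pt K a ⟶ pt K b) → Prop}
    (h0 : P 0) (hadd : ∀ f g, P f → P g → P (f + g)) (hsmul : ∀ (r : K) f, P f → P (r • f))
    (hp : ∀ p : Quiver.Path a b, P (ofPath K p)) (f : pt K a ⟶ pt K b) : P f := by
  refine Finsupp.induction_linear (motive := P) f h0 hadd ?_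
  intro p r
  have : (Finsupp.single p r : pt K a ⟶ pt K b) = r • ofPath K p := by
    exact (Finsupp.smul_single_one p r).symm
  exact this ▸ hsmul r _ (hp p)

theorem dLin_ofPath {a b : V} (p : Quiver.Path a b) :
    dLin δ (pt K a) (pt K b) (ofPath K p) = dPath δ p := by
  exact (Finsupp.linearCombination_single K (1 : K) p).trans (one_smul K _)

theorem dLin_ofArr {a b : V} (e : a ⟶ b) :
    dLin δ (pt K a) (pt K b) (ofArr K e) = δ e := by
  refine (dLin_ofPath δ _).trans ?_
  change ofPath K .nil ≫ δ e + (deg e).negOnePow • ((0 : pt K a ⟶ pt K a) ≫ _) = _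
  rw [ofPath_nil]
  simp

theorem isInternal_gr (a b : V) :
    DirectSum.IsInternal (gr K (pt K a) (pt K b)) := by
  refine DirectSum.isInternal_submodule_of_iSupIndep_of_iSup_eq_top ?_ ?_
  · intro n
    have h : (⨆ m, ⨆ _ : m ≠ n, gr K (pt K a) (pt K b) m) ≤
        Finsupp.supported K K {p : Quiver.Path a b | pathDeg p ≠ n} :=
      iSup₂_le fun m hm => Finsupp.supported_mono fun p hp h => hm (hp.symm.trans h)
    exact Disjoint.mono_right h (Finsupp.disjoint_supported_supported
      (Set.disjoint_left.2 fun p hp hp' => hp' hp))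
  · refine eq_top_iff.2 fun f _ => ?_
    refine hom_induction (P := fun f => f ∈ ⨆ n, gr K (pt K a) (pt K b) n) (zero_mem _)
      (fun _ _ => add_mem) (fun r _ => Submodule.smul_mem _ r) (fun p => ?_) f
    exact Submodule.mem_iSup_of_mem (pathDeg p) (ofPath_mem p)

theorem comp_mem_gr {a b c : V} {p q : ℤ} {f : pt K a ⟶ pt K b} {g : pt K b ⟶ pt K c}
    (hf : f ∈ gr K _ _ p) (hg : g ∈ gr K _ _ q) :
    f ≫ g ∈ gr K (pt K a) (pt K c) (p + q) := by
  refine gr_induction (P := fun f => f ≫ g ∈ gr K (pt K a) (pt K c) (p + q))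
    (by simp) (fun f f' h h' => ?_) (fun r f h => ?_) (fun x hx => ?_) hf
  · rw [Preadditive.add_comp]; exact add_mem h h'
  · rw [Linear.smul_comp]; exact Submodule.smul_mem _ _ h
  refine gr_induction (P := fun g => ofPath K x ≫ g ∈ gr K (pt K a) (pt K c) (p + q))
    (by simp) (fun f f' h h' => ?_) (fun r f h => ?_) (fun y hy => ?_) hg
  · rw [Preadditive.comp_add]; exact add_mem h h'
  · rw [Linear.comp_smul]; exact Submodule.smul_mem _ _ h
  rw [← ofPath_comp, ← hx, ← hy, ← pathDeg_comp]
  exact ofPath_mem _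

theorem comp_mem_gr' {a b c : V} {p q n : ℤ} {f : pt K a ⟶ pt K b}
    {g : pt K b ⟶ pt K c} (hf : f ∈ gr K _ _ p) (hg : g ∈ gr K _ _ q) (h : p + q = n) :
    f ≫ g ∈ gr K (pt K a) (pt K c) n :=
  h ▸ comp_mem_gr hf hg

theorem dPath_mem (hδ : ∀ ⦃a b : V⦄ (e : a ⟶ b), δ e ∈ gr K _ _ (deg e + 1))
    {a b : V} (p : Quiver.Path a b) :
    dPath δ p ∈ gr K (pt K a) (pt K b) (pathDeg p + 1) := by
  induction p with
  | nil => exact zero_mem _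
  | cons p e ih =>
    refine add_mem ?_ ?_
    · have := comp_mem_gr (ofPath_mem (K := K) p) (hδ e)
      rwa [← add_assoc] at this
    · have := comp_mem_gr ih (ofArr_mem (K := K) e)
      rw [add_right_comm] at this
      rw [Units.smul_def]
      exact zsmul_mem this _

theorem dLin_mem (hδ : ∀ ⦃a b : V⦄ (e : a ⟶ b), δ e ∈ gr K _ _ (deg e + 1))
    {a b : V} {n : ℤ} {f : pt K a ⟶ pt K b} (hf : f ∈ gr K _ _ n) :
    dLin δ _ _ f ∈ gr K (pt K a) (pt K b) (n + 1) := by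
  refine gr_induction (P := fun f => dLin δ _ _ f ∈ gr K (pt K a) (pt K b) (n + 1))
    (by simp) (fun f f' h h' => ?_) (fun r f h => ?_) (fun x hx => ?_) hf
  · rw [map_add]; exact add_mem h h'
  · rw [map_smul]; exact Submodule.smul_mem _ _ h
  · rw [dLin_ofPath, ← hx]; exact dPath_mem δ hδ x

theorem dPath_comp {a b c : V} (p : Quiver.Path a b) (q : Quiver.Path b c) :
    dPath δ (p.comp q) = ofPath K p ≫ dPath δ q +
      (pathDeg q).negOnePow • (dPath δ p ≫ ofPath K q) := by
  induction q with
  | nil => simp [dPath, pathDeg, ofPath_nil]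
  | cons q e ih =>
    rw [Quiver.Path.comp_cons]
    simp only [dPath, pathDeg, ih, ofPath_comp, ofPath_cons, Preadditive.comp_add,
      Preadditive.add_comp, Category.assoc, smul_add, Int.negOnePow_add, Linear.units_smul_comp,
      Linear.comp_units_smul, smul_smul]
    rw [add_assoc, mul_comm]

theorem dLin_comp {a b c : V} {q : ℤ} (f : pt K a ⟶ pt K b) {g : pt K b ⟶ pt K c}
    (hg : g ∈ gr K _ _ q) :
    dLin δ _ _ (f ≫ g) = f ≫ dLin δ _ _ g + q.negOnePow • (dLin δ _ _ f ≫ g) := by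
  refine gr_induction (P := fun g => dLin δ _ _ (f ≫ g) =
    f ≫ dLin δ _ _ g + q.negOnePow • (dLin δ _ _ f ≫ g)) (by simp) (fun g g' h h' => ?_)
    (fun r g h => ?_) (fun y hy => ?_) hg
  · simp only [Preadditive.comp_add, map_add, h, h', smul_add]; abel
  · simp only [Linear.comp_smul, map_smul, h, smul_add]; rw [smul_comm]
  refine hom_induction (P := fun f => dLin δ _ _ (f ≫ ofPath K y) =
    f ≫ dLin δ _ _ (ofPath K y) + q.negOnePow • (dLin δ _ _ f ≫ ofPath K y)) (by simp)
    (fun f f' h h' => ?_) (fun r f h => ?_) (fun x => ?_) f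
  · simp only [Preadditive.add_comp, map_add, h, h', smul_add]; abel
  · simp only [Linear.smul_comp, map_smul, h, smul_add]; rw [smul_comm]
  rw [← ofPath_comp, dLin_ofPath, dLin_ofPath, dLin_ofPath, dPath_comp, hy]

theorem dLin_id (a : V) : dLin δ _ _ (𝟙 (pt K a)) = 0 :=
  dLin_ofPath δ (Quiver.Path.nil : Quiver.Path a a)

theorem dLin_comp_sub_id {a b : V} (f : a ⟶ b) (g : b ⟶ a) (hf : δ f = 0) (hg : δ g = 0) :
    dLin δ _ _ (ofArr K f ≫ ofArr K g - 𝟙 (pt K a)) = 0 := by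
  rw [map_sub, dLin_id, dLin_comp _ _ (ofArr_mem g), dLin_ofArr, dLin_ofArr, hf, hg]
  simp

theorem dLin_comp_sub_comp {a b : V} (f : a ⟶ b) (g : b ⟶ a) (h₁ : a ⟶ a)
    (h₂ : b ⟶ b) (hf : δ f = 0) (ef : deg f = 0)
    (hh₁ : δ h₁ = ofArr K f ≫ ofArr K g - 𝟙 (pt K a))
    (hh₂ : δ h₂ = ofArr K g ≫ ofArr K f - 𝟙 (pt K b)) :
    dLin δ _ _ (ofArr K f ≫ ofArr K h₂ - ofArr K h₁ ≫ ofArr K f) = 0 := by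
  rw [map_sub, dLin_comp _ _ (ofArr_mem h₂), dLin_comp _ _ (ofArr_mem f), dLin_ofArr, dLin_ofArr,
    dLin_ofArr, hf, hh₁, hh₂, ef]
  simp

theorem dLin_dLin (hδ : ∀ ⦃a b : V⦄ (e : a ⟶ b), δ e ∈ gr K _ _ (deg e + 1))
    (hδδ : ∀ ⦃a b : V⦄ (e : a ⟶ b), dLin δ _ _ (δ e) = 0)
    {a b : V} (f : pt K a ⟶ pt K b) : dLin δ _ _ (dLin δ _ _ f) = 0 := by
  refine hom_induction (P := fun f => dLin δ _ _ (dLin δ _ _ f) = 0) (by simp)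
    (fun f f' h h' => by simp [h, h']) (fun r f h => by simp [h]) (fun p => ?_) f
  rw [dLin_ofPath]
  clear f
  induction p with
  | nil => exact map_zero _
  | cons p e ih =>
    simp only [dPath, map_add]
    rw [Units.smul_def, map_zsmul, dLin_comp δ _ (hδ e), dLin_comp δ _ (ofArr_mem e), ih,
      hδδ, dLin_ofPath, dLin_ofArr]
    simp [Int.negOnePow_succ, Units.smul_def]

/-- The dg category whose underlying graded category is the graded path category of `V`, with the
differential determined by its values `δ` on arrows and the Leibniz rule. -/
noncomputable def dgCat (hδ : ∀ ⦃a b : V⦄ (e : a ⟶ b), δ e ∈ gr K _ _ (deg e + 1))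
    (hδδ : ∀ ⦃a b : V⦄ (e : a ⟶ b), dLin δ _ _ (δ e) = 0) : DGCat K where
  Obj := PathCat K V
  dg :=
    { gr := gr K
      isInternal := fun X Y => isInternal_gr (V := V) X Y
      d := dLin δ
      d_mem := dLin_mem δ hδ
      d_d := dLin_dLin δ hδ hδδ
      id_mem := fun X => ofPath_mem (V := V) (K := K) (Quiver.Path.nil : Quiver.Path (V := V) X X)
      comp_mem := comp_mem_gr
      d_comp := dLin_comp δ }

section Lift

variable {C : DGCat K} (φ : V → C.Obj) (ψ : ∀ ⦃a b : V⦄, (a ⟶ b) → (φ a ⟶ φ b))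

/-- The image of a path, given the images of the vertices and arrows. -/
def pathMap {a : V} : {b : V} → Quiver.Path a b → (φ a ⟶ φ b)
  | _, .nil => 𝟙 (φ a)
  | _, .cons p e => pathMap p ≫ ψ e

/-- The `K`-linear extension of `pathMap`. -/
noncomputable def linMap (a b : V) : (pt K a ⟶ pt K b) →ₗ[K] (φ a ⟶ φ b) :=
  Finsupp.linearCombination K fun p : Quiver.Path a b => pathMap φ ψ p

theorem linMap_ofPath {a b : V} (p : Quiver.Path a b) :
    linMap φ ψ a b (ofPath K p) = pathMap φ ψ p :=
  (Finsupp.linearCombination_single K (1 : K) p).trans (one_smul K _)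

theorem linMap_ofArr {a b : V} (e : a ⟶ b) : linMap φ ψ a b (ofArr K e) = ψ e :=
  (linMap_ofPath φ ψ _).trans (Category.id_comp _)

theorem linMap_id (a : V) : linMap φ ψ a a (𝟙 (pt K a)) = 𝟙 (φ a) :=
  linMap_ofPath φ ψ (Quiver.Path.nil : Quiver.Path a a)

theorem pathMap_comp {a b c : V} (p : Quiver.Path a b) (q : Quiver.Path b c) :
    pathMap φ ψ (p.comp q) = pathMap φ ψ p ≫ pathMap φ ψ q := by
  induction q with
  | nil => simp [pathMap]
  | cons q e ih => simp [pathMap, ih]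

theorem linMap_comp {a b c : V} (f : pt K a ⟶ pt K b) (g : pt K b ⟶ pt K c) :
    linMap φ ψ a c (f ≫ g) = linMap φ ψ a b f ≫ linMap φ ψ b c g := by
  refine hom_induction (P := fun f => linMap φ ψ a c (f ≫ g) =
    linMap φ ψ a b f ≫ linMap φ ψ b c g) (by simp) (fun f f' h h' => ?_) (fun r f h => ?_)
    (fun x => ?_) f
  · simp only [Preadditive.add_comp, map_add, h, h']
  · simp only [Linear.smul_comp, map_smul, h]
  refine hom_induction (P := fun g => linMap φ ψ a c (ofPath K x ≫ g) =
    linMap φ ψ a b (ofPath K x) ≫ linMap φ ψ b c g) (by simp) (fun f f' h h' => ?_)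
    (fun r f h => ?_) (fun y => ?_) g
  · simp only [Preadditive.comp_add, map_add, h, h']
  · simp only [Linear.comp_smul, map_smul, h]
  rw [← ofPath_comp, linMap_ofPath, linMap_ofPath, linMap_ofPath, pathMap_comp]

theorem pathMap_mem
    (hdeg : ∀ ⦃a b : V⦄ (e : a ⟶ b), ψ e ∈ C.gr (φ a) (φ b) (deg e))
    {a b : V} (p : Quiver.Path a b) : pathMap φ ψ p ∈ C.gr (φ a) (φ b) (pathDeg p) := by
  induction p with
  | nil => exact DGCategory.id_mem _
  | cons p e ih => exact DGCategory.comp_mem ih (hdeg e)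

theorem linMap_dPath
    (hdeg : ∀ ⦃a b : V⦄ (e : a ⟶ b), ψ e ∈ C.gr (φ a) (φ b) (deg e))
    (hd : ∀ ⦃a b : V⦄ (e : a ⟶ b), linMap φ ψ a b (δ e) = C.d (φ a) (φ b) (ψ e))
    {a b : V} (p : Quiver.Path a b) :
    linMap φ ψ a b (dPath δ p) = C.d (φ a) (φ b) (pathMap φ ψ p) := by
  induction p with
  | nil => exact (map_zero _).trans (DGCat.id_mem_cocycles (C := C) (φ a)).2.symm
  | cons p e ih =>
    refine Eq.trans ?_ (DGCategory.d_comp (K := K) _ (hdeg e)).symm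
    have he : pathMap φ ψ (Quiver.Hom.toPath (V := V) e) = ψ e := Category.id_comp _
    simp only [dPath, map_add, Units.smul_def, map_zsmul, linMap_comp, linMap_ofPath, hd, ih, he]

theorem linMap_mem
    (hdeg : ∀ ⦃a b : V⦄ (e : a ⟶ b), ψ e ∈ C.gr (φ a) (φ b) (deg e))
    {a b : V} {n : ℤ} {f : pt K a ⟶ pt K b} (hf : f ∈ gr K _ _ n) :
    linMap φ ψ a b f ∈ C.gr (φ a) (φ b) n := by
  refine gr_induction (P := fun f => linMap φ ψ a b f ∈ C.gr (φ a) (φ b) n)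
    (by simp) (fun f g h h' => ?_) (fun r f h => ?_) (fun p hp => ?_) hf
  · rw [map_add]; exact add_mem h h'
  · rw [map_smul]; exact Submodule.smul_mem _ _ h
  · rw [← hp, linMap_ofPath]; exact pathMap_mem φ ψ hdeg p

theorem linMap_dLin
    (hdeg : ∀ ⦃a b : V⦄ (e : a ⟶ b), ψ e ∈ C.gr (φ a) (φ b) (deg e))
    (hd : ∀ ⦃a b : V⦄ (e : a ⟶ b), linMap φ ψ a b (δ e) = C.d (φ a) (φ b) (ψ e))
    {a b : V} (f : pt K a ⟶ pt K b) :
    linMap φ ψ a b (dLin δ _ _ f) = C.d (φ a) (φ b) (linMap φ ψ a b f) := by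
  refine hom_induction (P := fun f => linMap φ ψ a b (dLin δ _ _ f) =
    C.d (φ a) (φ b) (linMap φ ψ a b f)) (by simp) (fun f g h h' => ?_) (fun r f h => ?_)
    (fun p => ?_) f
  · simp only [map_add, h, h']
  · simp only [map_smul, h]
  · rw [dLin_ofPath, linMap_ofPath]; exact linMap_dPath δ φ ψ hdeg hd p

/-- The dg functor out of `dgCat` determined by the images of the vertices and arrows. -/
noncomputable def lift (hδ : ∀ ⦃a b : V⦄ (e : a ⟶ b), δ e ∈ gr K _ _ (deg e + 1))
    (hδδ : ∀ ⦃a b : V⦄ (e : a ⟶ b), dLin δ _ _ (δ e) = 0)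
    (hdeg : ∀ ⦃a b : V⦄ (e : a ⟶ b), ψ e ∈ C.gr (φ a) (φ b) (deg e))
    (hd : ∀ ⦃a b : V⦄ (e : a ⟶ b), linMap φ ψ a b (δ e) = C.d (φ a) (φ b) (ψ e)) :
    dgCat δ hδ hδδ ⟶ C where
  obj := φ
  map {a b} f := linMap (K := K) φ ψ a b f
  map_id := linMap_id φ ψ
  map_comp := linMap_comp φ ψ
  map_add := map_add _
  map_smul := map_smul _
  map_mem := linMap_mem φ ψ hdeg
  map_d := linMap_dLin δ φ ψ hdeg hd

end Lift

end GradedQuiver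


/-! ### The generating sets -/

section Generators

open GradedQuiver

variable (K : Type u) [CommRing K]

/-- The quiver with vertices `* x`, one for every `x : V`, and no arrows. -/
structure Discr (V : Type u) : Type u where
  star ::
  val : V

instance (V : Type u) : GradedQuiver (Discr V) where
  Hom _ _ := PEmpty
  deg e := PEmpty.elim e

/-- The discrete dg category on the object set `V`: `Hom(X, X) = K`, and `Hom(X, Y) = 0` if
`X ≠ Y`. -/
noncomputable def discreteDG (V : Type u) : DGCat K :=
  dgCat (K := K) (V := Discr V) (fun _ _ e => PEmpty.elim e) (fun _ _ e => PEmpty.elim e)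
    (fun _ _ e => PEmpty.elim e)

variable {K} in
/-- The dg functor out of a discrete dg category determined by the images of the objects. -/
noncomputable def discreteLift {V : Type u} {C : DGCat K} (φ : V → C.Obj) : discreteDG K V ⟶ C :=
  lift (K := K) (V := Discr V) _ (fun x => φ x.val) (fun _ _ e => PEmpty.elim e) _ _
    (fun _ _ e => PEmpty.elim e) (fun _ _ e => PEmpty.elim e)

/-- The empty dg category. -/
noncomputable abbrev emptyDG : DGCat K := discreteDG K PEmpty

/-- `K` as a discrete dg category with a single object. -/
noncomputable abbrev unitDG : DGCat K := discreteDG K PUnit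

/-- The indices of the two objects of `K ∐ K`. -/
inductive Two : Type u
  | one
  | two

/-- `K ∐ K`, the discrete dg category with two objects. -/
noncomputable abbrev twoDG : DGCat K := discreteDG K Two

/-- The vertices `1` and `2` of the quiver of `S(n)`. -/
inductive SphereVert (n : ℤ) : Type u
  | one
  | two

/-- The arrow `u : 1 ⟶ 2` of the quiver of `S(n)`. -/
inductive SphereArr (n : ℤ) : SphereVert.{u} n → SphereVert.{u} n → Type u
  | u : SphereArr n .one .two

/-- The quiver of `S(n)`, with `|u| = -n`. -/
instance (n : ℤ) : GradedQuiver (SphereVert.{u} n) where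
  Hom := SphereArr n
  deg _ := -n

/-- The arrow `u`. -/
def SphereVert.u (n : ℤ) : (SphereVert.one : SphereVert.{u} n) ⟶ SphereVert.two := SphereArr.u

/-- The `n`-th sphere `S(n)`: objects `1, 2`, and a generator `u : 1 ⟶ 2` of degree `-n` with
`d u = 0`. -/
noncomputable def sphere (n : ℤ) : DGCat K :=
  dgCat (K := K) (V := SphereVert n) (fun _ _ _ => 0) (fun _ _ _ => zero_mem _)
    (fun _ _ _ => map_zero _)

/-- The vertices `1` and `2` of the quiver of `D(n)`. -/
inductive DiscVert (n : ℤ) : Type u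
  | one
  | two

/-- The arrows `t, dt : 1 ⟶ 2` of the quiver of `D(n)`. -/
inductive DiscArr (n : ℤ) : DiscVert.{u} n → DiscVert.{u} n → Type u
  | t : DiscArr n .one .two
  | dt : DiscArr n .one .two

/-- The quiver of `D(n)`, with `|t| = -n` and `|dt| = 1 - n`. -/
instance (n : ℤ) : GradedQuiver (DiscVert.{u} n) where
  Hom := DiscArr n
  deg
    | .t => -n
    | .dt => 1 - n

namespace DiscVert

/-- The arrow `t`. -/
def t (n : ℤ) : (one : DiscVert.{u} n) ⟶ two := DiscArr.t

/-- The arrow `dt`. -/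
def dt (n : ℤ) : (one : DiscVert.{u} n) ⟶ two := DiscArr.dt

end DiscVert

/-- The differential of `D(n)` on generators: `t ↦ dt` and `dt ↦ 0`. -/
noncomputable def discD (n : ℤ) : ∀ ⦃a b : DiscVert.{u} n⦄, (a ⟶ b) → (pt K a ⟶ pt K b)
  | _, _, .t => ofArr K (DiscVert.dt n)
  | _, _, .dt => 0

theorem ofArr_dt_mem (n : ℤ) :
    ofArr K (DiscVert.dt.{u} (n + 1)) ∈ gr K (pt K .one) (pt K .two) (-n) := by
  have h := ofArr_mem (K := K) (DiscVert.dt.{u} (n + 1))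
  have e : deg (DiscVert.dt.{u} (n + 1)) = -n := by
    change 1 - (n + 1) = -n
    ring
  rwa [e] at h

theorem discD_mem (n : ℤ) ⦃a b : DiscVert.{u} n⦄ (e : a ⟶ b) :
    discD K n e ∈ gr K (pt K a) (pt K b) (deg e + 1) := by
  match a, b, e with
  | _, _, .t =>
    have h := ofArr_mem (K := K) (DiscVert.dt.{u} n)
    have e : deg (DiscVert.dt.{u} n) = -n + 1 := by
      change 1 - n = -n + 1
      ring
    rwa [e] at h
  | _, _, .dt => exact zero_mem _

theorem discD_discD (n : ℤ) ⦃a b : DiscVert.{u} n⦄ (e : a ⟶ b) :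
    dLin (discD K n) _ _ (discD K n e) = 0 := by
  match a, b, e with
  | _, _, .t => exact dLin_ofArr (discD K n) (DiscVert.dt n)
  | _, _, .dt => exact map_zero _

/-- The `n`-th disc `D(n)`: objects `1, 2`, and generators `t, dt : 1 ⟶ 2` of degrees `-n` and
`1 - n`, with `d t = dt` and `d dt = 0`. -/
noncomputable def disc (n : ℤ) : DGCat K :=
  dgCat (discD K n) (discD_mem K n) (discD_discD K n)

/-- The vertices `1` and `2` of the quiver of `𝒦`. -/
inductive KVert : Type u
  | one
  | two

/-- The arrows `f : 1 ⟶ 2`, `g : 2 ⟶ 1`, `h₁ : 1 ⟶ 1`, `h₂ : 2 ⟶ 2`, `r : 1 ⟶ 2` of the quiver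
of `𝒦`. -/
inductive KArr : KVert.{u} → KVert.{u} → Type u
  | f : KArr .one .two
  | g : KArr .two .one
  | h₁ : KArr .one .one
  | h₂ : KArr .two .two
  | r : KArr .one .two

/-- The quiver of `𝒦`, with `|f| = |g| = 0`, `|h₁| = |h₂| = -1` and `|r| = -2`. -/
instance : GradedQuiver KVert.{u} where
  Hom := KArr
  deg
    | .f => 0
    | .g => 0
    | .h₁ => -1
    | .h₂ => -1
    | .r => -2

namespace KVert

/-- The arrow `f`. -/
def f : (one : KVert.{u}) ⟶ two := KArr.f

/-- The arrow `g`. -/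
def g : (two : KVert.{u}) ⟶ one := KArr.g

/-- The arrow `h₁`. -/
def h₁ : (one : KVert.{u}) ⟶ one := KArr.h₁

/-- The arrow `h₂`. -/
def h₂ : (two : KVert.{u}) ⟶ two := KArr.h₂

/-- The arrow `r`. -/
def r : (one : KVert.{u}) ⟶ two := KArr.r

end KVert

/-- The differential of `𝒦` on generators: `d f = 0 = d g`, `d h₁ = g ∘ f - Id₁`,
`d h₂ = f ∘ g - Id₂` and `d r = h₂ ∘ f - f ∘ h₁`. -/
noncomputable def kD : ∀ ⦃a b : KVert.{u}⦄, (a ⟶ b) → (pt K a ⟶ pt K b)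
  | _, _, .f => 0
  | _, _, .g => 0
  | _, _, .h₁ => ofArr K KVert.f ≫ ofArr K KVert.g - 𝟙 (pt K KVert.one)
  | _, _, .h₂ => ofArr K KVert.g ≫ ofArr K KVert.f - 𝟙 (pt K KVert.two)
  | _, _, .r => ofArr K KVert.f ≫ ofArr K KVert.h₂ - ofArr K KVert.h₁ ≫ ofArr K KVert.f

theorem kD_mem ⦃a b : KVert.{u}⦄ (e : a ⟶ b) :
    kD K e ∈ gr K (pt K a) (pt K b) (deg e + 1) := by
  have hid : ∀ a : KVert.{u}, 𝟙 (pt K a) ∈ gr K (pt K a) (pt K a) 0 := fun a =>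
    ofPath_mem (Quiver.Path.nil : Quiver.Path a a)
  have hf := ofArr_mem (K := K) KVert.f
  have hg := ofArr_mem (K := K) KVert.g
  have h1 := ofArr_mem (K := K) KVert.h₁
  have h2 := ofArr_mem (K := K) KVert.h₂
  match a, b, e with
  | _, _, .f => exact zero_mem _
  | _, _, .g => exact zero_mem _
  | _, _, .h₁ => exact sub_mem (comp_mem_gr' hf hg rfl) (hid _)
  | _, _, .h₂ => exact sub_mem (comp_mem_gr' hg hf rfl) (hid _)
  | _, _, .r => exact sub_mem (comp_mem_gr' hf h2 rfl) (comp_mem_gr' h1 hf rfl)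

theorem kD_kD ⦃a b : KVert.{u}⦄ (e : a ⟶ b) : dLin (kD K) _ _ (kD K e) = 0 := by
  match a, b, e with
  | _, _, .f => exact map_zero _
  | _, _, .g => exact map_zero _
  | _, _, .h₁ => exact dLin_comp_sub_id (kD K) KVert.f KVert.g rfl rfl
  | _, _, .h₂ => exact dLin_comp_sub_id (kD K) KVert.g KVert.f rfl rfl
  | _, _, .r => exact dLin_comp_sub_comp (kD K) KVert.f KVert.g KVert.h₁ KVert.h₂ rfl rfl rfl rfl

/-- The dg category `𝒦`, freely generated as a graded category by `f, g, h₁, h₂, r`. -/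
noncomputable def kDG : DGCat K :=
  dgCat (kD K) (kD_mem K) (kD_kD K)

/-- `σ : K ⟶ 𝒦`, `* ↦ 1`. -/
noncomputable def sigma : unitDG K ⟶ kDG K :=
  discreteLift (C := kDG K) fun _ => pt (V := KVert) K .one

/-- `ρ_n : K ∐ K ⟶ D(n)`, `*_i ↦ i`. -/
noncomputable def rho (n : ℤ) : twoDG K ⟶ disc K n :=
  discreteLift (C := disc K n) fun
    | .one => pt (V := DiscVert _) K .one
    | .two => pt (V := DiscVert _) K .two

/-- `∅ ⟶ K`. -/
noncomputable def emptyToUnit : emptyDG K ⟶ unitDG K :=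
  discreteLift fun x => x.elim

/-- `ι_n : S(n) ⟶ D(n + 1)` on objects: `i ↦ i`. -/
def iotaObj (n : ℤ) : SphereVert.{u} n → (disc.{u} K (n + 1)).Obj
  | .one => pt (V := DiscVert _) K .one
  | .two => pt (V := DiscVert _) K .two

/-- `ι_n : S(n) ⟶ D(n + 1)` on the generator: `u ↦ dt`. -/
noncomputable def iotaMap (n : ℤ) :
    ∀ ⦃a b : SphereVert.{u} n⦄, (a ⟶ b) → (iotaObj K n a ⟶ iotaObj K n b)
  | _, _, .u => ofArr (V := DiscVert (n + 1)) K (DiscVert.dt (n + 1))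

theorem iotaMap_mem (n : ℤ) ⦃a b : SphereVert.{u} n⦄ (e : a ⟶ b) :
    iotaMap K n e ∈ (disc K (n + 1)).gr (iotaObj K n a) (iotaObj K n b) (deg e) := by
  match a, b, e with
  | _, _, .u => exact ofArr_dt_mem K n

theorem iotaMap_d (n : ℤ) ⦃a b : SphereVert.{u} n⦄ (e : a ⟶ b) :
    (disc K (n + 1)).d (iotaObj K n a) (iotaObj K n b) (iotaMap K n e) = 0 := by
  match a, b, e with
  | _, _, .u => exact dLin_ofArr (discD K (n + 1)) (DiscVert.dt (n + 1))

/-- `ι_n : S(n) ⟶ D(n + 1)`, `i ↦ i` and `u ↦ dt`. -/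
noncomputable def iota (n : ℤ) : sphere K n ⟶ disc K (n + 1) :=
  lift (C := disc K (n + 1)) _ (iotaObj K n) (iotaMap K n) _ _ (iotaMap_mem K n)
    (fun _ _ e => (map_zero _).trans (iotaMap_d K n e).symm)

/-- The set `I = {∅ ⟶ K, ι_n : S(n) ⟶ D(n + 1) | n ∈ ℤ}`. -/
inductive generatingI : MorphismProperty (DGCat.{u} K)
  | emptyToUnit : generatingI (emptyToUnit K)
  | iota (n : ℤ) : generatingI (iota K n)

/-- The set `J = {ρ_n : K ∐ K ⟶ D(n), σ : K ⟶ 𝒦 | n ∈ ℤ}`. -/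
inductive generatingJ : MorphismProperty (DGCat.{u} K)
  | rho (n : ℤ) : generatingJ (rho K n)
  | sigma : generatingJ (sigma K)

end Generators

/-- The class `S`-cell: compositions `X₀ ⟶ colim Xᵢ` of sequences `X₀ ⟶ X₁ ⟶ X₂ ⟶ ⋯`
in which every `Xᵢ ⟶ Xᵢ₊₁` is a pushout of a small coproduct of elements of `S`. -/
def cell {C : Type (u + 1)} [Category.{u} C] (S : MorphismProperty C) : MorphismProperty C :=
  (MorphismProperty.coproducts.{u} S).pushouts.transfiniteCompositionsOfShape ℕ

/-! The two halves of the statement are proved independently.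

Quasi-equivalence: no pushout along `rho` or `sigma` is ever computed. A dg functor F : C → D has a
mapping path category `mapPath`, whose objects are homotopy equivalences p : F X → Y in D, and F
factors as `constPath`, which is quasi-fully faithful, followed by the projection `pathTgt`. Every
element of J has the left lifting property against `pathTgt` (`rlp_pathTgt`): a morphism of D lifts
to any two objects over its ends, and a dg functor out of 𝒦 provides a homotopy equivalence f by
which a given path can be prolonged, the generator r supplying the coherence that this needs.
Relative J-cells and pushouts of elements of J therefore lift against `pathTgt` as well. For such an
F, the square with `constPath` on top and the identity of D at the bottom has a lift s, so that F ≫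
s = `constPath` and s ≫ `pathTgt` = 𝟙. On cohomology these two equations make F bijective on Hom
complexes, and the path stored in s Y exhibits Y as homotopy equivalent to an object in the image of
F (`isQuasiEquivalence_of_section`).

Cells: a pushout of ι_n freely adjoins one morphism whose differential is a prescribed cocycle
(`isAttach_adjoinIncl`), and a pushout of ∅ → K adjoins one free object. Hence ρ_n is a composite of
two attachments (dt, then t), and σ is a composite of six (the object 2, then f, g, h₁, h₂, r), up
to isomorphism. Coproducts and pushouts of composites are again composites of coproducts and
pushouts, so a single step of a J-cell is a finite composite of steps of I-cells. Inserting the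
intermediate stages gives another sequence indexed by ℕ with the same colimit. The composites are
padded with identities to length 4 or 8, so that one operation `twoStep`, iterated, handles all of
them.

This argument uses small coproducts and pushouts of dg categories. They come from a construction of
all small colimits: the free dg category on the evident generators, modulo everything that all
cocones annihilate. -/

/-! ### Homogeneous components and signs in Hom modules. -/

section Graded

variable {K : Type u} [CommRing K]

/-- A family of submodules is an internal direct sum if it spans and admits projections. -/
theorem isInternal_of_projections {M : Type*} [AddCommGroup M] [Module K M] {ι : Type*}
    [DecidableEq ι] (A : ι → Submodule K M) (p : ι → M →ₗ[K] M)
    (hp : ∀ n, ∀ x ∈ A n, p n x = x) (hp' : ∀ m n, m ≠ n → ∀ x ∈ A m, p n x = 0)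
    (htop : ∀ x, x ∈ ⨆ n, A n) : DirectSum.IsInternal A := by
  refine DirectSum.isInternal_submodule_of_iSupIndep_of_iSup_eq_top (fun n => ?_)
    (eq_top_iff.2 fun x _ => htop x)
  rw [Submodule.disjoint_def]
  intro x hx hx'
  have h : (⨆ m, ⨆ _ : m ≠ n, A m) ≤ LinearMap.ker (p n) :=
    iSup₂_le fun m hm y hy => hp' m n hm y hy
  rw [← hp n x hx]
  exact h hx'

namespace DGCat

variable (C : DGCat K) (X Y : C.Obj)

/-- The decomposition of a Hom module into its homogeneous parts. -/
noncomputable def homEquiv : (X ⟶ Y) ≃ₗ[K] DirectSum ℤ fun n => C.gr X Y n :=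
  (LinearEquiv.ofBijective (DirectSum.coeLinearMap (C.gr X Y))
    (DGCategory.isInternal X Y)).symm

/-- The projection to the homogeneous part of degree `n`. -/
noncomputable def proj (n : ℤ) : (X ⟶ Y) →ₗ[K] (X ⟶ Y) :=
  (C.gr X Y n).subtype ∘ₗ DirectSum.component K ℤ (fun n => C.gr X Y n) n ∘ₗ
    (C.homEquiv X Y).toLinearMap

/-- The linear map which is multiplication by `(-1) ^ n` in degree `n`. -/
noncomputable def sgn : (X ⟶ Y) →ₗ[K] (X ⟶ Y) :=
  DirectSum.toModule K ℤ (X ⟶ Y) (fun n => n.negOnePow • (C.gr X Y n).subtype) ∘ₗ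
    (C.homEquiv X Y).toLinearMap

variable {C X Y}

theorem homEquiv_of_mem {n : ℤ} {f : X ⟶ Y} (hf : f ∈ C.gr X Y n) :
    C.homEquiv X Y f = DirectSum.lof K ℤ (fun n => C.gr X Y n) n ⟨f, hf⟩ := by
  refine (LinearEquiv.symm_apply_eq _).2 ?_
  exact (DirectSum.coeLinearMap_lof (C.gr X Y) n ⟨f, hf⟩).symm

theorem proj_of_mem {n : ℤ} {f : X ⟶ Y} (hf : f ∈ C.gr X Y n) : C.proj X Y n f = f := by
  simp [proj, homEquiv_of_mem hf, DirectSum.component.lof_self]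

theorem proj_of_mem_ne {m n : ℤ} (h : m ≠ n) {f : X ⟶ Y} (hf : f ∈ C.gr X Y m) :
    C.proj X Y n f = 0 := by
  simp [proj, homEquiv_of_mem hf, DirectSum.component.of, h]

theorem sgn_of_mem {n : ℤ} {f : X ⟶ Y} (hf : f ∈ C.gr X Y n) :
    C.sgn X Y f = n.negOnePow • f := by
  simp [sgn, homEquiv_of_mem hf, DirectSum.toModule_lof]

theorem mem_iSup_gr (f : X ⟶ Y) : f ∈ ⨆ n, C.gr X Y n := by
  rw [(DGCategory.isInternal (K := K) X Y).submodule_iSup_eq_top]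
  trivial

/-- Induction on morphisms: it suffices to treat homogeneous ones. -/
theorem homogeneous_induction {P : (X ⟶ Y) → Prop} (h0 : P 0)
    (hadd : ∀ f g, P f → P g → P (f + g)) (hh : ∀ n, ∀ f ∈ C.gr X Y n, P f) (f : X ⟶ Y) : P f :=
  Submodule.iSup_induction (motive := P) (fun n => C.gr X Y n) (mem_iSup_gr f) hh h0 hadd

theorem d_mem' {X Y : C.Obj} {m n : ℤ} {f : X ⟶ Y} (hf : f ∈ C.gr X Y m) (h : m + 1 = n) :
    C.d X Y f ∈ C.gr X Y n := h ▸ DGCategory.d_mem hf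

theorem comp_mem' {X Y Z : C.Obj} {p q n : ℤ} {f : X ⟶ Y} {g : Y ⟶ Z} (hf : f ∈ C.gr X Y p)
    (hg : g ∈ C.gr Y Z q) (h : p + q = n) : f ≫ g ∈ C.gr X Z n := h ▸ DGCategory.comp_mem hf hg

theorem d_d (f : X ⟶ Y) : C.d X Y (C.d X Y f) = 0 := DGCategory.d_d f

theorem d_id (X : C.Obj) : C.d X X (𝟙 X) = 0 := (id_mem_cocycles X).2

theorem id_mem (X : C.Obj) : 𝟙 X ∈ C.gr X X 0 := DGCategory.id_mem X

theorem d_comp {X Y Z : C.Obj} {q : ℤ} (f : X ⟶ Y) {g : Y ⟶ Z} (hg : g ∈ C.gr Y Z q) :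
    C.d X Z (f ≫ g) = f ≫ C.d Y Z g + q.negOnePow • (C.d X Y f ≫ g) := DGCategory.d_comp f hg

/-- The only term of the Leibniz rule whose sign depends on |g| contains d f, so g need not be
homogeneous. -/
theorem d_comp_closed {X Y Z : C.Obj} {f : X ⟶ Y} (hf : C.d X Y f = 0) (g : Y ⟶ Z) :
    C.d X Z (f ≫ g) = f ≫ C.d Y Z g := by
  refine homogeneous_induction (P := fun g => C.d X Z (f ≫ g) = f ≫ C.d Y Z g) (by simp)
    (fun g g' h h' => by simp [h, h']) (fun n g hg => ?_) g
  rw [d_comp f hg, hf]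
  simp

theorem smul_units_mem {n : ℤ} (ε : ℤˣ) {f : X ⟶ Y} (hf : f ∈ C.gr X Y n) :
    ε • f ∈ C.gr X Y n := by
  rw [Units.smul_def]
  exact zsmul_mem hf _

theorem sgn_mem {n : ℤ} {f : X ⟶ Y} (hf : f ∈ C.gr X Y n) : C.sgn X Y f ∈ C.gr X Y n := by
  rw [sgn_of_mem hf]
  exact smul_units_mem _ hf

/-- Degrees add under composition, so the sign is multiplicative. This is what makes composition in
the mapping path category associative. -/
theorem sgn_comp {X Y Z : C.Obj} (f : X ⟶ Y) (g : Y ⟶ Z) :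
    C.sgn X Z (f ≫ g) = C.sgn X Y f ≫ C.sgn Y Z g := by
  refine homogeneous_induction (P := fun f => C.sgn X Z (f ≫ g) = C.sgn X Y f ≫ C.sgn Y Z g)
    (by simp) (fun f f' h h' => by simp [h, h']) (fun p f hf => ?_) f
  refine homogeneous_induction (P := fun g => C.sgn X Z (f ≫ g) = C.sgn X Y f ≫ C.sgn Y Z g)
    (by simp) (fun f f' h h' => by simp [h, h']) (fun q g hg => ?_) g
  rw [sgn_of_mem hf, sgn_of_mem hg, sgn_of_mem (DGCategory.comp_mem hf hg), Int.negOnePow_add,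
    Linear.units_smul_comp, Linear.comp_units_smul, smul_smul]

theorem sgn_id (X : C.Obj) : C.sgn X X (𝟙 X) = 𝟙 X := by
  rw [sgn_of_mem (id_mem X)]
  simp

theorem d_units_smul (ε : ℤˣ) (f : X ⟶ Y) : C.d X Y (ε • f) = ε • C.d X Y f := by
  rw [Units.smul_def, Units.smul_def, _root_.map_zsmul]

end DGCat

namespace DGFunctor

variable {C D : DGCat K} (F : DGFunctor C D)

theorem map_zero (X Y : C.Obj) : F.map (0 : X ⟶ Y) = 0 := _root_.map_zero (F.mapHom X Y)

theorem map_sub {X Y : C.Obj} (f g : X ⟶ Y) : F.map (f - g) = F.map f - F.map g :=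
  _root_.map_sub (F.mapHom X Y) f g

theorem map_proj {X Y : C.Obj} (n : ℤ) (f : X ⟶ Y) :
    F.map (C.proj X Y n f) = D.proj _ _ n (F.map f) := by
  refine DGCat.homogeneous_induction (P := fun f => F.map (C.proj X Y n f) =
    D.proj _ _ n (F.map f)) (by simp [map_zero]) (fun f f' h h' => by simp [h, h', F.map_add])
    (fun m f hf => ?_) f
  rcases eq_or_ne m n with rfl | h
  · rw [DGCat.proj_of_mem hf, DGCat.proj_of_mem (F.map_mem hf)]
  · rw [DGCat.proj_of_mem_ne h hf, DGCat.proj_of_mem_ne h (F.map_mem hf), map_zero]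

end DGFunctor

end Graded

/-! ### The mapping path category and the criterion for quasi-equivalences. -/

section MappingPath

variable {K : Type u} [CommRing K]

/-- A closed morphism of degree `0` which is invertible up to homotopy. -/
def DGCat.IsHomotopyEquiv (C : DGCat K) {X Y : C.Obj} (p : X ⟶ Y) : Prop :=
  p ∈ C.cocycles X Y 0 ∧ ∃ g ∈ C.cocycles Y X 0,
    p ≫ g - 𝟙 X ∈ C.coboundaries X X 0 ∧ g ≫ p - 𝟙 Y ∈ C.coboundaries Y Y 0

theorem DGCat.isHomotopyEquiv_id {C : DGCat K} (X : C.Obj) : C.IsHomotopyEquiv (𝟙 X) :=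
  ⟨id_mem_cocycles X, 𝟙 X, id_mem_cocycles X, by simp, by simp⟩

theorem DGCat.cocycle_comp_coboundary {C : DGCat K} {X Y Z : C.Obj} {f : X ⟶ Y} {g : Y ⟶ Z}
    (hf : f ∈ C.cocycles X Y 0) (hg : g ∈ C.coboundaries Y Z 0) :
    f ≫ g ∈ C.coboundaries X Z 0 := by
  obtain ⟨k, hk, rfl⟩ := hg
  refine ⟨f ≫ k, comp_mem' hf.1 hk (by simp), d_comp_closed hf.2 k⟩

theorem DGCat.coboundary_comp_cocycle {C : DGCat K} {X Y Z : C.Obj} {f : X ⟶ Y} {g : Y ⟶ Z}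
    (hf : f ∈ C.coboundaries X Y 0) (hg : g ∈ C.cocycles Y Z 0) :
    f ≫ g ∈ C.coboundaries X Z 0 := by
  obtain ⟨k, hk, rfl⟩ := hf
  refine ⟨k ≫ g, comp_mem' hk hg.1 (by simp), ?_⟩
  rw [d_comp k hg.1, show C.d Y Z g = 0 from hg.2]
  simp

/-- The identity behind both parts is p q q' p' - 1 = p (q q' - 1) p' + (p p' - 1), in diagrammatic
order. It allows a path to be prolonged by a homotopy equivalence. -/
theorem DGCat.IsHomotopyEquiv.comp {C : DGCat K} {X Y Z : C.Obj} {p : X ⟶ Y} {q : Y ⟶ Z}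
    (hp : C.IsHomotopyEquiv p) (hq : C.IsHomotopyEquiv q) : C.IsHomotopyEquiv (p ≫ q) := by
  obtain ⟨hp, p', hp', h₁, h₂⟩ := hp
  obtain ⟨hq, q', hq', h₃, h₄⟩ := hq
  refine ⟨comp_mem_cocycles hp hq, q' ≫ p', comp_mem_cocycles hq' hp', ?_, ?_⟩
  · have h := cocycle_comp_coboundary hp (coboundary_comp_cocycle h₃ hp')
    have := add_mem h h₁
    simpa [Preadditive.comp_sub, Preadditive.sub_comp] using this
  · have h := cocycle_comp_coboundary hq' (coboundary_comp_cocycle h₂ hq)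
    have := add_mem h h₄
    simpa [Preadditive.comp_sub, Preadditive.sub_comp] using this

namespace DGFunctor

/-- The objects of the mapping path category of a dg functor. -/
structure MapPath {C D : DGCat K} (F : DGFunctor C D) : Type u where
  src : C.Obj
  tgt : D.Obj
  path : F.obj src ⟶ tgt
  isHomotopyEquiv : D.IsHomotopyEquiv path

namespace MapPath

variable {C D : DGCat K} {F : DGFunctor C D}

theorem path_mem (X : F.MapPath) : X.path ∈ D.gr _ _ 0 := X.isHomotopyEquiv.1.1

theorem d_path (X : F.MapPath) : D.d _ _ X.path = 0 := X.isHomotopyEquiv.1.2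

/-- The morphisms of the mapping path category. -/
abbrev Mor (X Y : F.MapPath) : Type u :=
  (X.src ⟶ Y.src) × (X.tgt ⟶ Y.tgt) × (F.obj X.src ⟶ Y.tgt)

/-- A triple (a, b, c) behaves like the triangular matrix with diagonal F a, b and corner entry c.
Composition is matrix multiplication, with the sign of moving b past the corner, whose degree is
shifted by one. -/
noncomputable instance : Category.{u} F.MapPath where
  Hom X Y := Mor X Y
  id X := (𝟙 _, 𝟙 _, 0)
  comp f g := (f.1 ≫ g.1, f.2.1 ≫ g.2.1,
    F.map f.1 ≫ g.2.2 + f.2.2 ≫ D.sgn _ _ g.2.1)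
  id_comp f := by simp
  comp_id f := by simp [DGCat.sgn_id]
  assoc f g h := by simp [DGCat.sgn_comp, add_assoc]

/-- A morphism of the mapping path category, given by its components. -/
abbrev mk' {X Y : F.MapPath} (a : X.src ⟶ Y.src) (b : X.tgt ⟶ Y.tgt) (c : F.obj X.src ⟶ Y.tgt) :
    X ⟶ Y := ((a, b, c) : Mor X Y)

theorem hom_ext {X Y : F.MapPath} {f g : X ⟶ Y} (h₁ : f.1 = g.1) (h₂ : f.2.1 = g.2.1)
    (h₃ : f.2.2 = g.2.2) : f = g := Prod.ext h₁ (Prod.ext h₂ h₃)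

@[simp] theorem id_fst (X : F.MapPath) : (𝟙 X : X ⟶ X).1 = 𝟙 _ := rfl
@[simp] theorem id_snd_fst (X : F.MapPath) : (𝟙 X : X ⟶ X).2.1 = 𝟙 _ := rfl
@[simp] theorem id_snd_snd (X : F.MapPath) : (𝟙 X : X ⟶ X).2.2 = 0 := rfl

section

variable {X Y Z : F.MapPath} (f : X ⟶ Y) (g : Y ⟶ Z)

@[simp] theorem comp_fst : (f ≫ g).1 = f.1 ≫ g.1 := rfl
@[simp] theorem comp_snd_fst : (f ≫ g).2.1 = f.2.1 ≫ g.2.1 := rfl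
@[simp] theorem comp_snd_snd :
    (f ≫ g).2.2 = F.map f.1 ≫ g.2.2 + f.2.2 ≫ D.sgn _ _ g.2.1 := rfl

end

instance (X Y : F.MapPath) : AddCommGroup (X ⟶ Y) := inferInstanceAs (AddCommGroup (Mor X Y))

instance (X Y : F.MapPath) : Module K (X ⟶ Y) := inferInstanceAs (Module K (Mor X Y))

section

variable {X Y : F.MapPath} (f g : X ⟶ Y)

@[simp] theorem add_fst : (f + g).1 = f.1 + g.1 := rfl
@[simp] theorem add_snd_fst : (f + g).2.1 = f.2.1 + g.2.1 := rfl
@[simp] theorem add_snd_snd : (f + g).2.2 = f.2.2 + g.2.2 := rfl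
@[simp] theorem sub_fst : (f - g).1 = f.1 - g.1 := rfl
@[simp] theorem sub_snd_fst : (f - g).2.1 = f.2.1 - g.2.1 := rfl
@[simp] theorem sub_snd_snd : (f - g).2.2 = f.2.2 - g.2.2 := rfl
@[simp] theorem zero_fst : (0 : X ⟶ Y).1 = 0 := rfl
@[simp] theorem zero_snd_fst : (0 : X ⟶ Y).2.1 = 0 := rfl
@[simp] theorem zero_snd_snd : (0 : X ⟶ Y).2.2 = 0 := rfl
@[simp] theorem smul_fst (r : K) : (r • f).1 = r • f.1 := rfl
@[simp] theorem smul_snd_fst (r : K) : (r • f).2.1 = r • f.2.1 := rfl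
@[simp] theorem smul_snd_snd (r : K) : (r • f).2.2 = r • f.2.2 := rfl
@[simp] theorem units_smul_fst (r : ℤˣ) : (r • f).1 = r • f.1 := rfl
@[simp] theorem units_smul_snd_fst (r : ℤˣ) : (r • f).2.1 = r • f.2.1 := rfl
@[simp] theorem units_smul_snd_snd (r : ℤˣ) : (r • f).2.2 = r • f.2.2 := rfl

end

instance : Preadditive F.MapPath where
  add_comp _ _ _ f f' g := hom_ext (by simp) (by simp) (by simp [F.map_add]; abel)
  comp_add _ _ _ f f' g := hom_ext (by simp) (by simp) (by simp; abel)

instance : Linear K F.MapPath where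
  smul_comp _ _ _ r f g := hom_ext (by simp) (by simp) (by simp [F.map_smul])
  comp_smul _ _ _ f r g := hom_ext (by simp) (by simp) (by simp)

/-- The homogeneous morphisms of degree `n` of the mapping path category. -/
def gr (X Y : F.MapPath) (n : ℤ) : Submodule K (X ⟶ Y) :=
  (C.gr X.src Y.src n).prod ((D.gr X.tgt Y.tgt n).prod (D.gr (F.obj X.src) Y.tgt (n - 1)))

/-- The differential of the mapping path category. -/
noncomputable def dMor (X Y : F.MapPath) : (X ⟶ Y) →ₗ[K] (X ⟶ Y) where
  toFun f := mk' (C.d _ _ f.1) (D.d _ _ f.2.1)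
    (X.path ≫ f.2.1 - F.map f.1 ≫ Y.path - D.d _ _ f.2.2)
  map_add' f g := hom_ext (by simp) (by simp) (by simp [F.map_add]; abel)
  map_smul' r f := hom_ext (by simp) (by simp) (by simp [F.map_smul, smul_sub])

theorem isInternal_gr (X Y : F.MapPath) : DirectSum.IsInternal (gr X Y) := by
  refine isInternal_of_projections _ (fun n => ((C.proj X.src Y.src n).prodMap
    ((D.proj X.tgt Y.tgt n).prodMap (D.proj (F.obj X.src) Y.tgt (n - 1))) :
      Mor X Y →ₗ[K] Mor X Y)) ?_ ?_ ?_
  · rintro n f ⟨h₁, h₂, h₃⟩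
    exact hom_ext (DGCat.proj_of_mem h₁) (DGCat.proj_of_mem h₂) (DGCat.proj_of_mem h₃)
  · rintro m n h f ⟨h₁, h₂, h₃⟩
    exact hom_ext (DGCat.proj_of_mem_ne h h₁) (DGCat.proj_of_mem_ne h h₂)
      (DGCat.proj_of_mem_ne (by simpa using h) h₃)
  · intro f
    have e : f = mk' f.1 0 0 + mk' 0 f.2.1 0 + mk' 0 0 f.2.2 :=
      hom_ext (by simp) (by simp) (by simp)
    rw [e]
    refine add_mem (add_mem ?_ ?_) ?_
    · refine DGCat.homogeneous_induction (P := fun a => (mk' a 0 0 : X ⟶ Y) ∈ ⨆ n, gr X Y n)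
        (zero_mem _) (fun a a' h h' => ?_) (fun n a h => ?_) f.1
      · convert! add_mem h h' using 1
        exact hom_ext (by simp) (by simp) (by simp)
      · exact Submodule.mem_iSup_of_mem n ⟨h, zero_mem _, zero_mem _⟩
    · refine DGCat.homogeneous_induction (P := fun a => (mk' 0 a 0 : X ⟶ Y) ∈ ⨆ n, gr X Y n)
        (zero_mem _) (fun a a' h h' => ?_) (fun n a h => ?_) f.2.1
      · convert! add_mem h h' using 1
        exact hom_ext (by simp) (by simp) (by simp)
      · exact Submodule.mem_iSup_of_mem n ⟨zero_mem _, h, zero_mem _⟩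
    · refine DGCat.homogeneous_induction (P := fun a => (mk' 0 0 a : X ⟶ Y) ∈ ⨆ n, gr X Y n)
        (zero_mem _) (fun a a' h h' => ?_) (fun n a h => ?_) f.2.2
      · convert! add_mem h h' using 1
        exact hom_ext (by simp) (by simp) (by simp)
      -- The third component of a morphism of degree m has degree m - 1, so a corner entry of degree
      -- n lies in total degree n + 1.
      · exact Submodule.mem_iSup_of_mem (n + 1) ⟨zero_mem _, zero_mem _, by simpa using h⟩

/-- A triple with a and b closed is closed exactly when d c = p b - F(a) p', that is, when c is a
homotopy filling the square formed by the two paths. In the Leibniz rule the two terms F(a) p' b',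
passing through the middle path, cancel; the square of the differential vanishes because the paths
are closed of degree 0. -/
noncomputable instance : DGCategory K F.MapPath where
  gr := gr
  isInternal := isInternal_gr
  d := dMor
  d_mem {X Y n f} hf := by
    obtain ⟨h₁, h₂, h₃⟩ := hf
    refine ⟨DGCategory.d_mem h₁, DGCategory.d_mem h₂, sub_mem (sub_mem ?_ ?_) ?_⟩
    · exact DGCat.comp_mem' X.path_mem h₂ (by ring)
    · exact DGCat.comp_mem' (F.map_mem h₁) Y.path_mem (by ring)
    · exact DGCat.d_mem' h₃ (by ring)
  d_d {X Y} f := by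
    refine hom_ext (DGCat.d_d _) (DGCat.d_d _) ?_
    simp only [dMor, LinearMap.coe_mk, AddHom.coe_mk, _root_.map_sub, DGCat.d_comp_closed X.d_path,
      DGCat.d_d, DGCat.d_comp _ Y.path_mem, Y.d_path, F.map_d, zero_snd_snd]
    simp
  id_mem X := ⟨DGCat.id_mem _, DGCat.id_mem _, zero_mem _⟩
  comp_mem {X Y Z p q f g} hf hg := by
    obtain ⟨h₁, h₂, h₃⟩ := hf
    obtain ⟨k₁, k₂, k₃⟩ := hg
    refine ⟨DGCategory.comp_mem h₁ k₁, DGCategory.comp_mem h₂ k₂, add_mem ?_ ?_⟩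
    · exact DGCat.comp_mem' (F.map_mem h₁) k₃ (by ring)
    · exact DGCat.comp_mem' h₃ (DGCat.sgn_mem k₂) (by ring)
  d_comp {X Y Z q} f {g} hg := by
    obtain ⟨k₁, k₂, k₃⟩ := hg
    refine hom_ext (DGCat.d_comp _ k₁) (DGCat.d_comp _ k₂) ?_
    simp only [dMor, LinearMap.coe_mk, AddHom.coe_mk, comp_fst, comp_snd_fst, comp_snd_snd,
      add_snd_snd, units_smul_snd_snd, _root_.map_add, DGCat.d_comp _ k₃,
      DGCat.d_units_smul, DGCat.d_comp _ k₂, F.map_comp, F.map_d, DGCat.sgn_of_mem k₂,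
      DGCat.sgn_of_mem (DGCategory.d_mem k₂), Int.negOnePow_succ, Int.negOnePow_sub,
      Preadditive.comp_sub, Preadditive.sub_comp, Linear.comp_units_smul,
      smul_smul, smul_sub, smul_add, Units.neg_smul, Category.assoc]
    simp
    abel

end MapPath

variable {C D : DGCat K} (F : DGFunctor C D)

/-- The mapping path category of a dg functor. -/
noncomputable def mapPath : DGCat K where
  Obj := F.MapPath

open MapPath

/-- The projection of the mapping path category to the target. -/
noncomputable def pathTgt : F.mapPath ⟶ D where
  obj X := X.tgt
  map f := f.2.1
  map_id _ := rfl
  map_comp _ _ := rfl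
  map_add _ _ := rfl
  map_smul _ _ := rfl
  map_mem hf := hf.2.1
  map_d _ := rfl

/-- The constant paths. -/
noncomputable def constPath : C ⟶ F.mapPath where
  obj X := ⟨X, F.obj X, 𝟙 _, DGCat.isHomotopyEquiv_id _⟩
  map f := mk' f (F.map f) 0
  map_id _ := hom_ext rfl (F.map_id _) rfl
  map_comp f g := hom_ext rfl (F.map_comp f g) (by
    change 0 = F.map f ≫ 0 + 0 ≫ D.sgn _ _ (F.map g)
    simp)
  map_add f g := hom_ext rfl (F.map_add f g) (add_zero 0).symm
  map_smul r f := hom_ext rfl (F.map_smul r f) (smul_zero r).symm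
  map_mem hf := ⟨hf, F.map_mem hf, zero_mem _⟩
  map_d f := hom_ext rfl (F.map_d f) (by
    change 0 = 𝟙 _ ≫ F.map f - F.map f ≫ 𝟙 _ - D.d _ _ 0
    simp)

/-- Between constant paths the components (b, c) contribute a contractible complex, so only the
component a survives in cohomology. -/
theorem constPath_quasiFullyFaithful : DGFunctor.QuasiFullyFaithful F.constPath := by
  intro X Y n
  constructor
  · refine (injective_iff_map_eq_zero _).2 fun x hx => ?_
    obtain ⟨⟨f, hf⟩, rfl⟩ := Submodule.Quotient.mk_surjective _ x
    rw [Submodule.Quotient.mk_eq_zero]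
    obtain ⟨k, hk, e⟩ := (Submodule.Quotient.mk_eq_zero _).1 hx
    exact ⟨k.1, hk.1, congrArg Prod.fst e⟩
  · intro y
    obtain ⟨⟨f, hf⟩, rfl⟩ := Submodule.Quotient.mk_surjective _ y
    obtain ⟨a, b, c⟩ := f
    change X ⟶ Y at a
    change F.obj X ⟶ F.obj Y at b
    change F.obj X ⟶ F.obj Y at c
    obtain ⟨⟨ha, hb, hc⟩, h⟩ := hf
    change c ∈ D.gr _ _ (n - 1) at hc
    have e₁ : C.d X Y a = 0 := congrArg Prod.fst h
    have e₃ : 𝟙 _ ≫ b - F.map a ≫ 𝟙 _ - D.d _ _ c = 0 := congrArg (fun g => g.2.2) h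
    refine ⟨Submodule.Quotient.mk ⟨a, ha, e₁⟩, (Submodule.Quotient.eq _).2 ?_⟩
    -- Closedness says F a - b = -d c, and since both paths are identities the boundary of (0, -c,
    -- 0) is (0, -d c, -c). This is the difference between the image of a and the given cocycle (a,
    -- b, c).
    refine ⟨mk' 0 (-c) 0, ⟨zero_mem _, neg_mem hc, zero_mem _⟩, ?_⟩
    rw [Category.id_comp, Category.comp_id, sub_sub, sub_eq_zero] at e₃
    refine hom_ext ?_ ?_ ?_
    · change C.d X Y 0 = a - a
      rw [_root_.map_zero, sub_self]
    · change D.d _ _ (-c) = F.map a - b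
      rw [e₃, _root_.map_neg]
      abel
    · have e : 𝟙 (F.obj X) ≫ (-c) - F.map (0 : X ⟶ Y) ≫ 𝟙 (F.obj Y) -
          D.d (F.obj X) (F.obj Y) 0 = 0 - c := by
        rw [F.map_zero]
        simp
      exact e

/-- In cohomology `F ≫ s` is bijective and `s ≫ pathTgt F` is the identity. The first gives
injectivity of F; if s y = s (F x), applying the projection gives y = F x. For essential
surjectivity no lifting is needed beyond s: the object s Y is itself a homotopy equivalence from an
object F X to Y. -/
theorem isQuasiEquivalence_of_section (F : C ⟶ D) (s : D ⟶ mapPath F)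
    (h₁ : F ≫ s = constPath F) (h₂ : s ≫ pathTgt F = 𝟙 D) : DGFunctor.IsQuasiEquivalence F := by
  have H₁ : DGFunctor.QuasiFullyFaithful (F ≫ s) := h₁ ▸ constPath_quasiFullyFaithful F
  have H₂ : DGFunctor.QuasiFullyFaithful (s ≫ pathTgt F) := by
    rw [h₂]
    intro X Y n
    have : cohomologyMap (𝟙 D : D ⟶ D) X Y n = LinearMap.id := by
      ext x
      rfl
    rw [this]
    exact Function.bijective_id
  have comp : ∀ {A B E : DGCat K} (G : A ⟶ B) (G' : B ⟶ E) (X Y : A.Obj) (n : ℤ)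
      (x : A.Cohomology X Y n), cohomologyMap (G ≫ G') X Y n x =
        cohomologyMap G' _ _ n (cohomologyMap G X Y n x) := by
    intro A B E G G' X Y n x
    obtain ⟨x, rfl⟩ := Submodule.Quotient.mk_surjective _ x
    rfl
  refine ⟨fun X Y n => ⟨?_, ?_⟩, ⟨fun Y => ?_⟩⟩
  · intro x y hxy
    refine (H₁ X Y n).1 ?_
    rw [comp, comp, hxy]
  · intro y
    obtain ⟨x, hx⟩ := (H₁ X Y n).2 (cohomologyMap s _ _ n y)
    refine ⟨x, (H₂ _ _ n).1 ?_⟩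
    rw [comp, comp, ← hx, comp]
  -- The endpoint of the path s Y equals Y only propositionally, so the isomorphism is followed by
  -- an `eqToIso`.
  · have hY : (s.obj Y.obj).tgt = Y.obj := congrArg (fun G : D ⟶ D => G.obj Y.obj) h₂
    obtain ⟨hp, g, hg, h₁, h₂⟩ := (s.obj Y.obj).isHomotopyEquiv
    obtain ⟨Y⟩ := Y
    refine ⟨⟨(s.obj Y).src⟩, ⟨Iso.trans (Y := (⟨(s.obj Y).tgt⟩ : D.H0)) ?_
      (eqToIso (congrArg DGCat.H0.mk hY))⟩⟩
    exact
      { hom := Submodule.Quotient.mk ⟨(s.obj Y).path, hp⟩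
        inv := Submodule.Quotient.mk ⟨g, hg⟩
        hom_inv_id := (Submodule.Quotient.eq _).2 h₁
        inv_hom_id := (Submodule.Quotient.eq _).2 h₂ }

end DGFunctor

end MappingPath

/-! ### Lifting the elements of J against the projection of the mapping path category. -/

section Lifting

variable {K : Type u} [CommRing K]

namespace GradedQuiver

variable {V : Type u} [GradedQuiver V] {δ : ∀ ⦃a b : V⦄, (a ⟶ b) → (pt K a ⟶ pt K b)}
  {hδ : ∀ ⦃a b : V⦄ (e : a ⟶ b), δ e ∈ gr K _ _ (deg e + 1)}
  {hδδ : ∀ ⦃a b : V⦄ (e : a ⟶ b), dLin δ _ _ (δ e) = 0}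

/-- A dg functor out of a dg category on a graded quiver is determined by the images of vertices
and arrows. -/
theorem dgFunctor_ext {C : DGCat K} {G H : dgCat δ hδ hδδ ⟶ C}
    (hobj : ∀ v : V, G.obj (pt (V := V) K v) = H.obj (pt (V := V) K v))
    (hmap : ∀ ⦃a b : V⦄ (e : a ⟶ b), HEq (G.map (ofArr (V := V) K e)) (H.map (ofArr (V := V) K e))) : G = H := by
  obtain ⟨⟨Go, Gm, Gid, Gcomp⟩, Gadd, Gsmul, _, _⟩ := G
  obtain ⟨⟨Ho, Hm, Hid, Hcomp⟩, Hadd, Hsmul, _, _⟩ := H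
  obtain rfl : Go = Ho := funext hobj
  have key : ∀ {a b : V} (p : Quiver.Path a b), Gm (X := pt (V := V) K a) (Y := pt (V := V) K b)
      (ofPath (V := V) K p) = Hm (X := pt (V := V) K a) (Y := pt (V := V) K b)
        (ofPath (V := V) K p) := by
    intro a b p
    induction p with
    | nil => exact (Gid _).trans (Hid _).symm
    | cons p e ih =>
      rw [ofPath_cons]
      exact (Gcomp (ofPath (V := V) K p) (ofArr (V := V) K e)).trans
        ((congrArg₂ _ ih (eq_of_heq (hmap e))).trans (Hcomp (ofPath (V := V) K p) (ofArr (V := V) K e)).symm)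
  obtain rfl : @Gm = @Hm := by
    ext X Y f
    refine hom_induction (V := V) (P := fun f => Gm f = Hm f) ?_ (fun f g h h' => ?_)
      (fun r f h => ?_) (fun p => ?_) f
    · have h₁ := Gsmul (0 : K) (0 : X ⟶ Y)
      have h₂ := Hsmul (0 : K) (0 : X ⟶ Y)
      simp only [smul_zero, zero_smul] at h₁ h₂
      exact h₁.trans h₂.symm
    · exact (Gadd f g).trans ((congrArg₂ _ h h').trans (Hadd f g).symm)
    · exact (Gsmul r f).trans ((congrArg _ h).trans (Hsmul r f).symm)
    · exact key p
  rfl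

end GradedQuiver

open GradedQuiver

theorem discreteDG_ext {V : Type u} {C : DGCat K} {G H : discreteDG K V ⟶ C}
    (hobj : ∀ v : V, G.obj (pt (V := Discr V) K ⟨v⟩) = H.obj (pt (V := Discr V) K ⟨v⟩)) : G = H :=
  dgFunctor_ext (fun v => hobj v.val) (fun _ _ e => PEmpty.elim e)

namespace DGFunctor

variable {C D : DGCat K} (F : DGFunctor C D)

open MapPath

/-- The image of g is a homotopy inverse, with the images of h₁ and h₂ as homotopies; r plays no
role here. -/
theorem kDG_isHomotopyEquiv_f (G : kDG K ⟶ D) :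
    D.IsHomotopyEquiv (G.map (ofArr (V := KVert) K KVert.f)) := by
  have hf : ofArr (V := KVert) K KVert.f ∈ (kDG K).cocycles _ _ 0 :=
    ⟨ofArr_mem KVert.f, dLin_ofArr (kD K) KVert.f⟩
  have hg : ofArr (V := KVert) K KVert.g ∈ (kDG K).cocycles _ _ 0 :=
    ⟨ofArr_mem KVert.g, dLin_ofArr (kD K) KVert.g⟩
  refine ⟨G.map_mem_cocycles hf, _, G.map_mem_cocycles hg, ?_, ?_⟩
  · refine ⟨_, G.map_mem (ofArr_mem KVert.h₁), (G.map_d _).symm.trans ?_⟩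
    refine (congrArg G.map (dLin_ofArr (kD K) KVert.h₁)).trans ?_
    refine (G.map_sub _ _).trans ?_
    exact congrArg₂ _ (G.map_comp _ _) (G.map_id _)
  · refine ⟨_, G.map_mem (ofArr_mem KVert.h₂), (G.map_d _).symm.trans ?_⟩
    refine (congrArg G.map (dLin_ofArr (kD K) KVert.h₂)).trans ?_
    refine (G.map_sub _ _).trans ?_
    exact congrArg₂ _ (G.map_comp _ _) (G.map_id _)

section Disc

variable {F} {n : ℤ} (G : disc K n ⟶ D) {X Y : C.Obj}
  {p : F.obj X ⟶ G.obj (pt (V := DiscVert n) K .one)} (hp : D.IsHomotopyEquiv p)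
  {q : F.obj Y ⟶ G.obj (pt (V := DiscVert n) K .two)} (hq : D.IsHomotopyEquiv q)

/-- The lift of a dg functor out of a disc to the mapping path category, on objects. -/
def discLiftObj : DiscVert.{u} n → F.mapPath.Obj
  | .one => ⟨X, _, p, hp⟩
  | .two => ⟨Y, _, q, hq⟩

/-- The lift of a dg functor out of a disc to the mapping path category, on the generator `t`. -/
noncomputable def discLiftT : discLiftObj G hp hq .one ⟶ discLiftObj G hp hq .two :=
  mk' 0 (G.map (ofArr K (DiscVert.t n))) 0

/-- The lift of a dg functor out of a disc to the mapping path category, on arrows. -/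
noncomputable def discLiftMap : ∀ ⦃a b : DiscVert.{u} n⦄, (a ⟶ b) →
    (discLiftObj G hp hq a ⟶ discLiftObj G hp hq b)
  | _, _, .t => discLiftT G hp hq
  | _, _, .dt => F.mapPath.d _ _ (discLiftT G hp hq)

theorem discLiftT_mem : discLiftT G hp hq ∈ F.mapPath.gr _ _ (-n) :=
  ⟨zero_mem _, G.map_mem (ofArr_mem (DiscVert.t n)), zero_mem _⟩

/-- The lift of a dg functor out of a disc to the mapping path category. -/
noncomputable def discLift : disc K n ⟶ F.mapPath :=
  lift (C := F.mapPath) _ (discLiftObj G hp hq) (discLiftMap G hp hq) _ _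
    (fun _ _ e => match e with
      | .t => discLiftT_mem G hp hq
      | .dt => DGCat.d_mem' (discLiftT_mem G hp hq) (by change _ = 1 - n; ring))
    (fun _ _ e => match e with
      | .t => linMap_ofArr _ _ (DiscVert.dt n)
      | .dt => (_root_.map_zero _).trans (DGCat.d_d (C := F.mapPath) _).symm)

theorem discLift_pathTgt : discLift G hp hq ≫ F.pathTgt = G := by
  refine dgFunctor_ext (fun v => by cases v <;> rfl) (fun a b e => ?_)
  match a, b, e with
  | _, _, .t =>
    refine heq_of_eq ?_
    exact congrArg (fun f => F.pathTgt.map f)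
      (linMap_ofArr (discLiftObj G hp hq) (discLiftMap G hp hq) (DiscVert.t n))
  | _, _, .dt =>
    refine heq_of_eq ?_
    refine (congrArg (fun f => F.pathTgt.map f)
      (linMap_ofArr (discLiftObj G hp hq) (discLiftMap G hp hq) (DiscVert.dt n))).trans ?_
    refine (G.map_d (ofArr (V := DiscVert n) K (DiscVert.t n))).symm.trans ?_
    exact congrArg G.map (dLin_ofArr (discD K n) (DiscVert.t n))

end Disc

/-- The morphism t lifts to (0, t, 0) whatever the two paths are. As dt may be sent to the
differential of this lift, there is no condition to satisfy. -/
theorem exists_disc_lift {n : ℤ} (G : disc K n ⟶ D) (X Y : F.MapPath)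
    (hX : X.tgt = G.obj (pt (V := DiscVert n) K .one))
    (hY : Y.tgt = G.obj (pt (V := DiscVert n) K .two)) :
    ∃ L : disc K n ⟶ F.mapPath, L.obj (pt (V := DiscVert n) K .one) = X ∧
      L.obj (pt (V := DiscVert n) K .two) = Y ∧ L ≫ F.pathTgt = G := by
  obtain ⟨X, X', p, hp⟩ := X
  obtain ⟨Y, Y', q, hq⟩ := Y
  dsimp only at hX hY
  subst hX hY
  exact ⟨discLift G hp hq, rfl, rfl, discLift_pathTgt G hp hq⟩

section K

variable {F} (G : kDG K ⟶ D) {X : C.Obj}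
  {p : F.obj X ⟶ G.obj (pt (V := KVert) K .one)} (hp : D.IsHomotopyEquiv p)

/-- The lift of a dg functor out of `𝒦` to the mapping path category, on objects. -/
noncomputable def kLiftObj : KVert.{u} → F.mapPath.Obj
  | .one => ⟨X, _, p, hp⟩
  | .two => ⟨X, _, _, hp.comp (kDG_isHomotopyEquiv_f G)⟩

/-- The lift of a dg functor out of `𝒦` to the mapping path category, on arrows. -/
noncomputable def kLiftMap : ∀ ⦃a b : KVert.{u}⦄, (a ⟶ b) → (kLiftObj G hp a ⟶ kLiftObj G hp b)
  | _, _, .f => mk' (𝟙 X) (G.map (ofArr K KVert.f)) 0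
  | _, _, .g => mk' (𝟙 X) (G.map (ofArr K KVert.g)) (p ≫ G.map (ofArr K KVert.h₁))
  | _, _, .h₁ => mk' 0 (G.map (ofArr K KVert.h₁)) 0
  | _, _, .h₂ => mk' 0 (G.map (ofArr K KVert.h₂)) (p ≫ G.map (ofArr K KVert.r))
  | _, _, .r => mk' 0 (G.map (ofArr K KVert.r)) 0

theorem kLiftMap_mem ⦃a b : KVert.{u}⦄ (e : a ⟶ b) :
    kLiftMap G hp e ∈ F.mapPath.gr (kLiftObj G hp a) (kLiftObj G hp b) (deg e) := by
  have h1 := G.map_mem (ofArr_mem KVert.h₁)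
  have hr := G.map_mem (ofArr_mem KVert.r)
  match a, b, e with
  | _, _, .f => exact ⟨DGCat.id_mem _, G.map_mem (ofArr_mem KVert.f), zero_mem _⟩
  | _, _, .g => exact ⟨DGCat.id_mem _, G.map_mem (ofArr_mem KVert.g),
      DGCat.comp_mem' hp.1.1 h1 rfl⟩
  | _, _, .h₁ => exact ⟨zero_mem _, h1, zero_mem _⟩
  | _, _, .h₂ => exact ⟨zero_mem _, G.map_mem (ofArr_mem KVert.h₂),
      DGCat.comp_mem' hp.1.1 hr rfl⟩
  | _, _, .r => exact ⟨zero_mem _, hr, zero_mem _⟩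

theorem kDG_map_d ⦃a b : KVert.{u}⦄ (e : a ⟶ b) :
    D.d _ _ (G.map (ofArr (V := KVert) K e)) = G.map (kD K e) :=
  (G.map_d _).symm.trans (congrArg G.map (dLin_ofArr (kD K) e))

section Relations

variable {A B : D.Obj} {p : F.obj X ⟶ A} (hp : D.IsHomotopyEquiv p) {f : A ⟶ B}
  (hpf : D.IsHomotopyEquiv (p ≫ f)) {g : B ⟶ A} {h₁ : A ⟶ A} {h₂ : B ⟶ B} {r : A ⟶ B}

/-- The path chosen at the second vertex is `p ≫ f`, so the square for f commutes strictly and needs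
no homotopy. -/
theorem dMor_lift_f (hf : D.d _ _ f = 0) :
    dMor ⟨X, A, p, hp⟩ ⟨X, B, p ≫ f, hpf⟩ (mk' (𝟙 X) f 0) = 0 :=
  hom_ext (by simp [dMor, DGCat.d_id]) (by simp [dMor, hf]) (by simp [dMor])

/-- The square for g commutes only up to homotopy: p f g - p = d (p h₁). This dictates the third
component. -/
theorem dMor_lift_g (hg : D.d _ _ g = 0) (hh₁ : D.d _ _ h₁ = f ≫ g - 𝟙 A) :
    dMor ⟨X, B, p ≫ f, hpf⟩ ⟨X, A, p, hp⟩ (mk' (𝟙 X) g (p ≫ h₁)) = 0 :=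
  hom_ext (by simp [dMor, DGCat.d_id]) (by simp [dMor, hg])
    (by simp [dMor, DGCat.d_comp_closed hp.1.2, hh₁])

theorem dMor_lift_h₁ (hh₁ : D.d _ _ h₁ = f ≫ g - 𝟙 A) :
    dMor ⟨X, A, p, hp⟩ ⟨X, A, p, hp⟩ (mk' 0 h₁ 0) =
    (mk' (𝟙 X) f 0 : (⟨X, A, p, hp⟩ : F.MapPath) ⟶ ⟨X, B, p ≫ f, hpf⟩) ≫
      mk' (𝟙 X) g (p ≫ h₁) - 𝟙 _ :=
  hom_ext (by simp [dMor]) (by simp [dMor, hh₁]) (by simp [dMor, F.map_zero])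

/-- This is where r is indispensable. The third component of the composite of the lifts of g and f
is p h₁ f, whereas h₂ alone would contribute p f h₂; the discrepancy p (f h₂ - h₁ f) is d (p r). -/
theorem dMor_lift_h₂ (hh₂ : D.d _ _ h₂ = g ≫ f - 𝟙 B) (hr : D.d _ _ r = f ≫ h₂ - h₁ ≫ f)
    (hf' : f ∈ D.gr A B 0) :
    dMor ⟨X, B, p ≫ f, hpf⟩ ⟨X, B, p ≫ f, hpf⟩ (mk' 0 h₂ (p ≫ r)) =
    (mk' (𝟙 X) g (p ≫ h₁) : (⟨X, B, p ≫ f, hpf⟩ : F.MapPath) ⟶ ⟨X, A, p, hp⟩) ≫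
      mk' (𝟙 X) f 0 - 𝟙 _ :=
  hom_ext (by simp [dMor]) (by simp [dMor, hh₂])
    (by simp [dMor, F.map_zero, DGCat.d_comp_closed hp.1.2, hr, DGCat.sgn_of_mem hf'])

theorem dMor_lift_r (hr : D.d _ _ r = f ≫ h₂ - h₁ ≫ f) :
    dMor ⟨X, A, p, hp⟩ ⟨X, B, p ≫ f, hpf⟩ (mk' 0 r 0) =
    (mk' (𝟙 X) f 0 : (⟨X, A, p, hp⟩ : F.MapPath) ⟶ ⟨X, B, p ≫ f, hpf⟩) ≫ mk' 0 h₂ (p ≫ r) -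
      (mk' 0 h₁ 0 : (⟨X, A, p, hp⟩ : F.MapPath) ⟶ ⟨X, A, p, hp⟩) ≫ mk' (𝟙 X) f 0 :=
  hom_ext (by simp [dMor]) (by simp [dMor, hr]) (by simp [dMor, F.map_zero])

end Relations

theorem kLiftMap_d ⦃a b : KVert.{u}⦄ (e : a ⟶ b) :
    linMap (K := K) (C := F.mapPath) (kLiftObj G hp) (kLiftMap G hp) a b (kD K e) =
      F.mapPath.d _ _ (kLiftMap G hp e) := by
  have df : D.d _ _ (G.map (ofArr (V := KVert) K KVert.f)) = 0 :=
    (kDG_map_d G KVert.f).trans (G.map_zero _ _)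
  have dg : D.d _ _ (G.map (ofArr (V := KVert) K KVert.g)) = 0 :=
    (kDG_map_d G KVert.g).trans (G.map_zero _ _)
  have dh₁ : D.d _ _ (G.map (ofArr (V := KVert) K KVert.h₁)) =
      G.map (ofArr (V := KVert) K KVert.f) ≫ G.map (ofArr (V := KVert) K KVert.g) - 𝟙 _ :=
    (kDG_map_d G KVert.h₁).trans
      ((G.map_sub _ _).trans (congrArg₂ _ (G.map_comp _ _) (G.map_id _)))
  have dh₂ : D.d _ _ (G.map (ofArr (V := KVert) K KVert.h₂)) =
      G.map (ofArr (V := KVert) K KVert.g) ≫ G.map (ofArr (V := KVert) K KVert.f) - 𝟙 _ :=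
    (kDG_map_d G KVert.h₂).trans
      ((G.map_sub _ _).trans (congrArg₂ _ (G.map_comp _ _) (G.map_id _)))
  have dr : D.d _ _ (G.map (ofArr (V := KVert) K KVert.r)) =
      G.map (ofArr (V := KVert) K KVert.f) ≫ G.map (ofArr (V := KVert) K KVert.h₂) -
      G.map (ofArr (V := KVert) K KVert.h₁) ≫ G.map (ofArr (V := KVert) K KVert.f) :=
    (kDG_map_d G KVert.r).trans
      ((G.map_sub _ _).trans (congrArg₂ _ (G.map_comp _ _) (G.map_comp _ _)))
  have hpf := hp.comp (kDG_isHomotopyEquiv_f G)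
  match a, b, e with
  | _, _, .f => exact (_root_.map_zero _).trans (dMor_lift_f hp hpf df).symm
  | _, _, .g => exact (_root_.map_zero _).trans (dMor_lift_g hp hpf dg dh₁).symm
  | _, _, .h₁ =>
    refine (_root_.map_sub (linMap (K := K) (C := F.mapPath) (kLiftObj G hp) (kLiftMap G hp)
      KVert.one KVert.one) _ _).trans ?_
    rw [linMap_comp, linMap_id, linMap_ofArr, linMap_ofArr]
    exact (dMor_lift_h₁ hp hpf dh₁).symm
  | _, _, .h₂ =>
    refine (_root_.map_sub (linMap (K := K) (C := F.mapPath) (kLiftObj G hp) (kLiftMap G hp)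
      KVert.two KVert.two) _ _).trans ?_
    rw [linMap_comp, linMap_id, linMap_ofArr, linMap_ofArr]
    exact (dMor_lift_h₂ hp hpf dh₂ dr (G.map_mem (ofArr_mem KVert.f))).symm
  | _, _, .r =>
    refine (_root_.map_sub (linMap (K := K) (C := F.mapPath) (kLiftObj G hp) (kLiftMap G hp)
      KVert.one KVert.two) _ _).trans ?_
    rw [linMap_comp, linMap_comp, linMap_ofArr, linMap_ofArr, linMap_ofArr]
    exact (dMor_lift_r hp hpf dr).symm

/-- The lift of a dg functor out of `𝒦` to the mapping path category. -/
noncomputable def kLift : kDG K ⟶ F.mapPath :=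
  lift (C := F.mapPath) _ (kLiftObj G hp) (kLiftMap G hp) _ _ (kLiftMap_mem G hp)
    (kLiftMap_d G hp)

theorem kLift_pathTgt : kLift G hp ≫ F.pathTgt = G := by
  refine dgFunctor_ext (fun v => by cases v <;> rfl) (fun a b e => ?_)
  have h : HEq (F.pathTgt.map (kLiftMap G hp e)) (G.map (ofArr (V := KVert) K e)) := by
    match a, b, e with
    | _, _, .f => rfl
    | _, _, .g => rfl
    | _, _, .h₁ => rfl
    | _, _, .h₂ => rfl
    | _, _, .r => rfl
  refine HEq.trans (heq_of_eq ?_) h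
  exact congrArg (fun f => F.pathTgt.map f)
    (linMap_ofArr (kLiftObj G hp) (kLiftMap G hp) e)

end K

theorem exists_kDG_lift (G : kDG K ⟶ D) (X : F.MapPath)
    (hX : X.tgt = G.obj (pt (V := KVert) K .one)) :
    ∃ L : kDG K ⟶ F.mapPath, L.obj (pt (V := KVert) K .one) = X ∧ L ≫ F.pathTgt = G := by
  obtain ⟨X, X', p, hp⟩ := X
  dsimp only at hX
  subst hX
  exact ⟨kLift G hp, rfl, kLift_pathTgt G hp⟩

theorem hasLiftingProperty_rho (n : ℤ) : HasLiftingProperty (rho K n) F.pathTgt where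
  sq_hasLift {f g} sq := by
    have h : ∀ v, (f.obj v).tgt = g.obj ((rho K n).obj v) := fun v =>
      congrArg (fun G : twoDG K ⟶ D => G.obj v) sq.w
    obtain ⟨L, h₁, h₂, h₃⟩ := exists_disc_lift F g _ _ (h (pt (V := Discr Two) K ⟨.one⟩))
      (h (pt (V := Discr Two) K ⟨.two⟩))
    exact ⟨⟨L, discreteDG_ext fun v => by cases v <;> assumption, h₃⟩⟩

theorem hasLiftingProperty_sigma : HasLiftingProperty (sigma K) F.pathTgt where
  sq_hasLift {f g} sq := by
    have h : ∀ v, (f.obj v).tgt = g.obj ((sigma K).obj v) := fun v =>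
      congrArg (fun G : unitDG K ⟶ D => G.obj v) sq.w
    obtain ⟨L, h₁, h₃⟩ := exists_kDG_lift F g _ (h (pt (V := Discr PUnit) K ⟨.unit⟩))
    exact ⟨⟨L, discreteDG_ext fun v => h₁, h₃⟩⟩

end DGFunctor

theorem rlp_pathTgt {C D : DGCat K} (F : C ⟶ D) : (generatingJ K).rlp (DGFunctor.pathTgt F) := by
  rintro _ _ _ (n | _)
  · exact DGFunctor.hasLiftingProperty_rho F n
  · exact DGFunctor.hasLiftingProperty_sigma F

/-- The square commutes because F factors as `constPath` followed by `pathTgt`; its lift is the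
section required by the criterion. -/
theorem isQuasiEquivalence_of_llp_rlp {C D : DGCat K} (F : C ⟶ D)
    (hF : (generatingJ K).rlp.llp F) : quasiEquivalences K F := by
  have := hF _ (rlp_pathTgt F)
  have sq : CommSq (DGFunctor.constPath F) F (DGFunctor.pathTgt F) (𝟙 D) := ⟨rfl⟩
  exact DGFunctor.isQuasiEquivalence_of_section F sq.lift sq.fac_left sq.fac_right

theorem cell_generatingJ_le_quasiEquivalences :
    cell (generatingJ K) ≤ quasiEquivalences K := fun _ _ F hF =>
  isQuasiEquivalence_of_llp_rlp F
    ((generatingJ K).transfiniteCompositionsOfShape_pushouts_coproducts_le_llp_rlp ℕ F hF)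

theorem pushouts_generatingJ_le_quasiEquivalences :
    (generatingJ K).pushouts ≤ quasiEquivalences K := fun _ _ F hF =>
  isQuasiEquivalence_of_llp_rlp F
    (MorphismProperty.pushouts_le _ (MorphismProperty.pushouts_monotone
      (MorphismProperty.le_llp_rlp _) F hF))

end Lifting

/-! ### Quotients of dg categories by the common kernel of a class of dg functors. -/

section CommonKernel

variable {K : Type u} [CommRing K]

namespace DGCat

variable {A : DGCat K} (𝒢 : ∀ ⦃B : DGCat K⦄, (A ⟶ B) → Prop)

/-- The morphisms which are sent to zero by all dg functors in a given class. -/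
def commonKernel (X Y : A.Obj) : Submodule K (X ⟶ Y) where
  carrier := {f | ∀ ⦃B : DGCat K⦄ (G : A ⟶ B), 𝒢 G → G.map f = 0}
  add_mem' hf hg B G hG := by rw [DGFunctor.map_add, hf G hG, hg G hG, add_zero]
  zero_mem' B G _ := DGFunctor.map_zero G _ _
  smul_mem' r f hf B G hG := by rw [DGFunctor.map_smul, hf G hG, smul_zero]

variable {𝒢}

theorem comp_mem_commonKernel_left {X Y Z : A.Obj} {f : X ⟶ Y} (hf : f ∈ commonKernel 𝒢 X Y)
    (g : Y ⟶ Z) : f ≫ g ∈ commonKernel 𝒢 X Z := fun B G hG => by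
  rw [Functor.map_comp, hf G hG, Limits.zero_comp]

theorem comp_mem_commonKernel_right {X Y Z : A.Obj} (f : X ⟶ Y) {g : Y ⟶ Z}
    (hg : g ∈ commonKernel 𝒢 Y Z) : f ≫ g ∈ commonKernel 𝒢 X Z := fun B G hG => by
  rw [Functor.map_comp, hg G hG, Limits.comp_zero]

theorem d_mem_commonKernel {X Y : A.Obj} {f : X ⟶ Y} (hf : f ∈ commonKernel 𝒢 X Y) :
    A.d X Y f ∈ commonKernel 𝒢 X Y := fun B G hG => by
  rw [DGFunctor.map_d, hf G hG, map_zero]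

/-- Dg functors commute with the projections to homogeneous components, so the common kernel is a
graded submodule and the quotient inherits a direct sum decomposition. -/
theorem proj_mem_commonKernel {X Y : A.Obj} {f : X ⟶ Y} (hf : f ∈ commonKernel 𝒢 X Y) (n : ℤ) :
    A.proj X Y n f ∈ commonKernel 𝒢 X Y := fun B G hG => by
  rw [DGFunctor.map_proj, hf G hG, map_zero]

/-- The objects of the quotient of a dg category by the common kernel of a class of dg
functors. -/
structure KernelQuotient (𝒢 : ∀ ⦃B : DGCat K⦄, (A ⟶ B) → Prop) : Type u where
  obj : A.Obj

namespace KernelQuotient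

/-- The Hom modules of the quotient by the common kernel. -/
abbrev Mor (X Y : KernelQuotient 𝒢) : Type u :=
  (X.obj ⟶ Y.obj) ⧸ commonKernel 𝒢 X.obj Y.obj

/-- The class of a morphism in the quotient. -/
abbrev cls {X Y : KernelQuotient 𝒢} (f : X.obj ⟶ Y.obj) : Mor X Y := Submodule.Quotient.mk f

/-- Identities in the quotient can be tested after applying the members of the class. The class
ranges over targets in a large type, but being in the kernel is a proposition, so the quotient stays
small. -/
theorem cls_eq_cls_iff {X Y : KernelQuotient 𝒢} {f g : X.obj ⟶ Y.obj} :
    (cls f : Mor X Y) = cls g ↔ ∀ ⦃B : DGCat K⦄ (G : A ⟶ B), 𝒢 G → G.map f = G.map g := by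
  refine (Submodule.Quotient.eq _).trans (forall₃_congr fun B G hG => ?_)
  rw [DGFunctor.map_sub, sub_eq_zero]

instance : Category.{u} (KernelQuotient 𝒢) where
  Hom X Y := Mor X Y
  id X := cls (𝟙 X.obj)
  comp {X Y Z} := Quotient.map₂ (fun f g => f ≫ g) (by
    intro f f' hf g g' hg
    have hf' := (Submodule.quotientRel_def _).1 hf
    have hg' := (Submodule.quotientRel_def _).1 hg
    refine (Submodule.quotientRel_def _).2 ?_
    have h := add_mem (comp_mem_commonKernel_left hf' g) (comp_mem_commonKernel_right f' hg')
    simpa [Preadditive.sub_comp, Preadditive.comp_sub] using h)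
  id_comp f := by
    induction f using Quotient.inductionOn
    exact congrArg (Quotient.mk _) (Category.id_comp _)
  comp_id f := by
    induction f using Quotient.inductionOn
    exact congrArg (Quotient.mk _) (Category.comp_id _)
  assoc f g h := by
    induction f using Quotient.inductionOn
    induction g using Quotient.inductionOn
    induction h using Quotient.inductionOn
    exact congrArg (Quotient.mk _) (Category.assoc _ _ _)

instance (X Y : KernelQuotient 𝒢) : AddCommGroup (X ⟶ Y) :=
  inferInstanceAs (AddCommGroup (Mor X Y))

instance (X Y : KernelQuotient 𝒢) : Module K (X ⟶ Y) := inferInstanceAs (Module K (Mor X Y))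

/-- The class of a morphism, as a linear map. -/
def mkLin (X Y : KernelQuotient 𝒢) : (X.obj ⟶ Y.obj) →ₗ[K] (X ⟶ Y) :=
  (commonKernel 𝒢 X.obj Y.obj).mkQ

theorem mkLin_surjective (X Y : KernelQuotient 𝒢) : Function.Surjective (mkLin X Y) :=
  Submodule.Quotient.mk_surjective _

theorem mkLin_comp {X Y Z : KernelQuotient 𝒢} (f : X.obj ⟶ Y.obj) (g : Y.obj ⟶ Z.obj) :
    mkLin X Z (f ≫ g) = mkLin X Y f ≫ mkLin Y Z g := rfl

instance : Preadditive (KernelQuotient 𝒢) where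
  add_comp X Y Z f f' g := by
    obtain ⟨f, rfl⟩ := mkLin_surjective X Y f
    obtain ⟨f', rfl⟩ := mkLin_surjective X Y f'
    obtain ⟨g, rfl⟩ := mkLin_surjective Y Z g
    rw [← map_add, ← mkLin_comp, ← mkLin_comp, ← mkLin_comp, ← map_add, Preadditive.add_comp]
  comp_add X Y Z f g g' := by
    obtain ⟨f, rfl⟩ := mkLin_surjective X Y f
    obtain ⟨g, rfl⟩ := mkLin_surjective Y Z g
    obtain ⟨g', rfl⟩ := mkLin_surjective Y Z g'
    rw [← map_add, ← mkLin_comp, ← mkLin_comp, ← mkLin_comp, ← map_add, Preadditive.comp_add]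

instance : Linear K (KernelQuotient 𝒢) where
  smul_comp X Y Z r f g := by
    obtain ⟨f, rfl⟩ := mkLin_surjective X Y f
    obtain ⟨g, rfl⟩ := mkLin_surjective Y Z g
    rw [← map_smul, ← mkLin_comp, ← mkLin_comp, ← map_smul, Linear.smul_comp]
  comp_smul X Y Z f r g := by
    obtain ⟨f, rfl⟩ := mkLin_surjective X Y f
    obtain ⟨g, rfl⟩ := mkLin_surjective Y Z g
    rw [← map_smul, ← mkLin_comp, ← mkLin_comp, ← map_smul, Linear.comp_smul]

/-- The differential of the quotient. -/
def dLin (X Y : KernelQuotient 𝒢) : (X ⟶ Y) →ₗ[K] (X ⟶ Y) :=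
  Submodule.mapQ _ _ (A.d X.obj Y.obj) fun _ => d_mem_commonKernel

theorem dLin_mkLin {X Y : KernelQuotient 𝒢} (f : X.obj ⟶ Y.obj) :
    dLin X Y (mkLin X Y f) = mkLin X Y (A.d _ _ f) := rfl

instance : DGCategory K (KernelQuotient 𝒢) where
  gr X Y n := (A.gr X.obj Y.obj n).map (mkLin X Y)
  isInternal X Y := by
    refine isInternal_of_projections _ (fun n => Submodule.mapQ _ _ (A.proj X.obj Y.obj n)
      fun _ hf => proj_mem_commonKernel hf n) ?_ ?_ fun x => ?_
    · rintro n _ ⟨f, hf, rfl⟩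
      exact congrArg (mkLin X Y) (proj_of_mem hf)
    · rintro m n h _ ⟨f, hf, rfl⟩
      exact (congrArg (mkLin X Y) (proj_of_mem_ne h hf)).trans (map_zero _)
    · obtain ⟨f, rfl⟩ := mkLin_surjective X Y x
      rw [← Submodule.map_iSup]
      exact ⟨f, mem_iSup_gr f, rfl⟩
  d := dLin
  d_mem := by
    rintro X Y n _ ⟨f, hf, rfl⟩
    exact ⟨_, DGCategory.d_mem hf, rfl⟩
  d_d {X Y} f := by
    obtain ⟨f, rfl⟩ := mkLin_surjective X Y f
    rw [dLin_mkLin, dLin_mkLin, DGCat.d_d, map_zero]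
  id_mem X := ⟨_, DGCat.id_mem _, rfl⟩
  comp_mem := by
    rintro X Y Z p q _ _ ⟨f, hf, rfl⟩ ⟨g, hg, rfl⟩
    exact ⟨_, DGCategory.comp_mem hf hg, rfl⟩
  d_comp := by
    rintro X Y Z q f _ ⟨g, hg, rfl⟩
    obtain ⟨f, rfl⟩ := mkLin_surjective X Y f
    rw [← mkLin_comp, dLin_mkLin, dLin_mkLin, dLin_mkLin, DGCat.d_comp f hg, map_add,
      mkLin_comp, Units.smul_def, map_zsmul, mkLin_comp, Units.smul_def]

end KernelQuotient

variable (𝒢) in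
/-- The quotient of a dg category by the common kernel of a class of dg functors. -/
def kernelQuotient : DGCat K where
  Obj := KernelQuotient 𝒢

open KernelQuotient

variable (𝒢) in
/-- The projection to the quotient by the common kernel of a class of dg functors. -/
def toKernelQuotient : A ⟶ kernelQuotient 𝒢 where
  obj X := ⟨X⟩
  map {X Y} f := mkLin ⟨X⟩ ⟨Y⟩ f
  map_id _ := rfl
  map_comp _ _ := rfl
  map_add {X Y} f g := map_add (mkLin (𝒢 := 𝒢) ⟨X⟩ ⟨Y⟩) f g
  map_smul {X Y} r f := map_smul (mkLin (𝒢 := 𝒢) ⟨X⟩ ⟨Y⟩) r f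
  map_mem hf := ⟨_, hf, rfl⟩
  map_d _ := rfl

/-- The linear maps out of the Hom modules of the quotient induced by a member of the class. -/
def KernelQuotient.descLin {B : DGCat K} (G : A ⟶ B) (hG : 𝒢 G) (X Y : KernelQuotient 𝒢) :
    (X ⟶ Y) →ₗ[K] (G.obj X.obj ⟶ G.obj Y.obj) :=
  (commonKernel 𝒢 X.obj Y.obj).liftQ (G.mapHom X.obj Y.obj) fun _ hf => hf G hG

/-- The dg functor out of the quotient induced by a member of the class. -/
def kernelQuotientDesc {B : DGCat K} (G : A ⟶ B) (hG : 𝒢 G) : kernelQuotient 𝒢 ⟶ B where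
  obj X := G.obj X.obj
  map {X Y} f := descLin G hG X Y f
  map_id X := G.map_id X.obj
  map_comp {X Y Z} f g := by
    obtain ⟨f, rfl⟩ := mkLin_surjective X Y f
    obtain ⟨g, rfl⟩ := mkLin_surjective Y Z g
    exact G.map_comp f g
  map_add {X Y} f g := map_add (descLin G hG X Y) f g
  map_smul {X Y} r f := map_smul (descLin G hG X Y) r f
  map_mem := by
    rintro X Y n _ ⟨f, hf, rfl⟩
    exact G.map_mem hf
  map_d {X Y} f := by
    obtain ⟨f, rfl⟩ := mkLin_surjective X Y f
    exact G.map_d f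

theorem kernelQuotient_ext {B : DGCat K} {G H : kernelQuotient 𝒢 ⟶ B}
    (h : toKernelQuotient 𝒢 ≫ G = toKernelQuotient 𝒢 ≫ H) : G = H := by
  have hobj : ∀ X : A.Obj, G.obj ⟨X⟩ = H.obj ⟨X⟩ := fun X =>
    congrArg (fun F : A ⟶ B => F.obj X) h
  have hmap : ∀ (X Y : A.Obj) (f : X ⟶ Y),
      HEq (G.map (mkLin (𝒢 := 𝒢) ⟨X⟩ ⟨Y⟩ f)) (H.map (mkLin (𝒢 := 𝒢) ⟨X⟩ ⟨Y⟩ f)) :=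
    fun X Y f => congr_arg_heq (fun F : A ⟶ B => F.map f) h
  obtain ⟨⟨Go, Gm, _, _⟩, _, _, _, _⟩ := G
  obtain ⟨⟨Ho, Hm, _, _⟩, _, _, _, _⟩ := H
  obtain rfl : Go = Ho := funext fun X => hobj X.obj
  obtain rfl : @Gm = @Hm := by
    ext X Y f
    obtain ⟨f, rfl⟩ := mkLin_surjective X Y f
    exact eq_of_heq (hmap _ _ f)
  rfl

theorem toKernelQuotient_map_eq {X Y : A.Obj} {f g : X ⟶ Y}
    (h : ∀ ⦃B : DGCat K⦄ (G : A ⟶ B), 𝒢 G → G.map f = G.map g) :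
    (toKernelQuotient 𝒢).map f = (toKernelQuotient 𝒢).map g :=
  cls_eq_cls_iff.2 h

theorem toKernelQuotient_map_heq {X Y X' Y' : A.Obj} {f : X ⟶ Y} {g : X' ⟶ Y'} (hX : X = X')
    (hY : Y = Y') (h : ∀ ⦃B : DGCat K⦄ (G : A ⟶ B), 𝒢 G → HEq (G.map f) (G.map g)) :
    HEq ((toKernelQuotient 𝒢).map f) ((toKernelQuotient 𝒢).map g) := by
  subst hX hY
  exact heq_of_eq (toKernelQuotient_map_eq fun B G hG => eq_of_heq (h G hG))

end DGCat

namespace DGFunctor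

variable {C D : DGCat K}

/-- A dg functor, given by its values on homogeneous morphisms. -/
noncomputable def ofHomogeneous (obj : C.Obj → D.Obj)
    (φ : ∀ (X Y : C.Obj) (n : ℤ), C.gr X Y n →ₗ[K] (obj X ⟶ obj Y))
    (hid : ∀ X, φ X X 0 ⟨𝟙 X, DGCat.id_mem X⟩ = 𝟙 (obj X))
    (hcomp : ∀ {X Y Z : C.Obj} {p q : ℤ} (f : C.gr X Y p) (g : C.gr Y Z q),
      φ X Z (p + q) ⟨f.1 ≫ g.1, DGCategory.comp_mem f.2 g.2⟩ = φ X Y p f ≫ φ Y Z q g)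
    (hmem : ∀ {X Y : C.Obj} {n : ℤ} (f : C.gr X Y n), φ X Y n f ∈ D.gr (obj X) (obj Y) n)
    (hd : ∀ {X Y : C.Obj} {n : ℤ} (f : C.gr X Y n),
      φ X Y (n + 1) ⟨C.d X Y f.1, DGCategory.d_mem f.2⟩ = D.d _ _ (φ X Y n f)) : C ⟶ D :=
  let Φ (X Y : C.Obj) : (X ⟶ Y) →ₗ[K] (obj X ⟶ obj Y) :=
    DirectSum.toModule K ℤ _ (φ X Y) ∘ₗ (C.homEquiv X Y).toLinearMap
  have hΦ : ∀ {X Y : C.Obj} {n : ℤ} {f : X ⟶ Y} (hf : f ∈ C.gr X Y n),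
      Φ X Y f = φ X Y n ⟨f, hf⟩ := fun hf => by
    simp [Φ, DGCat.homEquiv_of_mem hf, DirectSum.toModule_lof]
  { obj := obj
    map := fun {X Y} f => Φ X Y f
    map_id := fun X => (hΦ (DGCat.id_mem X)).trans (hid X)
    map_comp := fun {X Y Z} f g => by
      refine DGCat.homogeneous_induction (P := fun f => Φ X Z (f ≫ g) = Φ X Y f ≫ Φ Y Z g)
        (by simp) (fun f f' h h' => by simp [h, h']) (fun p f hf => ?_) f
      refine DGCat.homogeneous_induction (P := fun g => Φ X Z (f ≫ g) = Φ X Y f ≫ Φ Y Z g)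
        (by simp) (fun f f' h h' => by simp [h, h']) (fun q g hg => ?_) g
      rw [hΦ hf, hΦ hg, hΦ (DGCategory.comp_mem hf hg)]
      exact hcomp ⟨f, hf⟩ ⟨g, hg⟩
    map_add := fun f g => _root_.map_add _ f g
    map_smul := fun r f => _root_.map_smul _ r f
    map_mem := fun hf => by
      rw [hΦ hf]
      exact hmem ⟨_, hf⟩
    map_d := fun {X Y} f => by
      refine DGCat.homogeneous_induction (P := fun f => Φ X Y (C.d X Y f) = D.d _ _ (Φ X Y f))
        (by simp) (fun f f' h h' => by simp [h, h']) (fun p f hf => ?_) f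
      rw [hΦ hf, hΦ (DGCategory.d_mem hf)]
      exact hd ⟨f, hf⟩ }

theorem ofHomogeneous_map (obj : C.Obj → D.Obj)
    (φ : ∀ (X Y : C.Obj) (n : ℤ), C.gr X Y n →ₗ[K] (obj X ⟶ obj Y)) (hid) (hcomp) (hmem) (hd)
    {X Y : C.Obj} {n : ℤ} {f : X ⟶ Y} (hf : f ∈ C.gr X Y n) :
    (ofHomogeneous (D := D) obj φ hid hcomp hmem hd).map f = φ X Y n ⟨f, hf⟩ := by
  simp [ofHomogeneous, DGCat.homEquiv_of_mem hf, DirectSum.toModule_lof]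

theorem ext_homogeneous {G H : C ⟶ D} (hobj : ∀ X, G.obj X = H.obj X)
    (hmap : ∀ ⦃X Y : C.Obj⦄ (n : ℤ) (f : X ⟶ Y), f ∈ C.gr X Y n → HEq (G.map f) (H.map f)) :
    G = H := by
  obtain ⟨⟨Go, Gm, Gid, Gcomp⟩, Gadd, Gsmul, _, _⟩ := G
  obtain ⟨⟨Ho, Hm, Hid, Hcomp⟩, Hadd, Hsmul, _, _⟩ := H
  obtain rfl : Go = Ho := funext hobj
  obtain rfl : @Gm = @Hm := by
    ext X Y f
    refine DGCat.homogeneous_induction (P := fun f => Gm f = Hm f) ?_ (fun f g h h' => ?_)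
      (fun n f hf => ?_) f
    · exact eq_of_heq (hmap 0 _ (zero_mem _))
    · exact (Gadd f g).trans ((congrArg₂ _ h h').trans (Hadd f g).symm)
    · exact eq_of_heq (hmap n _ hf)
  rfl

end DGFunctor

end CommonKernel

/-! ### Existence of small colimits of dg categories. -/

section Colimits

open GradedQuiver Limits

variable {K : Type u} [CommRing K]

namespace DGColimit

variable {J : Type u} [SmallCategory J] (D : J ⥤ DGCat K)

/-- The objects of the colimit of a diagram of dg categories. -/
def ColimitVert : Type u :=
  Quot fun x y : (Σ j, (D.obj j).Obj) => ∃ φ : x.1 ⟶ y.1, (D.map φ).obj x.2 = y.2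

variable {D}

/-- The class of an object in the colimit. -/
def ColimitVert.mk (j : J) (X : (D.obj j).Obj) : ColimitVert D := Quot.mk _ ⟨j, X⟩

/-- The generators of the colimit: the homogeneous morphisms and their formal differentials. -/
inductive ColimitArr : ColimitVert D → ColimitVert D → Type u
  | of (j : J) {X Y : (D.obj j).Obj} (n : ℤ) (f : (D.obj j).gr X Y n) :
      ColimitArr (.mk j X) (.mk j Y)
  -- The differential of a generator is a further free generator. Hence a cocone extends to the free
  -- dg category without any relation to check; the identification with the differential taken in
  -- the diagram happens only in the quotient.
  | d (j : J) {X Y : (D.obj j).Obj} (n : ℤ) (f : (D.obj j).gr X Y n) :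
      ColimitArr (.mk j X) (.mk j Y)

instance : GradedQuiver (ColimitVert D) where
  Hom := ColimitArr
  deg
    | .of _ n _ => n
    | .d _ n _ => n + 1

namespace ColimitVert

/-- The generator given by a homogeneous morphism. -/
def of (j : J) {X Y : (D.obj j).Obj} (n : ℤ) (f : (D.obj j).gr X Y n) :
    (mk j X : ColimitVert D) ⟶ mk j Y := ColimitArr.of j n f

/-- The formal differential of a homogeneous morphism. -/
def d (j : J) {X Y : (D.obj j).Obj} (n : ℤ) (f : (D.obj j).gr X Y n) :
    (mk j X : ColimitVert D) ⟶ mk j Y := ColimitArr.d j n f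

end ColimitVert

/-- The differential on the generators of the colimit. -/
noncomputable def colimitD : ∀ ⦃a b : ColimitVert D⦄, (a ⟶ b) → (pt K a ⟶ pt K b)
  | _, _, .of j n f => ofArr K (ColimitVert.d j n f)
  | _, _, .d _ _ _ => 0

theorem colimitD_mem ⦃a b : ColimitVert D⦄ (e : a ⟶ b) :
    colimitD e ∈ gr K (pt K a) (pt K b) (deg e + 1) := by
  match a, b, e with
  | _, _, .of j n f => exact ofArr_mem (ColimitVert.d j n f)
  | _, _, .d _ _ _ => exact zero_mem _

theorem colimitD_colimitD ⦃a b : ColimitVert D⦄ (e : a ⟶ b) :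
    dLin (colimitD (K := K)) _ _ (colimitD e) = 0 := by
  match a, b, e with
  | _, _, .of j n f => exact dLin_ofArr _ (ColimitVert.d j n f)
  | _, _, .d _ _ _ => exact map_zero _

variable (D) in
/-- The free dg category on the generators of the colimit. -/
noncomputable def preColimit : DGCat K := dgCat colimitD (colimitD_mem (D := D)) colimitD_colimitD

variable {B : DGCat K} (s : D ⟶ (Functor.const J).obj B)

/-- A leg of a cocone. -/
abbrev leg (j : J) : D.obj j ⟶ B := s.app j

/-- The dg functor out of the colimit induced by a cocone, on objects. -/
def colimitDescObj : ColimitVert D → B.Obj :=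
  Quot.lift (fun x => (s.app x.1).obj x.2) (by
    rintro ⟨i, X⟩ ⟨j, Y⟩ ⟨φ, h⟩
    dsimp only at φ h
    rw [← h]
    exact (congrArg (fun G : D.obj i ⟶ B => G.obj X)
      ((s.naturality φ).trans (Category.comp_id _))).symm)

/-- The dg functor out of the colimit induced by a cocone, on generators. -/
def colimitDescMap : ∀ ⦃a b : ColimitVert D⦄, (a ⟶ b) →
    (colimitDescObj s a ⟶ colimitDescObj s b)
  | _, _, .of j _ f => (leg s j).map f.1
  | _, _, .d j _ f => B.d _ _ ((leg s j).map f.1)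

/-- The dg functor induced by a cocone on the free dg category on the generators. -/
noncomputable def preColimitDesc : preColimit D ⟶ B :=
  lift (C := B) _ (colimitDescObj s) (colimitDescMap s) _ _
    (fun _ _ e => match e with
      | .of j _ f => (leg s j).map_mem f.2
      | .d j _ f => DGCategory.d_mem ((leg s j).map_mem f.2))
    (fun _ _ e => match e with
      | .of j n f => linMap_ofArr _ _ (ColimitVert.d j n f)
      | .d j _ f => (map_zero _).trans (DGCat.d_d _).symm)

theorem preColimitDesc_of {j : J} {X Y : (D.obj j).Obj} {n : ℤ} (f : (D.obj j).gr X Y n) :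
    (preColimitDesc s).map (ofArr (V := ColimitVert D) K (ColimitVert.of j n f)) = (leg s j).map f.1 :=
  linMap_ofArr (K := K) (colimitDescObj s) (colimitDescMap s) (ColimitVert.of j n f)

theorem preColimit_d_of {j : J} {X Y : (D.obj j).Obj} {n : ℤ} (f : (D.obj j).gr X Y n) :
    (preColimit D).d _ _ (ofArr (V := ColimitVert D) K (ColimitVert.of j n f)) =
      ofArr (V := ColimitVert D) K (ColimitVert.d j n f) :=
  dLin_ofArr _ (ColimitVert.of j n f)

/-- The dg functors induced by cocones. -/
def IsPreColimitDesc ⦃B : DGCat K⦄ (G : preColimit D ⟶ B) : Prop :=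
  ∃ s : D ⟶ (Functor.const J).obj B, G = preColimitDesc s

variable (D) in
/-- The colimit of a diagram of dg categories. -/
noncomputable def colimitObj : DGCat K := DGCat.kernelQuotient (IsPreColimitDesc (D := D))

variable (D) in
/-- The projection from the free dg category on the generators to the colimit. -/
noncomputable def preColimitProj : preColimit D ⟶ colimitObj D :=
  DGCat.toKernelQuotient (IsPreColimitDesc (D := D))

/-- A relation holds in the colimit once it holds in the target of every cocone. Linearity and
functoriality of the maps into the colimit are thus inherited from the legs of cocones. -/
theorem preColimitProj_map_eq {X Y : (preColimit D).Obj} {f g : X ⟶ Y}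
    (h : ∀ ⦃B : DGCat K⦄ (s : D ⟶ (Functor.const J).obj B),
      (preColimitDesc s).map f = (preColimitDesc s).map g) :
    (preColimitProj D).map f = (preColimitProj D).map g :=
  DGCat.toKernelQuotient_map_eq fun _ _ ⟨s, hs⟩ => hs ▸ h s

theorem preColimitProj_map_heq {X Y X' Y' : (preColimit D).Obj} {f : X ⟶ Y} {g : X' ⟶ Y'}
    (hX : X = X') (hY : Y = Y') (h : ∀ ⦃B : DGCat K⦄ (s : D ⟶ (Functor.const J).obj B),
      HEq ((preColimitDesc s).map f) ((preColimitDesc s).map g)) :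
    HEq ((preColimitProj D).map f) ((preColimitProj D).map g) :=
  DGCat.toKernelQuotient_map_heq hX hY fun _ _ ⟨s, hs⟩ => hs ▸ h s

/-- An object of a dg category of the diagram as an object of the free dg category. -/
noncomputable def preColimitPt (j : J) (X : (D.obj j).Obj) : (preColimit D).Obj :=
  pt (V := ColimitVert D) K (.mk j X)

/-- The generator of the free dg category given by a homogeneous morphism. -/
noncomputable def gen (j : J) {X Y : (D.obj j).Obj} {n : ℤ} (f : (D.obj j).gr X Y n) :
    preColimitPt j X ⟶ preColimitPt j Y :=
  ofArr (V := ColimitVert D) K (ColimitVert.of j n f)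

theorem gen_mem (j : J) {X Y : (D.obj j).Obj} {n : ℤ} (f : (D.obj j).gr X Y n) :
    gen j f ∈ (preColimit D).gr _ _ n := ofArr_mem (ColimitVert.of j n f)

theorem preColimitDesc_gen {j : J} {X Y : (D.obj j).Obj} {n : ℤ} (f : (D.obj j).gr X Y n) :
    (preColimitDesc s).map (gen j f) = (leg s j).map f.1 := preColimitDesc_of s f

/-- The dg functors to the colimit. -/
noncomputable def toColimit (j : J) : D.obj j ⟶ colimitObj D :=
  DGFunctor.ofHomogeneous (D := colimitObj D)
    (fun X => (preColimitProj D).obj (preColimitPt j X))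
    (fun X Y n =>
      { toFun := fun f => (preColimitProj D).map (gen j f)
        map_add' := fun f g => by
          rw [← DGFunctor.map_add]
          refine preColimitProj_map_eq fun B s => ?_
          rw [DGFunctor.map_add, preColimitDesc_gen, preColimitDesc_gen, preColimitDesc_gen]
          exact DGFunctor.map_add _ _ _
        map_smul' := fun r f => by
          rw [RingHom.id_apply, ← DGFunctor.map_smul]
          refine preColimitProj_map_eq fun B s => ?_
          rw [DGFunctor.map_smul, preColimitDesc_gen, preColimitDesc_gen]
          exact DGFunctor.map_smul _ _ _ })
    (fun X => by
      refine Eq.trans ?_ ((preColimitProj D).map_id _)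
      refine preColimitProj_map_eq fun B s => ?_
      refine (preColimitDesc_gen s _).trans ?_
      exact ((leg s j).map_id X).trans ((preColimitDesc s).map_id (preColimitPt j X)).symm)
    (fun {X Y Z p q} f g => by
      refine Eq.trans ?_ ((preColimitProj D).map_comp (gen j f) (gen j g))
      refine preColimitProj_map_eq fun B s => ?_
      refine (preColimitDesc_gen s _).trans (((leg s j).map_comp _ _).trans ?_)
      refine Eq.trans ?_ ((preColimitDesc s).map_comp (gen j f) (gen j g)).symm
      exact congrArg₂ _ (preColimitDesc_gen s f).symm (preColimitDesc_gen s g).symm)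
    (fun f => DGFunctor.map_mem _ (gen_mem j f))
    (fun f => by
      refine Eq.trans ?_ ((preColimitProj D).map_d (gen j f))
      refine preColimitProj_map_eq fun B s => ?_
      refine (preColimitDesc_gen s _).trans (((leg s j).map_d _).trans ?_)
      refine Eq.trans ?_ ((preColimitDesc s).map_d (gen j f)).symm
      exact congrArg _ (preColimitDesc_gen s f).symm)

theorem toColimit_map {j : J} {X Y : (D.obj j).Obj} {n : ℤ} {f : X ⟶ Y}
    (hf : f ∈ (D.obj j).gr X Y n) :
    (toColimit j).map f = (preColimitProj D).map (gen j ⟨f, hf⟩) :=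
  DGFunctor.ofHomogeneous_map _ _ _ _ _ _ hf

/-- On objects this is the relation defining `ColimitVert`; on morphisms it is the naturality of
every cocone. Heterogeneous equality appears because the end objects agree only through
`Quot.sound`. -/
theorem map_toColimit {i j : J} (φ : i ⟶ j) : D.map φ ≫ toColimit j = toColimit i := by
  have hobj : ∀ X, (pt (V := ColimitVert D) K (.mk j ((D.map φ).obj X)) : (preColimit D).Obj) =
      pt (V := ColimitVert D) K (.mk i X) := fun X =>
    congrArg (pt (V := ColimitVert D) K) (Quot.sound ⟨φ, rfl⟩).symm
  refine DGFunctor.ext_homogeneous (fun X => congrArg (preColimitProj D).obj (hobj X))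
    (fun X Y n f hf => ?_)
  refine (heq_of_eq (toColimit_map ((D.map φ).map_mem hf))).trans
    (HEq.trans ?_ (heq_of_eq (toColimit_map hf).symm))
  refine preColimitProj_map_heq (hobj X) (hobj Y) fun B s => ?_
  refine (heq_of_eq (preColimitDesc_gen s _)).trans
    (HEq.trans ?_ (heq_of_eq (preColimitDesc_gen s _).symm))
  exact congr_arg_heq (fun G : D.obj i ⟶ B => G.map f)
    ((s.naturality φ).trans (Category.comp_id _))

variable (D) in
/-- The colimit cocone. -/
noncomputable def colimitCocone : Cocone D where
  pt := colimitObj D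
  ι :=
    { app := toColimit
      naturality := fun _ _ φ => (map_toColimit φ).trans (Category.comp_id _).symm }

/-- The dg functor out of the colimit induced by a cocone. -/
noncomputable def colimitDesc : colimitObj D ⟶ B :=
  DGCat.kernelQuotientDesc (preColimitDesc s) ⟨s, rfl⟩

theorem toColimit_desc (j : J) : toColimit j ≫ colimitDesc s = leg s j := by
  refine DGFunctor.ext_homogeneous (fun _ => rfl) (fun X Y n f hf => heq_of_eq ?_)
  refine (congrArg (colimitDesc s).map (toColimit_map hf)).trans ?_
  exact preColimitDesc_gen s ⟨f, hf⟩

theorem d_heq {C : DGCat K} {X Y X' Y' : C.Obj} {f : X ⟶ Y} {g : X' ⟶ Y'} (hX : X = X')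
    (hY : Y = Y') (h : HEq f g) : HEq (C.d _ _ f) (C.d _ _ g) := by
  subst hX hY h
  rfl

theorem colimit_hom_ext {G H : colimitObj D ⟶ B}
    (h : ∀ j, toColimit j ≫ G = toColimit j ≫ H) : G = H := by
  refine DGCat.kernelQuotient_ext ?_
  have hobj : ∀ v : ColimitVert D, G.obj ((preColimitProj D).obj (pt (V := ColimitVert D) K v)) =
      H.obj ((preColimitProj D).obj (pt (V := ColimitVert D) K v)) := by
    rintro ⟨j, X⟩
    exact congrArg (fun F : D.obj j ⟶ B => F.obj X) (h j)
  have hgen : ∀ {j : J} {X Y : (D.obj j).Obj} {n : ℤ} (f : (D.obj j).gr X Y n),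
      HEq (G.map ((preColimitProj D).map (gen j f))) (H.map ((preColimitProj D).map (gen j f))) := by
    intro j X Y n f
    rw [← toColimit_map f.2]
    exact congr_arg_heq (fun F : D.obj j ⟶ B => F.map f.1) (h j)
  refine dgFunctor_ext hobj (fun a b e => ?_)
  match a, b, e with
  | _, _, .of j n f => exact hgen f
  | _, _, .d j n f =>
    -- A formal differential is the differential of another generator, so agreement there follows
    -- from compatibility with differentials.
    have e : ∀ F : colimitObj D ⟶ B, (preColimitProj D ≫ F).map
        (ofArr (V := ColimitVert D) K (ColimitVert.d j n f)) =
        B.d _ _ (F.map ((preColimitProj D).map (gen j f))) := fun F => by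
      rw [← preColimit_d_of]
      exact (preColimitProj D ≫ F).map_d (gen j f)
    refine (heq_of_eq (e G)).trans (HEq.trans ?_ (heq_of_eq (e H).symm))
    exact d_heq (hobj _) (hobj _) (hgen f)

variable (D) in
/-- The colimit cocone is a colimit. -/
noncomputable def colimitCoconeIsColimit : IsColimit (colimitCocone D) where
  desc s := colimitDesc s.ι
  fac s j := toColimit_desc s.ι j
  uniq s _ hm := colimit_hom_ext fun j => (hm j).trans (toColimit_desc s.ι j).symm

end DGColimit

instance : HasColimitsOfSize.{u, u} (DGCat.{u} K) where
  has_colimits_of_shape _ _ :=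
    { has_colimit := fun D => ⟨⟨_, DGColimit.colimitCoconeIsColimit D⟩⟩ }

instance : HasPushouts (DGCat.{u} K) :=
  -- The shape of a span lives in universe 0, while colimits were constructed for shapes in universe
  -- u.
  have := hasColimitsOfSizeShrink.{0, 0, u, u} (DGCat.{u} K)
  inferInstance

end Colimits

/-! ### Closure properties of attachments. -/

section Cells

open Limits

universe w v' u'

namespace CategoryTheory.MorphismProperty

variable {C : Type u'} [Category.{v'} C]

/-- The morphisms obtained by attaching a family of morphisms of `S` all at once. -/
def IsAttach (S : MorphismProperty C) : MorphismProperty C := fun X Y f =>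
  ∃ (T : Type w) (A B : T → C) (i : ∀ t, A t ⟶ B t) (a : ∀ t, A t ⟶ X) (b : ∀ t, B t ⟶ Y),
    (∀ t, S (i t)) ∧ (∀ t, a t ≫ f = i t ≫ b t) ∧
    ∀ (Z : C) (φ : X ⟶ Z) (ψ : ∀ t, B t ⟶ Z), (∀ t, a t ≫ φ = i t ≫ ψ t) →
      ∃! y : Y ⟶ Z, f ≫ y = φ ∧ ∀ t, b t ≫ y = ψ t

theorem pushouts_coproducts_le_isAttach (S : MorphismProperty C) :
    (coproducts.{w} S).pushouts ≤ IsAttach.{w} S := by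
  rintro X Y f ⟨A, B, p, a, b, hp, sq⟩
  rw [coproducts_iff] at hp
  obtain ⟨T, ⟨X₁, X₂, c₁, c₂, h₁, h₂, α, hα⟩⟩ := hp
  refine ⟨T, fun t => X₁.obj ⟨t⟩, fun t => X₂.obj ⟨t⟩, fun t => α.app ⟨t⟩,
    fun t => c₁.ι.app ⟨t⟩ ≫ a, fun t => c₂.ι.app ⟨t⟩ ≫ b, fun t => hα ⟨t⟩, fun t => ?_,
    fun Z φ ψ h => ?_⟩
  · rw [Category.assoc, sq.w, h₁.fac_assoc]
    exact Category.assoc _ _ _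
  · let ψ' : c₂.pt ⟶ Z := h₂.desc ⟨Z, Discrete.natTrans fun t => ψ t.as⟩
    have hψ' : ∀ t : T, c₂.ι.app ⟨t⟩ ≫ ψ' = ψ t := fun t => h₂.fac _ ⟨t⟩
    have hw : a ≫ φ = h₁.desc (Cocone.mk _ (α ≫ c₂.ι)) ≫ ψ' := by
      refine h₁.hom_ext fun ⟨t⟩ => ?_
      rw [h₁.fac_assoc, ← Category.assoc, h t, ← hψ' t]
      exact (Category.assoc _ _ _).symm
    refine ⟨sq.desc φ ψ' hw, ⟨sq.inl_desc _ _ _, fun t => ?_⟩, fun y hy => ?_⟩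
    · rw [Category.assoc, sq.inr_desc, hψ']
    · refine sq.hom_ext (by rw [hy.1, sq.inl_desc]) (h₂.hom_ext fun ⟨t⟩ => ?_)
      rw [sq.inr_desc, hψ', ← Category.assoc, hy.2]

theorem isAttach_le_pushouts_coproducts [HasCoproducts.{w} C] (S : MorphismProperty C) :
    IsAttach.{w} S ≤ (coproducts.{w} S).pushouts := by
  rintro X Y f ⟨T, A, B, i, a, b, hi, hw, huniv⟩
  have hp : coproducts.{w} S (Limits.Sigma.map i) := by
    refine colimitsOfShape_le_coproducts S T _ ?_
    exact colimitsOfShape.mk' _ _ _ _ (colimit.isColimit _) (colimit.isColimit _)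
      (Discrete.natTrans fun t => i t.as) (fun t => hi t.as) _ (fun t => ι_colimMap _ _)
  refine ⟨_, _, Limits.Sigma.map i, Limits.Sigma.desc a, Limits.Sigma.desc b, hp, ⟨⟨?_⟩, ⟨?_⟩⟩⟩
  · exact Limits.Sigma.hom_ext _ _ fun t => by simp [hw]
  · have hs : ∀ s : PushoutCocone (Limits.Sigma.desc a) (Limits.Sigma.map i), ∀ t,
        a t ≫ s.inl = i t ≫ Limits.Sigma.ι B t ≫ s.inr := fun s t => by
      have := Limits.Sigma.ι A t ≫= s.condition
      simpa using this
    choose y hy hy' using fun s => huniv s.pt s.inl _ (hs s)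
    refine PushoutCocone.IsColimit.mk _ y (fun s => (hy s).1)
      (fun s => Limits.Sigma.hom_ext _ _ fun t => ?_) (fun s m h₁ h₂ => hy' s m ⟨h₁, fun t => ?_⟩)
    · rw [← Category.assoc, Limits.Sigma.ι_desc]
      exact (hy s).2 t
    · rw [← h₂, ← Category.assoc, Limits.Sigma.ι_desc]

/-- This trades a pushout of a coproduct for one universal property phrased with families, which is
easier to verify for concrete dg functors. -/
theorem pushouts_coproducts_eq_isAttach [HasCoproducts.{w} C] (S : MorphismProperty C) :
    (coproducts.{w} S).pushouts = IsAttach.{w} S :=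
  le_antisymm (pushouts_coproducts_le_isAttach S) (isAttach_le_pushouts_coproducts S)

/-- The attached family is empty: the universal property then only says that every morphism factors
uniquely through f. Isomorphisms and identities obtained in this way serve as padding for
composites. -/
theorem isAttach_of_isIso (S : MorphismProperty C) {X Y : C} (f : X ⟶ Y) [IsIso f] :
    IsAttach.{w} S f :=
  ⟨PEmpty, PEmpty.elim, PEmpty.elim, fun t => t.elim, fun t => t.elim, fun t => t.elim,
    fun t => t.elim, fun t => t.elim, fun _ φ _ _ =>
      ⟨inv f ≫ φ, ⟨IsIso.hom_inv_id_assoc f φ, fun t => t.elim⟩,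
        fun y hy => by rw [← hy.1, IsIso.inv_hom_id_assoc]⟩⟩

/-- The families attached to the summands are merged into one family indexed by the sigma type. -/
theorem coproducts_isAttach_le (S : MorphismProperty C) :
    coproducts.{w} (IsAttach.{w} S) ≤ IsAttach.{w} S := by
  intro X Y f hf
  rw [coproducts_iff] at hf
  obtain ⟨T, ⟨X₁, X₂, c₁, c₂, h₁, h₂, α, hα⟩⟩ := hf
  choose R A B i a b hi hw huniv using fun t : T => hα ⟨t⟩
  refine ⟨Σ t, R t, fun x => A x.1 x.2, fun x => B x.1 x.2, fun x => i x.1 x.2,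
    fun x => a x.1 x.2 ≫ c₁.ι.app ⟨x.1⟩, fun x => b x.1 x.2 ≫ c₂.ι.app ⟨x.1⟩,
    fun x => hi x.1 x.2, fun x => ?_, fun Z φ ψ h => ?_⟩
  · rw [Category.assoc, h₁.fac]
    change a x.1 x.2 ≫ α.app ⟨x.1⟩ ≫ c₂.ι.app ⟨x.1⟩ = _
    rw [← Category.assoc, hw, Category.assoc]
  · have h' : ∀ t (r : R t), a t r ≫ c₁.ι.app ⟨t⟩ ≫ φ = i t r ≫ ψ ⟨t, r⟩ := fun t r => by
      rw [← h ⟨t, r⟩, Category.assoc]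
    choose y hy hy' using fun t => huniv t Z (c₁.ι.app ⟨t⟩ ≫ φ) (fun r => ψ ⟨t, r⟩) (h' t)
    let y' : c₂.pt ⟶ Z := h₂.desc ⟨Z, Discrete.natTrans fun t => y t.as⟩
    have ey : ∀ t : T, c₂.ι.app ⟨t⟩ ≫ y' = y t := fun t => h₂.fac _ ⟨t⟩
    refine ⟨y', ⟨h₁.hom_ext fun ⟨t⟩ => ?_, fun ⟨t, r⟩ => ?_⟩, fun z hz => h₂.hom_ext fun ⟨t⟩ => ?_⟩
    · rw [h₁.fac_assoc]
      refine (Category.assoc _ _ _).trans ?_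
      rw [ey]
      exact (hy t).1
    · rw [Category.assoc, ey]
      exact (hy t).2 r
    · rw [ey]
      refine hy' t _ ⟨?_, fun r => ?_⟩
      · rw [← hz.1, h₁.fac_assoc]
        exact (Category.assoc _ _ _).symm
      · rw [← hz.2 ⟨t, r⟩, Category.assoc]

/-! ### Composites of two steps and their insertion into sequences. -/

/-- The composites of two morphisms of `W`. -/
def twoStep (W : MorphismProperty C) : MorphismProperty C := fun X Y f =>
  ∃ (Z : C) (g : X ⟶ Z) (h : Z ⟶ Y), W g ∧ W h ∧ g ≫ h = f

theorem le_twoStep {W : MorphismProperty C} (hW : ∀ X, W (𝟙 X)) : W ≤ twoStep W :=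
  fun X _ f hf => ⟨X, 𝟙 X, f, hW X, hf, Category.id_comp f⟩

theorem twoStep_id {W : MorphismProperty C} (hW : ∀ X, W (𝟙 X)) (X : C) : twoStep W (𝟙 X) :=
  le_twoStep hW _ (hW X)

/-- The first factor is pushed out along a; by the pasting law the remaining square is then a
pushout of the second factor. -/
theorem pushouts_twoStep_le [HasPushouts C] {W : MorphismProperty C} (hW : W.pushouts ≤ W) :
    (twoStep W).pushouts ≤ twoStep W := by
  rintro X Y f ⟨A, B, p, a, b, ⟨M, g, h, hg, hh, rfl⟩, sq⟩
  have sq₁ := IsPushout.of_hasPushout a g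
  have hw : a ≫ f = g ≫ h ≫ b := by rw [sq.w, Category.assoc]
  refine ⟨_, pushout.inl a g, sq₁.desc f (h ≫ b) hw, hW _ ⟨_, _, _, _, _, hg, sq₁⟩,
    hW _ ⟨_, _, h, pushout.inr a g, b, hh, ?_⟩, sq₁.inl_desc _ _ _⟩
  refine IsPushout.of_top ?_ (sq₁.inr_desc _ _ _) sq₁
  rwa [sq₁.inl_desc]

/-- The coproduct of the intermediate objects factors the given map into two coproducts. -/
theorem coproducts_twoStep_le [HasCoproducts.{w} C] {W : MorphismProperty C}
    (hW : coproducts.{w} W ≤ W) : coproducts.{w} (twoStep W) ≤ twoStep W := by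
  intro X Y f hf
  rw [coproducts_iff] at hf
  obtain ⟨T, ⟨X₁, X₂, c₁, c₂, h₁, h₂, α, hα⟩⟩ := hf
  choose M g h hg hh hgh using hα
  let N : Discrete T ⥤ C := Discrete.functor fun t => M ⟨t⟩
  let β : X₁ ⟶ N := Discrete.natTrans fun t => g t
  let γ : N ⟶ X₂ := Discrete.natTrans fun t => h t
  refine ⟨colimit N, h₁.desc (Cocone.mk _ (β ≫ (colimit.cocone N).ι)),
    (colimit.isColimit N).desc (Cocone.mk _ (γ ≫ c₂.ι)),
    hW _ (colimitsOfShape_le_coproducts W T _ ⟨_, _, _, _, h₁, colimit.isColimit N, β, fun t => hg t⟩),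
    hW _ (colimitsOfShape_le_coproducts W T _ ⟨_, _, _, _, colimit.isColimit N, h₂, γ, fun t => hh t⟩),
    h₁.hom_ext fun t => ?_⟩
  rw [h₁.fac_assoc, h₁.fac]
  change (g t ≫ colimit.ι N t) ≫ _ = α.app t ≫ _
  rw [Category.assoc]
  have := (colimit.isColimit N).fac (Cocone.mk _ (γ ≫ c₂.ι)) t
  refine (congrArg (g t ≫ ·) this).trans ?_
  change g t ≫ h t ≫ _ = _
  rw [← Category.assoc, hgh]

/-- The sequence `inl 0, inr 0, inl 1, inr 1, …`. -/
def interleave : ℕ → ℕ ⊕ ℕ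
  | 0 => .inl 0
  | n + 1 => (interleave n).elim .inr fun i => .inl (i + 1)

/-- The successor in the sequence `interleave`. -/
def interleaveNext (s : ℕ ⊕ ℕ) : ℕ ⊕ ℕ := s.elim .inr fun i => .inl (i + 1)

/-- The position in the sequence `interleave`. -/
def interleaveIndex : ℕ ⊕ ℕ → ℕ
  | .inl i => 2 * i
  | .inr i => 2 * i + 1

theorem interleave_index_inl (i : ℕ) : interleave (2 * i) = .inl i := by
  induction i with
  | zero => rfl
  | succ i ih =>
    change interleaveNext (interleaveNext (interleave (2 * i))) = _
    rw [ih]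
    rfl

/-- Positions correspond bijectively to states in ℕ ⊕ ℕ. Objects and maps of the refined sequence
are defined on states, so types never depend on the parity of a natural number. -/
theorem interleave_index (s : ℕ ⊕ ℕ) : interleave (interleaveIndex s) = s := by
  rcases s with i | i
  · exact interleave_index_inl i
  · change interleaveNext (interleave (2 * i)) = _
    rw [interleave_index_inl]
    rfl

theorem interleaveIndex_next (s : ℕ ⊕ ℕ) :
    interleaveIndex (interleaveNext s) = interleaveIndex s + 1 := by
  cases s <;> rfl

theorem interleaveIndex_interleave (n : ℕ) : interleaveIndex (interleave n) = n := by
  induction n with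
  | zero => rfl
  | succ n ih => exact (interleaveIndex_next (interleave n)).trans (congrArg (· + 1) ih)

section Refine

variable (F : ℕ ⥤ C) (M : ℕ → C) (g : ∀ i, F.obj i ⟶ M i) (h : ∀ i, M i ⟶ F.obj (i + 1))

/-- The objects of the refinement of a sequence by factorizations of its maps. -/
def refineObj : ℕ ⊕ ℕ → C := Sum.elim F.obj M

/-- The maps of the refinement of a sequence by factorizations of its maps. -/
def refineMap : ∀ s : ℕ ⊕ ℕ, refineObj F M s ⟶ refineObj F M (interleaveNext s)
  | .inl i => g i
  | .inr i => h i

/-- The refinement of a sequence by factorizations of its maps. -/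
def refineFunctor : ℕ ⥤ C :=
  Functor.ofSequence (X := fun n => refineObj F M (interleave n))
    fun n => refineMap F M g h (interleave n)

theorem refineFunctor_map (n : ℕ) : (refineFunctor F M g h).map (homOfLE (Nat.le_add_right n 1)) =
    refineMap F M g h (interleave n) :=
  Functor.ofSequence_map_homOfLE_succ _ n

variable {F M g h} {Z : C} (t : refineFunctor F M g h ⟶ (Functor.const ℕ).obj Z)

/-- The leg of a cocone of the refinement at a given state. -/
def refineLeg (n : ℕ) (s : ℕ ⊕ ℕ) (e : interleave n = s) : refineObj F M s ⟶ Z :=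
  eqToHom (congrArg (refineObj F M) e.symm) ≫ t.app n

theorem refineLeg_congr {m n : ℕ} (h : m = n) {s : ℕ ⊕ ℕ} (e : interleave m = s)
    (e' : interleave n = s) : refineLeg t m s e = refineLeg t n s e' := by
  subst h
  rfl

theorem refineMap_refineLeg (n : ℕ) (s : ℕ ⊕ ℕ) (e : interleave n = s) :
    refineMap F M g h s ≫ refineLeg t (n + 1) (interleaveNext s) (congrArg interleaveNext e) =
      refineLeg t n s e := by
  subst e
  have := t.naturality (homOfLE (Nat.le_add_right n 1))
  rw [refineFunctor_map] at this
  refine Eq.trans ?_ (this.trans ?_)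
  · exact congrArg _ (Category.id_comp _)
  · exact (Category.comp_id _).trans (Category.id_comp _).symm

/-- The legs of a cocone of the refinement. -/
def refineLeg' (s : ℕ ⊕ ℕ) : refineObj F M s ⟶ Z :=
  refineLeg t (interleaveIndex s) s (interleave_index s)

theorem refineMap_refineLeg' (s : ℕ ⊕ ℕ) :
    refineMap F M g h s ≫ refineLeg' t (interleaveNext s) = refineLeg' t s := by
  refine Eq.trans ?_ (refineMap_refineLeg t _ s (interleave_index s))
  exact congrArg _ (refineLeg_congr t (interleaveIndex_next s) _ _)

variable {Y : C} {ι : F ⟶ (Functor.const ℕ).obj Y}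

/-- The legs of the colimit cocone of the refinement. -/
def refineIncl (h : ∀ i, M i ⟶ F.obj (i + 1)) (ι : F ⟶ (Functor.const ℕ).obj Y) :
    ∀ s : ℕ ⊕ ℕ, refineObj F M s ⟶ Y
  | .inl i => ι.app i
  | .inr i => h i ≫ ι.app (i + 1)

theorem refineMap_refineIncl (hgh : ∀ i, g i ≫ h i = F.map (homOfLE (Nat.le_add_right i 1)))
    (s : ℕ ⊕ ℕ) :
    refineMap F M g h s ≫ refineIncl h ι (interleaveNext s) = refineIncl h ι s := by
  rcases s with i | i
  · change g i ≫ h i ≫ ι.app (i + 1) = ι.app i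
    rw [← Category.assoc, hgh, ι.naturality]
    exact Category.comp_id _
  · rfl

/-- The colimit cocone of the refinement. -/
def refineCocone (hgh : ∀ i, g i ≫ h i = F.map (homOfLE (Nat.le_add_right i 1)))
    (ι : F ⟶ (Functor.const ℕ).obj Y) : refineFunctor F M g h ⟶ (Functor.const ℕ).obj Y :=
  NatTrans.ofSequence (fun n => refineIncl h ι (interleave n)) fun n => by
    rw [refineFunctor_map]
    exact (refineMap_refineIncl hgh (interleave n)).trans (Category.comp_id _).symm

/-- The restriction of a cocone of the refinement to the original sequence. -/
def restrictRefine (hgh : ∀ i, g i ≫ h i = F.map (homOfLE (Nat.le_add_right i 1))) :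
    F ⟶ (Functor.const ℕ).obj Z :=
  NatTrans.ofSequence (fun i => refineLeg' t (.inl i)) fun i => by
    rw [← hgh]
    refine (Category.assoc _ _ _).trans ?_
    refine (congrArg (g i ≫ ·) (refineMap_refineLeg' t (.inr i))).trans ?_
    exact (refineMap_refineLeg' t (.inl i)).trans (Category.comp_id _).symm

/-- The refinement has the same colimit. -/
def refineIsColimit (hgh : ∀ i, g i ≫ h i = F.map (homOfLE (Nat.le_add_right i 1)))
    (hι : IsColimit (Cocone.mk Y ι)) : IsColimit (Cocone.mk Y (refineCocone hgh ι)) where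
  desc t := hι.desc (Cocone.mk t.pt (restrictRefine t.ι hgh))
  fac t n := by
    have fac : ∀ i, ι.app i ≫ hι.desc (Cocone.mk t.pt (restrictRefine t.ι hgh)) =
        refineLeg' t.ι (.inl i) := fun i => hι.fac _ i
    -- At an original stage this is the universal property of the given colimit; at an inserted
    -- stage it follows from the next original one.
    have key : ∀ s, refineIncl h ι s ≫ hι.desc (Cocone.mk t.pt (restrictRefine t.ι hgh)) =
        refineLeg' t.ι s := by
      rintro (i | i)
      · exact fac i
      · change (h i ≫ ι.app (i + 1)) ≫ _ = _
        rw [Category.assoc, fac]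
        exact refineMap_refineLeg' t.ι (.inr i)
    refine (key (interleave n)).trans ?_
    exact (refineLeg_congr t.ι (interleaveIndex_interleave n) _ rfl).trans (Category.id_comp _)
  uniq t m hm := hι.hom_ext fun i => by
    rw [hι.fac]
    change _ = refineLeg' t.ι (.inl i)
    have key : ∀ n s (e : interleave n = s), refineIncl h ι s ≫ m = refineLeg t.ι n s e := by
      rintro n s rfl
      exact (hm n).trans (Category.id_comp _).symm
    -- Only the original stages are needed for uniqueness, since their legs already determine a
    -- morphism out of Y.
    exact key _ _ (interleave_index (.inl i))

end Refine

/-- The original stages are cofinal in the refined sequence, so inserting the midpoints of the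
factorizations does not change the colimit. -/
theorem transfiniteCompositions_twoStep_le (W : MorphismProperty C) :
    (twoStep W).transfiniteCompositionsOfShape ℕ ≤ W.transfiniteCompositionsOfShape ℕ := by
  rintro X Y f ⟨c⟩
  choose M g h hg hh hgh using fun i => c.map_mem i (not_isMax i)
  refine ⟨⟨⟨refineFunctor c.F M g h, c.isoBot, inferInstance, refineCocone hgh c.incl,
    refineIsColimit hgh c.isColimit, c.fac⟩, fun n _ => ?_⟩⟩
  refine (congrArg (fun f => W f) (refineFunctor_map c.F M g h n)).mpr ?_
  have key : ∀ s, W (refineMap c.F M g h s) := fun s => match s with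
    | .inl i => hg i
    | .inr i => hh i
  exact key (interleave n)

end CategoryTheory.MorphismProperty

end Cells

/-! ### Freely adjoining a morphism with prescribed differential. -/

section Adjoin

open GradedQuiver

variable {K : Type u} [CommRing K]

namespace GradedQuiver

/-- A dg functor out of a free dg category is the linear extension of its values on arrows; an
arbitrary functor can thereby be extended over an adjoined arrow with `lift`. -/
theorem map_eq_linMap {V : Type u} [GradedQuiver V]
    {δ : ∀ ⦃a b : V⦄, (a ⟶ b) → (pt K a ⟶ pt K b)}
    {hδ : ∀ ⦃a b : V⦄ (e : a ⟶ b), δ e ∈ gr K _ _ (deg e + 1)}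
    {hδδ : ∀ ⦃a b : V⦄ (e : a ⟶ b), dLin δ _ _ (δ e) = 0} {C : DGCat K} (F : dgCat δ hδ hδδ ⟶ C)
    {a b : V} (f : pt (V := V) K a ⟶ pt (V := V) K b) :
    F.map f = linMap (K := K) (V := V) (fun v => F.obj (pt (V := V) K v))
      (fun _ _ e => F.map (ofArr (V := V) K e)) a b f := by
  refine hom_induction (V := V) (P := fun f => F.map f = linMap (K := K) (V := V) _ _ a b f) ?_
    (fun f g h h' => ?_) (fun r f h => ?_) (fun p => ?_) f
  · exact (DGFunctor.map_zero F _ _).trans (map_zero _).symm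
  · exact (F.map_add f g).trans ((congrArg₂ _ h h').trans (map_add _ f g).symm)
  · exact (F.map_smul r f).trans ((congrArg _ h).trans (map_smul _ r f).symm)
  · refine Eq.trans ?_ (linMap_ofPath _ _ p).symm
    clear f
    induction p with
    | nil => exact F.map_id _
    | cons p e ih =>
      rw [ofPath_cons]
      exact (F.map_comp (ofPath (V := V) K p) (ofArr (V := V) K e)).trans (congrArg (· ≫ _) ih)

end GradedQuiver

variable (K) in
/-- A graded quiver together with a differential on its linearized path category. -/
structure DGQuiver where
  /-- the vertices -/
  V : Type u
  [quiver : GradedQuiver V]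
  /-- the values of the differential on arrows -/
  δ : ∀ ⦃a b : V⦄, (a ⟶ b) → (pt K a ⟶ pt K b)
  δ_mem : ∀ ⦃a b : V⦄ (e : a ⟶ b), δ e ∈ gr K _ _ (deg e + 1)
  dLin_δ : ∀ ⦃a b : V⦄ (e : a ⟶ b), dLin δ _ _ (δ e) = 0

attribute [instance] DGQuiver.quiver

namespace DGQuiver

variable (Q : DGQuiver K)

/-- The dg category freely generated by a dg quiver. -/
noncomputable abbrev dg : DGCat K := dgCat Q.δ Q.δ_mem Q.dLin_δ

/-- The vertices of the dg quiver obtained by adjoining an arrow of degree `-(n + 1)`. -/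
structure AdjoinVert (a b : Q.V) (n : ℤ) : Type u where
  val : Q.V

/-- The arrows of the dg quiver obtained by adjoining an arrow. -/
inductive AdjoinArr (a b : Q.V) (n : ℤ) :
    Q.AdjoinVert a b n → Q.AdjoinVert a b n → Type u
  | old {x y : Q.V} (e : x ⟶ y) : AdjoinArr a b n ⟨x⟩ ⟨y⟩
  | new : AdjoinArr a b n ⟨a⟩ ⟨b⟩

instance (a b : Q.V) (n : ℤ) : GradedQuiver (Q.AdjoinVert a b n) where
  Hom := Q.AdjoinArr a b n
  deg
    | .old e => deg e
    | .new => -(n + 1)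

section Adjoin

variable {Q} {a b : Q.V} {n : ℤ}

/-- An arrow of `Q` in the extended quiver. -/
def oldArr (a b : Q.V) (n : ℤ) {x y : Q.V} (e : x ⟶ y) :
    (⟨x⟩ : Q.AdjoinVert a b n) ⟶ ⟨y⟩ := AdjoinArr.old e

/-- The adjoined arrow. -/
def newArr (a b : Q.V) (n : ℤ) : (⟨a⟩ : Q.AdjoinVert a b n) ⟶ ⟨b⟩ := AdjoinArr.new

/-- The image of a path of `Q` in the extended quiver. -/
def oldPath (a b : Q.V) (n : ℤ) {x : Q.V} : {y : Q.V} → Quiver.Path x y →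
    Quiver.Path (⟨x⟩ : Q.AdjoinVert a b n) ⟨y⟩
  | _, .nil => .nil
  | _, .cons p e => .cons (oldPath a b n p) (oldArr a b n e)

/-- The inclusion of the linearized path categories. -/
noncomputable def oldLin (a b : Q.V) (n : ℤ) (x y : Q.V) : (pt K x ⟶ pt K y) →ₗ[K]
    (pt K (⟨x⟩ : Q.AdjoinVert a b n) ⟶ pt K ⟨y⟩) :=
  Finsupp.linearCombination K fun p : Quiver.Path x y => ofPath K (oldPath a b n p)

theorem oldLin_ofPath {x y : Q.V} (p : Quiver.Path x y) :
    oldLin a b n x y (ofPath K p) = ofPath K (oldPath a b n p) :=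
  (Finsupp.linearCombination_single K (1 : K) p).trans (one_smul K _)

theorem oldLin_ofArr {x y : Q.V} (e : x ⟶ y) :
    oldLin a b n x y (ofArr K e) = ofArr K (oldArr a b n e) :=
  oldLin_ofPath _

theorem oldLin_id (x : Q.V) : oldLin a b n x x (𝟙 (pt K x)) = 𝟙 _ :=
  oldLin_ofPath (Quiver.Path.nil : Quiver.Path x x)

theorem oldPath_comp {x y z : Q.V} (p : Quiver.Path x y) (q : Quiver.Path y z) :
    oldPath a b n (p.comp q) = (oldPath a b n p).comp (oldPath a b n q) := by
  induction q with
  | nil => rfl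
  | cons q e ih => exact congrArg (Quiver.Path.cons · _) ih

theorem oldLin_comp {x y z : Q.V} (f : pt K x ⟶ pt K y) (g : pt K y ⟶ pt K z) :
    oldLin a b n x z (f ≫ g) = oldLin a b n x y f ≫ oldLin a b n y z g := by
  refine hom_induction (P := fun f => oldLin a b n x z (f ≫ g) =
    oldLin a b n x y f ≫ oldLin a b n y z g) (by simp) (fun f f' h h' => ?_) (fun r f h => ?_)
    (fun p => ?_) f
  · simp only [Preadditive.add_comp, map_add, h, h']
  · simp only [Linear.smul_comp, map_smul, h]
  refine hom_induction (P := fun g => oldLin a b n x z (ofPath K p ≫ g) =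
    oldLin a b n x y (ofPath K p) ≫ oldLin a b n y z g) (by simp) (fun f f' h h' => ?_)
    (fun r f h => ?_) (fun q => ?_) g
  · simp only [Preadditive.comp_add, map_add, h, h']
  · simp only [Linear.comp_smul, map_smul, h]
  rw [← ofPath_comp, oldLin_ofPath, oldLin_ofPath, oldLin_ofPath, oldPath_comp, ofPath_comp]

theorem pathDeg_oldPath {x y : Q.V} (p : Quiver.Path x y) :
    pathDeg (oldPath a b n p) = pathDeg p := by
  induction p with
  | nil => rfl
  | cons p e ih => exact congrArg (· + deg e) ih

theorem oldLin_mem {x y : Q.V} {k : ℤ} {f : pt K x ⟶ pt K y} (hf : f ∈ gr K _ _ k) :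
    oldLin a b n x y f ∈ gr K _ _ k := by
  refine gr_induction (P := fun f => oldLin a b n x y f ∈ gr K _ _ k)
    (by simp) (fun f g h h' => ?_) (fun r f h => ?_) (fun p hp => ?_) hf
  · rw [map_add]; exact add_mem h h'
  · rw [map_smul]; exact Submodule.smul_mem _ _ h
  · rw [oldLin_ofPath, ← hp, ← pathDeg_oldPath]; exact ofPath_mem _

variable (z : pt K a ⟶ pt K b)

/-- The differential of the extended quiver on arrows: it maps the adjoined arrow to `z`. -/
noncomputable def adjoinδ (n : ℤ) (z : pt K a ⟶ pt K b) :
    ∀ ⦃x y : Q.AdjoinVert a b n⦄, (x ⟶ y) → (pt K x ⟶ pt K y)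
  | _, _, .old e => oldLin a b n _ _ (Q.δ e)
  | _, _, .new => oldLin a b n _ _ z

/-- Both sides obey the same Leibniz rule along the inclusion and agree on arrows by the choice of
`adjoinδ`. -/
theorem dLin_oldLin {x y : Q.V} (f : pt K x ⟶ pt K y) :
    dLin (adjoinδ n z) _ _ (oldLin a b n x y f) = oldLin a b n x y (dLin Q.δ _ _ f) := by
  refine hom_induction (P := fun f => dLin (adjoinδ n z) _ _ (oldLin a b n x y f) =
    oldLin a b n x y (dLin Q.δ _ _ f)) (by simp) (fun f g h h' => ?_) (fun r f h => ?_)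
    (fun p => ?_) f
  · simp only [map_add, h, h']
  · simp only [map_smul, h]
  · rw [oldLin_ofPath, dLin_ofPath, dLin_ofPath]
    clear f
    induction p with
    | nil => exact (map_zero _).symm
    | cons p e ih =>
      simp only [oldPath, dPath, map_add, Units.smul_def, map_zsmul, oldLin_comp, oldLin_ofPath,
        ih]
      rfl

variable (Q) in
/-- The dg quiver obtained by adjoining an arrow of degree `-(n + 1)` with differential `z`. -/
noncomputable def adjoin (a b : Q.V) (n : ℤ) (z : pt K a ⟶ pt K b) (hz : z ∈ gr K _ _ (-n))
    (dz : dLin Q.δ _ _ z = 0) : DGQuiver K where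
  V := Q.AdjoinVert a b n
  δ := adjoinδ n z
  δ_mem x y e := match x, y, e with
    | _, _, .old e => oldLin_mem (Q.δ_mem e)
    | _, _, .new => by
      have h : oldLin a b n a b z ∈ gr K _ _ (-n) := oldLin_mem hz
      rwa [show -n = -(n + 1) + 1 by ring] at h
  dLin_δ x y e := match x, y, e with
    | _, _, .old e => (dLin_oldLin z _).trans ((congrArg _ (Q.dLin_δ e)).trans (map_zero _))
    | _, _, .new => (dLin_oldLin z _).trans ((congrArg _ dz).trans (map_zero _))

variable {z} {hz : z ∈ gr K _ _ (-n)} {dz : dLin Q.δ _ _ z = 0}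

/-- The inclusion dg functor. -/
noncomputable def adjoinIncl (hz : z ∈ gr K _ _ (-n)) (dz : dLin Q.δ _ _ z = 0) :
    Q.dg ⟶ (Q.adjoin a b n z hz dz).dg where
  obj x := pt (V := Q.AdjoinVert a b n) K ⟨x⟩
  map {x y} f := oldLin a b n x y f
  map_id := oldLin_id
  map_comp := oldLin_comp
  map_add {x y} f g := LinearMap.map_add (oldLin (Q := Q) a b n x y) f g
  map_smul {x y} r f := LinearMap.map_smul (oldLin (Q := Q) a b n x y) r f
  map_mem := oldLin_mem
  map_d f := (dLin_oldLin z f).symm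

/-- The adjoined arrow as a morphism of the extended dg category. -/
noncomputable def newHom (hz : z ∈ gr K _ _ (-n)) (dz : dLin Q.δ _ _ z = 0) :
    (adjoinIncl hz dz).obj (pt (V := Q.V) K a) ⟶ (adjoinIncl hz dz).obj (pt (V := Q.V) K b) :=
  ofArr (V := Q.AdjoinVert a b n) K (newArr a b n)

theorem newHom_mem : newHom hz dz ∈ (Q.adjoin a b n z hz dz).dg.gr _ _ (-(n + 1)) :=
  ofArr_mem (V := Q.AdjoinVert a b n) (newArr a b n)

theorem d_newHom : (Q.adjoin a b n z hz dz).dg.d _ _ (newHom hz dz) = (adjoinIncl hz dz).map z :=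
  dLin_ofArr (V := Q.AdjoinVert a b n) (adjoinδ n z) (newArr a b n)

section Desc

variable {C : DGCat K} (F : Q.dg ⟶ C)
  {s : F.obj (pt (V := Q.V) K a) ⟶ F.obj (pt (V := Q.V) K b)}

/-- The images of arrows under the extension of a dg functor. -/
noncomputable def adjoinDescMap (n : ℤ)
    (s : F.obj (pt (V := Q.V) K a) ⟶ F.obj (pt (V := Q.V) K b)) :
    ∀ ⦃x y : Q.AdjoinVert a b n⦄, (x ⟶ y) →
      (F.obj (pt (V := Q.V) K x.val) ⟶ F.obj (pt (V := Q.V) K y.val))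
  | _, _, .old e => F.map (ofArr (V := Q.V) K e)
  | _, _, .new => s

theorem linMap_adjoinDescMap {x y : Q.V} (f : pt K x ⟶ pt K y) :
    linMap (K := K) (fun v : Q.AdjoinVert a b n => F.obj (pt (V := Q.V) K v.val))
      (adjoinDescMap F n s) ⟨x⟩ ⟨y⟩ (oldLin a b n x y f) = F.map f := by
  refine Eq.trans ?_ (map_eq_linMap F f).symm
  refine hom_induction (P := fun f => linMap (K := K) _ (adjoinDescMap F n s) ⟨x⟩ ⟨y⟩
    (oldLin a b n x y f) = linMap (K := K) (fun v : Q.V => F.obj (pt (V := Q.V) K v))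
      (fun _ _ e => F.map (ofArr (V := Q.V) K e)) x y f) ?_ (fun f g h h' => ?_)
    (fun r f h => ?_) (fun p => ?_) f
  · simp only [map_zero]
  · simp only [map_add, h, h']
  · simp only [map_smul, h]
  · rw [oldLin_ofPath]
    refine (linMap_ofPath _ _ _).trans (Eq.trans ?_ (linMap_ofPath _ _ p).symm)
    clear f
    induction p with
    | nil => rfl
    | cons p e ih => exact congrArg (· ≫ F.map (ofArr (V := Q.V) K e)) ih

variable (s) in
/-- The extension of a dg functor to the adjoined arrow. -/
noncomputable def adjoinDesc (hz : z ∈ gr K _ _ (-n)) (dz : dLin Q.δ _ _ z = 0)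
    (hs : s ∈ C.gr _ _ (-(n + 1))) (ds : C.d _ _ s = F.map z) :
    (Q.adjoin a b n z hz dz).dg ⟶ C :=
  lift (V := Q.AdjoinVert a b n) (C := C) _ (fun v => F.obj (pt (V := Q.V) K v.val))
    (adjoinDescMap F n s) _ _
    (fun _ _ e => match e with
      | .old e => F.map_mem (ofArr_mem (V := Q.V) e)
      | .new => hs)
    (fun _ _ e => match e with
      | .old e => (linMap_adjoinDescMap F (Q.δ e)).trans
          ((congrArg F.map (dLin_ofArr Q.δ e).symm).trans (F.map_d (ofArr (V := Q.V) K e)))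
      | .new => (linMap_adjoinDescMap F z).trans ds.symm)

variable {F} (hs : s ∈ C.gr _ _ (-(n + 1))) (ds : C.d _ _ s = F.map z)

theorem adjoinIncl_adjoinDesc : adjoinIncl hz dz ≫ adjoinDesc F s hz dz hs ds = F :=
  dgFunctor_ext (fun _ => rfl) fun _ _ e =>
    heq_of_eq (linMap_adjoinDescMap F (ofArr (V := Q.V) K e))

theorem adjoinDesc_newHom : (adjoinDesc F s hz dz hs ds).map (newHom hz dz) = s :=
  linMap_ofArr _ (adjoinDescMap F n s) (newArr a b n)

theorem adjoin_hom_ext {G H : (Q.adjoin a b n z hz dz).dg ⟶ C}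
    (h : adjoinIncl hz dz ≫ G = adjoinIncl hz dz ≫ H)
    (h' : HEq (G.map (newHom hz dz)) (H.map (newHom hz dz))) : G = H := by
  refine dgFunctor_ext (V := Q.AdjoinVert a b n)
    (fun v => congrArg (fun F : Q.dg ⟶ C => F.obj (pt (V := Q.V) K v.val)) h) (fun x y e => ?_)
  match x, y, e with
  | _, _, .new => exact h'
  | _, _, .old e =>
    have key : ∀ G : (Q.adjoin a b n z hz dz).dg ⟶ C,
        (adjoinIncl hz dz ≫ G).map (ofArr (V := Q.V) K e) =
          G.map (ofArr (V := Q.AdjoinVert a b n) K (oldArr a b n e)) :=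
      fun G => congrArg G.map (oldLin_ofArr e)
    exact (heq_of_eq (key G).symm).trans ((congr_arg_heq
      (fun F : Q.dg ⟶ C => F.map (ofArr (V := Q.V) K e)) h).trans (heq_of_eq (key H)))

end Desc

end Adjoin

end DGQuiver

end Adjoin

/-! ### Adjoining a morphism is a pushout of ι_n. -/

section Attach

open GradedQuiver

variable {K : Type u} [CommRing K]

section Represent

variable {C : DGCat K} {X Y : C.Obj} {n : ℤ}

/-- The dg functor out of a sphere determined by a cocycle, on objects. -/
def sphereMkObj (X Y : C.Obj) : SphereVert.{u} n → C.Obj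
  | .one => X
  | .two => Y

/-- The dg functor out of a sphere determined by a cocycle, on arrows. -/
def sphereMkMap (n : ℤ) (z : X ⟶ Y) : ∀ ⦃a b : SphereVert.{u} n⦄, (a ⟶ b) →
    (sphereMkObj X Y a ⟶ sphereMkObj X Y b)
  | _, _, .u => z

/-- The dg functor out of a sphere determined by a cocycle. -/
noncomputable def sphereMk (z : X ⟶ Y) (hz : z ∈ C.gr X Y (-n)) (dz : C.d X Y z = 0) :
    sphere K n ⟶ C :=
  lift (C := C) _ (sphereMkObj X Y) (sphereMkMap n z) _ _
    (fun _ _ e => match e with | .u => hz)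
    (fun _ _ e => match e with | .u => (map_zero _).trans dz.symm)

theorem sphereMk_map (z : X ⟶ Y) (hz : z ∈ C.gr X Y (-n)) (dz : C.d X Y z = 0) :
    (sphereMk z hz dz).map (ofArr (V := SphereVert n) K (SphereVert.u n)) = z :=
  linMap_ofArr _ (sphereMkMap n z) (SphereVert.u n)

/-- The dg functor out of a disc determined by a homogeneous morphism, on objects. -/
def discMkObj (X Y : C.Obj) : DiscVert.{u} n → C.Obj
  | .one => X
  | .two => Y

/-- The dg functor out of a disc determined by a homogeneous morphism, on arrows. -/
def discMkMap (n : ℤ) (s : X ⟶ Y) : ∀ ⦃a b : DiscVert.{u} n⦄, (a ⟶ b) →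
    (discMkObj X Y a ⟶ discMkObj X Y b)
  | _, _, .t => s
  | _, _, .dt => C.d X Y s

/-- The dg functor out of a disc determined by a homogeneous morphism. -/
noncomputable def discMk (s : X ⟶ Y) (hs : s ∈ C.gr X Y (-n)) : disc K n ⟶ C :=
  lift (C := C) _ (discMkObj X Y) (discMkMap n s) _ _
    (fun _ _ e => match e with
      | .t => hs
      | .dt => DGCat.d_mem' hs (by change _ = 1 - n; ring))
    (fun _ _ e => match e with
      | .t => linMap_ofArr _ (discMkMap n s) (DiscVert.dt n)
      | .dt => (map_zero _).trans (DGCat.d_d (C := C) s).symm)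

theorem discMk_map_t (s : X ⟶ Y) (hs : s ∈ C.gr X Y (-n)) :
    (discMk s hs).map (ofArr (V := DiscVert n) K (DiscVert.t n)) = s :=
  linMap_ofArr _ (discMkMap n s) (DiscVert.t n)

theorem discMk_map_dt (s : X ⟶ Y) (hs : s ∈ C.gr X Y (-n)) :
    (discMk s hs).map (ofArr (V := DiscVert n) K (DiscVert.dt n)) = C.d X Y s :=
  linMap_ofArr _ (discMkMap n s) (DiscVert.dt n)

theorem disc_hom_ext {G H : disc K n ⟶ C}
    (h₁ : G.obj (pt (V := DiscVert n) K .one) = H.obj (pt (V := DiscVert n) K .one))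
    (h₂ : G.obj (pt (V := DiscVert n) K .two) = H.obj (pt (V := DiscVert n) K .two))
    (ht : HEq (G.map (ofArr (V := DiscVert n) K (DiscVert.t n)))
      (H.map (ofArr (V := DiscVert n) K (DiscVert.t n)))) : G = H := by
  refine dgFunctor_ext (V := DiscVert n) (fun v => by cases v <;> assumption) (fun a b e => ?_)
  match a, b, e with
  | _, _, .t => exact ht
  | _, _, .dt =>
    have key : ∀ G : disc K n ⟶ C, C.d _ _ (G.map (ofArr (V := DiscVert n) K (DiscVert.t n))) =
        G.map (ofArr (V := DiscVert n) K (DiscVert.dt n)) := fun G =>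
      (G.map_d _).symm.trans (congrArg G.map (dLin_ofArr (discD K n) (DiscVert.t n)))
    have aux : ∀ {X Y X' Y' : C.Obj} (s : X ⟶ Y) (s' : X' ⟶ Y'), X = X' → Y = Y' → HEq s s' →
        HEq (C.d X Y s) (C.d X' Y' s') := by
      rintro X Y _ _ s s' rfl rfl h
      rw [eq_of_heq h]
    exact (heq_of_eq (key G).symm).trans ((aux _ _ h₁ h₂ ht).trans (heq_of_eq (key H)))

/-- The disc represents homogeneous morphisms: the value on t is arbitrary, and it determines the
value on dt. -/
theorem exists_eq_discMk (G : disc K n ⟶ C) :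
    ∃ (X Y : C.Obj) (s : X ⟶ Y) (hs : s ∈ C.gr X Y (-n)), G = discMk s hs :=
  ⟨_, _, G.map (ofArr (V := DiscVert n) K (DiscVert.t n)), G.map_mem (ofArr_mem (DiscVert.t n)),
    disc_hom_ext rfl rfl (heq_of_eq (discMk_map_t _ _).symm)⟩

end Represent

namespace DGQuiver

open MorphismProperty

variable {Q : DGQuiver K} {a b : Q.V} {n : ℤ} {z : pt (V := Q.V) K a ⟶ pt (V := Q.V) K b}

/-- The sphere S(n) classifies the cocycle z, and a dg functor from D(n + 1) is a morphism s of
degree -(n + 1). Compatibility with φ along ι_n means d s = φ(z), which is exactly the datum needed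
to extend φ over the new arrow. -/
theorem isAttach_adjoinIncl (hz : z ∈ gr K _ _ (-n)) (dz : dLin Q.δ _ _ z = 0) :
    IsAttach.{u} (generatingI K) (adjoinIncl hz dz) := by
  refine ⟨PUnit, fun _ => sphere K n, fun _ => disc K (n + 1), fun _ => iota K n,
    fun _ => sphereMk (C := Q.dg) z hz dz, fun _ => discMk (newHom hz dz) newHom_mem,
    fun _ => .iota n, fun _ => ?_, fun C φ ψ h => ?_⟩
  · refine dgFunctor_ext (V := SphereVert n) (fun v => by cases v <;> rfl) (fun x y e => ?_)
    match x, y, e with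
    | _, _, .u =>
      refine heq_of_eq ?_
      refine (congrArg (adjoinIncl hz dz).map (sphereMk_map (C := Q.dg) z hz dz)).trans ?_
      refine d_newHom.symm.trans ?_
      refine (discMk_map_dt (newHom hz dz) newHom_mem).symm.trans ?_
      exact congrArg (discMk (newHom hz dz) newHom_mem).map
        (linMap_ofArr _ (iotaMap K n) (SphereVert.u n)).symm
  · replace h := h PUnit.unit
    obtain ⟨X, Y, s, hs, hψ⟩ := exists_eq_discMk (ψ PUnit.unit)
    -- The compatibility forces the ends of s to be the images of a and b; substituting them makes s
    -- an admissible image of the new arrow.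
    obtain rfl : φ.obj (pt (V := Q.V) K a) = X := by
      refine (congrArg (fun F : sphere K n ⟶ C => F.obj (pt (V := SphereVert n) K .one)) h).trans ?_
      rw [hψ]
      rfl
    obtain rfl : φ.obj (pt (V := Q.V) K b) = Y := by
      refine (congrArg (fun F : sphere K n ⟶ C => F.obj (pt (V := SphereVert n) K .two)) h).trans ?_
      rw [hψ]
      rfl
    have ds : C.d _ _ s = φ.map z := by
      have h₁ : (sphereMk (C := Q.dg) z hz dz ≫ φ).map
          (ofArr (V := SphereVert n) K (SphereVert.u n)) = φ.map z :=
        congrArg φ.map (sphereMk_map (C := Q.dg) z hz dz)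
      have h₂ : (iota K n ≫ discMk s hs).map (ofArr (V := SphereVert n) K (SphereVert.u n)) =
          C.d _ _ s :=
        (congrArg (discMk s hs).map (linMap_ofArr _ (iotaMap K n) (SphereVert.u n))).trans
          (discMk_map_dt s hs)
      rw [hψ] at h
      refine (h₂.symm.trans (eq_of_heq ?_)).trans h₁
      exact congr_arg_heq (fun F : sphere K n ⟶ C =>
        F.map (ofArr (V := SphereVert n) K (SphereVert.u n))) h.symm
    refine ⟨adjoinDesc φ s hz dz hs ds, ⟨adjoinIncl_adjoinDesc hs ds, fun _ => ?_⟩, fun y hy => ?_⟩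
    · refine Eq.trans ?_ hψ.symm
      refine disc_hom_ext rfl rfl (heq_of_eq ?_)
      refine (congrArg (adjoinDesc φ s hz dz hs ds).map (discMk_map_t (newHom hz dz) newHom_mem)).trans ?_
      exact (adjoinDesc_newHom hs ds).trans (discMk_map_t s hs).symm
    · refine adjoin_hom_ext (hy.1.trans (adjoinIncl_adjoinDesc hs ds).symm) ?_
      have h₁ := congr_arg_heq (fun F : disc K (n + 1) ⟶ C =>
        F.map (ofArr (V := DiscVert (n + 1)) K (DiscVert.t (n + 1))))
        ((hy.2 PUnit.unit).trans hψ)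
      refine HEq.trans (heq_of_eq ?_) (h₁.trans (heq_of_eq
        ((discMk_map_t s hs).trans (adjoinDesc_newHom hs ds).symm)))
      exact (congrArg y.map (discMk_map_t (newHom hz dz) newHom_mem)).symm

end DGQuiver

end Attach

/-! ### Decomposition of ρ_n into attachments. -/

section Generators

open GradedQuiver MorphismProperty

variable (K : Type u) [CommRing K]

/-- The dg functor `* ↦ *₁` from `K` to `K ∐ K`. -/
noncomputable def unitToTwo : unitDG K ⟶ twoDG K :=
  discreteLift (C := twoDG K) fun _ => pt (V := Discr Two) K ⟨.one⟩

/-- A dg functor out of a discrete dg category is just a choice of objects, so attaching ∅ → K adds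
one free object. -/
theorem isAttach_unitToTwo : IsAttach.{u} (generatingI K) (unitToTwo K) := by
  refine ⟨PUnit, fun _ => emptyDG K, fun _ => unitDG K, fun _ => emptyToUnit K,
    fun _ => discreteLift (C := unitDG K) fun x => x.elim,
    fun _ => discreteLift (C := twoDG K) fun _ => pt (V := Discr Two) K ⟨.two⟩,
    fun _ => .emptyToUnit, fun _ => discreteDG_ext fun x => x.elim, fun C φ ψ _ => ?_⟩
  refine ⟨discreteLift (C := C) fun
    | .one => φ.obj (pt (V := Discr PUnit) K ⟨PUnit.unit⟩)
    | .two => (ψ PUnit.unit).obj (pt (V := Discr PUnit) K ⟨PUnit.unit⟩),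
    ⟨discreteDG_ext fun _ => rfl, fun _ => discreteDG_ext fun _ => rfl⟩, fun y hy => ?_⟩
  refine discreteDG_ext fun v => ?_
  let ev (F : unitDG K ⟶ C) : C.Obj := F.obj (pt (V := Discr PUnit) K ⟨PUnit.unit⟩)
  cases v with
  | one => exact congrArg ev hy.1
  | two => exact congrArg ev (hy.2 PUnit.unit)

namespace DGQuiver

/-- The dg quiver with two vertices and no arrows. -/
noncomputable def two : DGQuiver K where
  V := Discr Two
  δ _ _ e := PEmpty.elim e
  δ_mem _ _ e := PEmpty.elim e
  dLin_δ _ _ e := PEmpty.elim e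

/-- The first vertex. -/
def twoFst : (two K).V := Discr.star Two.one

/-- The second vertex. -/
def twoSnd : (two K).V := Discr.star Two.two

section Disc

variable (n : ℤ)

/-- The dg quiver with two vertices and one closed arrow of degree `1 - n` between them. -/
noncomputable def discSkeleton : DGQuiver K :=
  -- Adjoining with parameter m creates an arrow of degree -(m + 1): the value m = n - 2 gives |dt|
  -- = 1 - n, and m = n - 1 below gives |t| = -n.
  (two K).adjoin (twoFst K) (twoSnd K) (n - 2) 0 (zero_mem _) (map_zero _)

/-- The first vertex of `discSkeleton`. -/
def skelFst : (discSkeleton K n).V := AdjoinVert.mk (Q := two K) (twoFst K)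

/-- The second vertex of `discSkeleton`. -/
def skelSnd : (discSkeleton K n).V := AdjoinVert.mk (Q := two K) (twoSnd K)

/-- The closed arrow of `discSkeleton`. -/
noncomputable def skelArr : skelFst K n ⟶ skelSnd K n :=
  newArr (Q := two K) (twoFst K) (twoSnd K) (n - 2)

theorem ofArr_skelArr_mem :
    ofArr (V := (discSkeleton K n).V) K (skelArr K n) ∈ gr K _ _ (-(n - 1)) := by
  have h : ofArr (V := (discSkeleton K n).V) K (skelArr K n) ∈ gr K _ _ (-(n - 2 + 1)) :=
    ofArr_mem (V := (discSkeleton K n).V) (skelArr K n)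
  rwa [show -(n - 2 + 1) = -(n - 1) by ring] at h

theorem dLin_ofArr_skelArr :
    dLin (discSkeleton K n).δ _ _ (ofArr (V := (discSkeleton K n).V) K (skelArr K n)) = 0 :=
  (dLin_ofArr (V := (discSkeleton K n).V) (discSkeleton K n).δ (skelArr K n)).trans (map_zero _)

/-- The dg quiver of the disc, built by adjoining `dt` and then `t`. -/
noncomputable def discBuilt : DGQuiver K :=
  (discSkeleton K n).adjoin (skelFst K n) (skelSnd K n) (n - 1) _ (ofArr_skelArr_mem K n)
    (dLin_ofArr_skelArr K n)

/-- The inclusion of the vertices into `discSkeleton`. -/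
noncomputable def twoToSkeleton : twoDG K ⟶ (discSkeleton K n).dg :=
  adjoinIncl (Q := two K) (zero_mem _) (map_zero _)

/-- The inclusion of `discSkeleton` into `discBuilt`. -/
noncomputable def skeletonToBuilt : (discSkeleton K n).dg ⟶ (discBuilt K n).dg :=
  adjoinIncl (ofArr_skelArr_mem K n) (dLin_ofArr_skelArr K n)

/-- The morphism `dt` between the images of the vertices under `ρ_n`. -/
noncomputable def rhoDt : (rho K n).obj (pt (V := (two K).V) K (twoFst K)) ⟶
    (rho K n).obj (pt (V := (two K).V) K (twoSnd K)) :=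
  ofArr (V := DiscVert n) K (DiscVert.dt n)

theorem rhoDt_mem : rhoDt K n ∈ (disc K n).gr _ _ (-(n - 2 + 1)) := by
  have h : ofArr (V := DiscVert n) K (DiscVert.dt n) ∈ gr K _ _ (1 - n) :=
    ofArr_mem (V := DiscVert n) (DiscVert.dt n)
  rw [show 1 - n = -(n - 2 + 1) by ring] at h
  exact h

theorem d_rhoDt : (disc K n).d _ _ (rhoDt K n) = 0 :=
  dLin_ofArr (discD K n) (DiscVert.dt n)

/-- The dg functor from `discSkeleton` to the disc. -/
noncomputable def skeletonToDisc : (discSkeleton K n).dg ⟶ disc K n :=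
  adjoinDesc (Q := two K) (C := disc K n) (rho K n) (rhoDt K n) _ _ (rhoDt_mem K n)
    ((d_rhoDt K n).trans (DGFunctor.map_zero (rho K n) _ _).symm)

/-- The morphism `t` between the images of the vertices under `ρ_n`. -/
noncomputable def skelT : (skeletonToDisc K n).obj (pt (V := (discSkeleton K n).V) K (skelFst K n)) ⟶
    (skeletonToDisc K n).obj (pt (V := (discSkeleton K n).V) K (skelSnd K n)) :=
  ofArr (V := DiscVert n) K (DiscVert.t n)

theorem skelT_mem : skelT K n ∈ (disc K n).gr _ _ (-(n - 1 + 1)) := by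
  have h : ofArr (V := DiscVert n) K (DiscVert.t n) ∈ gr K _ _ (-n) :=
    ofArr_mem (V := DiscVert n) (DiscVert.t n)
  rw [show -n = -(n - 1 + 1) by ring] at h
  exact h

theorem skeletonToDisc_map : (skeletonToDisc K n).map (ofArr (V := (discSkeleton K n).V) K
    (skelArr K n)) = rhoDt K n :=
  adjoinDesc_newHom (Q := two K) _ _

theorem d_skelT : (disc K n).d _ _ (skelT K n) = (skeletonToDisc K n).map
    (ofArr (V := (discSkeleton K n).V) K (skelArr K n)) :=
  (dLin_ofArr (discD K n) (DiscVert.t n)).trans (skeletonToDisc_map K n).symm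

/-- The dg functor from `discBuilt` to the disc. -/
noncomputable def builtToDisc : (discBuilt K n).dg ⟶ disc K n :=
  adjoinDesc (skeletonToDisc K n) (skelT K n) _ _ (skelT_mem K n) (d_skelT K n)

theorem discBuilt_newHom_mem : newHom (ofArr_skelArr_mem K n) (dLin_ofArr_skelArr K n) ∈
    (discBuilt K n).dg.gr _ _ (-n) := by
  have h := newHom_mem (hz := ofArr_skelArr_mem K n) (dz := dLin_ofArr_skelArr K n)
  rwa [show -(n - 1 + 1) = -n by ring] at h

/-- The dg functor from the disc to `discBuilt`. -/
noncomputable def discToBuilt : disc K n ⟶ (discBuilt K n).dg :=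
  discMk (C := (discBuilt K n).dg) (newHom (ofArr_skelArr_mem K n) (dLin_ofArr_skelArr K n))
    (discBuilt_newHom_mem K n)

theorem skeletonToBuilt_builtToDisc : skeletonToBuilt K n ≫ builtToDisc K n = skeletonToDisc K n :=
  adjoinIncl_adjoinDesc _ _

theorem twoToSkeleton_skeletonToDisc : twoToSkeleton K n ≫ skeletonToDisc K n = rho K n :=
  adjoinIncl_adjoinDesc (Q := two K) _ _

theorem discToBuilt_builtToDisc : discToBuilt K n ≫ builtToDisc K n = 𝟙 _ :=
  disc_hom_ext rfl rfl (heq_of_eq ((congrArg (builtToDisc K n).map (discMk_map_t _ _)).trans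
    (adjoinDesc_newHom _ _)))

theorem builtToDisc_discToBuilt : builtToDisc K n ≫ discToBuilt K n = 𝟙 _ := by
  have h : skeletonToDisc K n ≫ discToBuilt K n = skeletonToBuilt K n := by
    refine adjoin_hom_ext (Q := two K) ?_ (heq_of_eq ?_)
    · change twoToSkeleton K n ≫ skeletonToDisc K n ≫ discToBuilt K n =
        twoToSkeleton K n ≫ skeletonToBuilt K n
      rw [← Category.assoc, twoToSkeleton_skeletonToDisc]
      exact discreteDG_ext fun v => by cases v <;> rfl
    · refine (congrArg (discToBuilt K n).map (skeletonToDisc_map K n)).trans ?_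
      exact (discMk_map_dt _ _).trans d_newHom
  refine adjoin_hom_ext ?_ (heq_of_eq ?_)
  · change skeletonToBuilt K n ≫ builtToDisc K n ≫ discToBuilt K n = skeletonToBuilt K n ≫ 𝟙 _
    rw [← Category.assoc, skeletonToBuilt_builtToDisc, h, Category.comp_id]
  · exact (congrArg (discToBuilt K n).map (adjoinDesc_newHom _ _)).trans (discMk_map_t _ _)

theorem isIso_builtToDisc : IsIso (builtToDisc K n) :=
  ⟨discToBuilt K n, builtToDisc_discToBuilt K n, discToBuilt_builtToDisc K n⟩

/-- The four factors are the attachments of dt and t, an identity as padding, and the isomorphism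
with the disc. -/
theorem twoStep_rho : twoStep (twoStep (IsAttach.{u} (generatingI K))) (rho K n) := by
  have := isIso_builtToDisc K n
  refine ⟨_, twoToSkeleton K n ≫ skeletonToBuilt K n, builtToDisc K n,
    ⟨_, _, _, isAttach_adjoinIncl (Q := two K) _ _, isAttach_adjoinIncl _ _, rfl⟩,
    ⟨_, 𝟙 _, _, isAttach_of_isIso _ _, isAttach_of_isIso _ _, Category.id_comp _⟩, ?_⟩
  rw [Category.assoc, skeletonToBuilt_builtToDisc, twoToSkeleton_skeletonToDisc]

end Disc

end DGQuiver

end Generators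

/-! ### Construction of 𝒦 one generator at a time. -/

section Generators

open GradedQuiver MorphismProperty

variable (K : Type u) [CommRing K]

namespace DGQuiver

/-- The generators `f`. -/
noncomputable def quivF : DGQuiver K :=
  -- Degree -(m + 1) equals 0 for m = -1. The same parameter serves for g; then m = 0 for h₁ and h₂,
  -- and m = 1 for r.
  (two K).adjoin (twoFst K) (twoSnd K) (-1) 0 (zero_mem _) (map_zero _)

namespace quivF

/-- The first vertex. -/
noncomputable def fst : (quivF K).V := AdjoinVert.mk (Q := two K) (twoFst K)

/-- The second vertex. -/
noncomputable def snd : (quivF K).V := AdjoinVert.mk (Q := two K) (twoSnd K)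

/-- The arrow `f`. -/
noncomputable def f : fst K ⟶ snd K := newArr (Q := two K) (twoFst K) (twoSnd K) (-1)

theorem δ_f : (quivF K).δ (f K) = 0 := map_zero _

end quivF

/-- The generators `f` and `g`. -/
noncomputable def quivFG : DGQuiver K :=
  (quivF K).adjoin (quivF.snd K) (quivF.fst K) (-1) 0 (zero_mem _) (map_zero _)

namespace quivFG

/-- The first vertex. -/
noncomputable def fst : (quivFG K).V := AdjoinVert.mk (Q := quivF K) (quivF.fst K)

/-- The second vertex. -/
noncomputable def snd : (quivFG K).V := AdjoinVert.mk (Q := quivF K) (quivF.snd K)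

/-- The arrow `f`. -/
noncomputable def f : fst K ⟶ snd K := oldArr (Q := quivF K) _ _ _ (quivF.f K)

/-- The arrow `g`. -/
noncomputable def g : snd K ⟶ fst K := newArr (Q := quivF K) _ _ _

theorem δ_f : (quivFG K).δ (f K) = 0 :=
  (congrArg (oldLin (Q := quivF K) _ _ _ _ _) (quivF.δ_f K)).trans (map_zero _)

theorem δ_g : (quivFG K).δ (g K) = 0 := map_zero _

/-- The differential of `h₁`. -/
noncomputable def dh₁ : pt (V := (quivFG K).V) K (fst K) ⟶ pt (V := (quivFG K).V) K (fst K) :=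
  ofArr (V := (quivFG K).V) K (f K) ≫ ofArr (V := (quivFG K).V) K (g K) - 𝟙 _

theorem dh₁_mem : dh₁ K ∈ gr (V := (quivFG K).V) K _ _ (-0) :=
  sub_mem (comp_mem_gr' (ofArr_mem (V := (quivFG K).V) (f K))
    (ofArr_mem (V := (quivFG K).V) (g K)) rfl)
    (ofPath_mem (Quiver.Path.nil : Quiver.Path (V := (quivFG K).V) _ _))

end quivFG

/-- The generators `f`, `g` and `h₁`. -/
noncomputable def quivFGH : DGQuiver K :=
  (quivFG K).adjoin (quivFG.fst K) (quivFG.fst K) 0 (quivFG.dh₁ K) (quivFG.dh₁_mem K)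
    (dLin_comp_sub_id _ (quivFG.f K) (quivFG.g K) (quivFG.δ_f K) (quivFG.δ_g K))

namespace quivFGH

/-- The first vertex. -/
noncomputable def fst : (quivFGH K).V := AdjoinVert.mk (Q := quivFG K) (quivFG.fst K)

/-- The second vertex. -/
noncomputable def snd : (quivFGH K).V := AdjoinVert.mk (Q := quivFG K) (quivFG.snd K)

/-- The arrow `f`. -/
noncomputable def f : fst K ⟶ snd K := oldArr (Q := quivFG K) _ _ _ (quivFG.f K)

/-- The arrow `g`. -/
noncomputable def g : snd K ⟶ fst K := oldArr (Q := quivFG K) _ _ _ (quivFG.g K)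

/-- The arrow `h₁`. -/
noncomputable def h₁ : fst K ⟶ fst K := newArr (Q := quivFG K) _ _ _

theorem δ_f : (quivFGH K).δ (f K) = 0 :=
  (congrArg (oldLin (Q := quivFG K) _ _ _ _ _) (quivFG.δ_f K)).trans (map_zero _)

theorem δ_g : (quivFGH K).δ (g K) = 0 :=
  (congrArg (oldLin (Q := quivFG K) _ _ _ _ _) (quivFG.δ_g K)).trans (map_zero _)

theorem δ_h₁ : (quivFGH K).δ (h₁ K) =
    ofArr (V := (quivFGH K).V) K (f K) ≫ ofArr (V := (quivFGH K).V) K (g K) - 𝟙 _ := by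
  refine (map_sub (oldLin (Q := quivFG K) _ _ _ _ _) _ _).trans (congrArg₂ _ ?_ (oldLin_id _))
  exact (oldLin_comp _ _).trans (congrArg₂ _ (oldLin_ofArr _) (oldLin_ofArr _))

/-- The differential of `h₂`. -/
noncomputable def dh₂ : pt (V := (quivFGH K).V) K (snd K) ⟶ pt (V := (quivFGH K).V) K (snd K) :=
  ofArr (V := (quivFGH K).V) K (g K) ≫ ofArr (V := (quivFGH K).V) K (f K) - 𝟙 _

theorem dh₂_mem : dh₂ K ∈ gr (V := (quivFGH K).V) K _ _ (-0) :=
  sub_mem (comp_mem_gr' (ofArr_mem (V := (quivFGH K).V) (g K))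
    (ofArr_mem (V := (quivFGH K).V) (f K)) rfl)
    (ofPath_mem (Quiver.Path.nil : Quiver.Path (V := (quivFGH K).V) _ _))

end quivFGH

/-- The generators `f`, `g`, `h₁` and `h₂`. -/
noncomputable def quivFGHH : DGQuiver K :=
  (quivFGH K).adjoin (quivFGH.snd K) (quivFGH.snd K) 0 (quivFGH.dh₂ K) (quivFGH.dh₂_mem K)
    (dLin_comp_sub_id _ (quivFGH.g K) (quivFGH.f K) (quivFGH.δ_g K) (quivFGH.δ_f K))

namespace quivFGHH

/-- The first vertex. -/
noncomputable def fst : (quivFGHH K).V := AdjoinVert.mk (Q := quivFGH K) (quivFGH.fst K)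

/-- The second vertex. -/
noncomputable def snd : (quivFGHH K).V := AdjoinVert.mk (Q := quivFGH K) (quivFGH.snd K)

/-- The arrow `f`. -/
noncomputable def f : fst K ⟶ snd K := oldArr (Q := quivFGH K) _ _ _ (quivFGH.f K)

/-- The arrow `g`. -/
noncomputable def g : snd K ⟶ fst K := oldArr (Q := quivFGH K) _ _ _ (quivFGH.g K)

/-- The arrow `h₁`. -/
noncomputable def h₁ : fst K ⟶ fst K := oldArr (Q := quivFGH K) _ _ _ (quivFGH.h₁ K)

/-- The arrow `h₂`. -/
noncomputable def h₂ : snd K ⟶ snd K := newArr (Q := quivFGH K) _ _ _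

theorem δ_f : (quivFGHH K).δ (f K) = 0 :=
  (congrArg (oldLin (Q := quivFGH K) _ _ _ _ _) (quivFGH.δ_f K)).trans (map_zero _)

theorem δ_g : (quivFGHH K).δ (g K) = 0 :=
  (congrArg (oldLin (Q := quivFGH K) _ _ _ _ _) (quivFGH.δ_g K)).trans (map_zero _)

theorem δ_h₁ : (quivFGHH K).δ (h₁ K) =
    ofArr (V := (quivFGHH K).V) K (f K) ≫ ofArr (V := (quivFGHH K).V) K (g K) - 𝟙 _ := by
  refine (congrArg (oldLin (Q := quivFGH K) _ _ _ _ _) (quivFGH.δ_h₁ K)).trans ?_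
  refine (map_sub (oldLin (Q := quivFGH K) _ _ _ _ _) _ _).trans (congrArg₂ _ ?_ (oldLin_id _))
  exact (oldLin_comp _ _).trans (congrArg₂ _ (oldLin_ofArr _) (oldLin_ofArr _))

theorem δ_h₂ : (quivFGHH K).δ (h₂ K) =
    ofArr (V := (quivFGHH K).V) K (g K) ≫ ofArr (V := (quivFGHH K).V) K (f K) - 𝟙 _ := by
  refine (map_sub (oldLin (Q := quivFGH K) _ _ _ _ _) _ _).trans (congrArg₂ _ ?_ (oldLin_id _))
  exact (oldLin_comp _ _).trans (congrArg₂ _ (oldLin_ofArr _) (oldLin_ofArr _))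

/-- The differential of `r`. -/
noncomputable def dr : pt (V := (quivFGHH K).V) K (fst K) ⟶ pt (V := (quivFGHH K).V) K (snd K) :=
  ofArr (V := (quivFGHH K).V) K (f K) ≫ ofArr (V := (quivFGHH K).V) K (h₂ K) -
    ofArr (V := (quivFGHH K).V) K (h₁ K) ≫ ofArr (V := (quivFGHH K).V) K (f K)

theorem dr_mem : dr K ∈ gr (V := (quivFGHH K).V) K _ _ (-1) :=
  sub_mem (comp_mem_gr' (ofArr_mem (V := (quivFGHH K).V) (f K))
    (ofArr_mem (V := (quivFGHH K).V) (h₂ K)) rfl)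
    (comp_mem_gr' (ofArr_mem (V := (quivFGHH K).V) (h₁ K))
      (ofArr_mem (V := (quivFGHH K).V) (f K)) rfl)

/-- Since f is closed of degree 0, the two differentials are f (g f - 1) and (f g - 1) f, which
coincide. -/
theorem dLin_dr : dLin (quivFGHH K).δ _ _ (dr K) = 0 :=
  dLin_comp_sub_comp _ (f K) (g K) (h₁ K) (h₂ K) (δ_f K) rfl (δ_h₁ K) (δ_h₂ K)

end quivFGHH

/-- The generators `f`, `g`, `h₁`, `h₂` and `r`. -/
noncomputable def quivK : DGQuiver K :=
  (quivFGHH K).adjoin (quivFGHH.fst K) (quivFGHH.snd K) 1 (quivFGHH.dr K) (quivFGHH.dr_mem K)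
    (quivFGHH.dLin_dr K)

namespace quivK

/-- The first vertex. -/
noncomputable def fst : (quivK K).V := AdjoinVert.mk (Q := quivFGHH K) (quivFGHH.fst K)

/-- The second vertex. -/
noncomputable def snd : (quivK K).V := AdjoinVert.mk (Q := quivFGHH K) (quivFGHH.snd K)

/-- The arrow `f`. -/
noncomputable def f : fst K ⟶ snd K := oldArr (Q := quivFGHH K) _ _ _ (quivFGHH.f K)

/-- The arrow `g`. -/
noncomputable def g : snd K ⟶ fst K := oldArr (Q := quivFGHH K) _ _ _ (quivFGHH.g K)

/-- The arrow `h₁`. -/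
noncomputable def h₁ : fst K ⟶ fst K := oldArr (Q := quivFGHH K) _ _ _ (quivFGHH.h₁ K)

/-- The arrow `h₂`. -/
noncomputable def h₂ : snd K ⟶ snd K := oldArr (Q := quivFGHH K) _ _ _ (quivFGHH.h₂ K)

/-- The arrow `r`. -/
noncomputable def r : fst K ⟶ snd K := newArr (Q := quivFGHH K) _ _ _

theorem δ_f : (quivK K).δ (f K) = 0 :=
  (congrArg (oldLin (Q := quivFGHH K) _ _ _ _ _) (quivFGHH.δ_f K)).trans (map_zero _)

theorem δ_g : (quivK K).δ (g K) = 0 :=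
  (congrArg (oldLin (Q := quivFGHH K) _ _ _ _ _) (quivFGHH.δ_g K)).trans (map_zero _)

theorem δ_h₁ : (quivK K).δ (h₁ K) =
    ofArr (V := (quivK K).V) K (f K) ≫ ofArr (V := (quivK K).V) K (g K) - 𝟙 _ := by
  refine (congrArg (oldLin (Q := quivFGHH K) _ _ _ _ _) (quivFGHH.δ_h₁ K)).trans ?_
  refine (map_sub (oldLin (Q := quivFGHH K) _ _ _ _ _) _ _).trans (congrArg₂ _ ?_ (oldLin_id _))
  exact (oldLin_comp _ _).trans (congrArg₂ _ (oldLin_ofArr _) (oldLin_ofArr _))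

theorem δ_h₂ : (quivK K).δ (h₂ K) =
    ofArr (V := (quivK K).V) K (g K) ≫ ofArr (V := (quivK K).V) K (f K) - 𝟙 _ := by
  refine (congrArg (oldLin (Q := quivFGHH K) _ _ _ _ _) (quivFGHH.δ_h₂ K)).trans ?_
  refine (map_sub (oldLin (Q := quivFGHH K) _ _ _ _ _) _ _).trans (congrArg₂ _ ?_ (oldLin_id _))
  exact (oldLin_comp _ _).trans (congrArg₂ _ (oldLin_ofArr _) (oldLin_ofArr _))

theorem δ_r : (quivK K).δ (r K) =
    ofArr (V := (quivK K).V) K (f K) ≫ ofArr (V := (quivK K).V) K (h₂ K) -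
      ofArr (V := (quivK K).V) K (h₁ K) ≫ ofArr (V := (quivK K).V) K (f K) := by
  refine (map_sub (oldLin (Q := quivFGHH K) _ _ _ _ _) _ _).trans (congrArg₂ _ ?_ ?_)
  · exact (oldLin_comp _ _).trans (congrArg₂ _ (oldLin_ofArr _) (oldLin_ofArr _))
  · exact (oldLin_comp _ _).trans (congrArg₂ _ (oldLin_ofArr _) (oldLin_ofArr _))

end quivK

/-- The dg functor from `𝒦` to its construction by attaching arrows, on objects. -/
noncomputable def kToBuiltObj : KVert.{u} → (quivK K).dg.Obj
  | .one => pt (V := (quivK K).V) K (quivK.fst K)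
  | .two => pt (V := (quivK K).V) K (quivK.snd K)

/-- The dg functor from `𝒦` to its construction by attaching arrows, on arrows. -/
noncomputable def kToBuiltMap :
    ∀ ⦃a b : KVert.{u}⦄, (a ⟶ b) → (kToBuiltObj K a ⟶ kToBuiltObj K b)
  | _, _, .f => ofArr (V := (quivK K).V) K (quivK.f K)
  | _, _, .g => ofArr (V := (quivK K).V) K (quivK.g K)
  | _, _, .h₁ => ofArr (V := (quivK K).V) K (quivK.h₁ K)
  | _, _, .h₂ => ofArr (V := (quivK K).V) K (quivK.h₂ K)
  | _, _, .r => ofArr (V := (quivK K).V) K (quivK.r K)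

theorem kToBuiltMap_mem ⦃a b : KVert.{u}⦄ (e : a ⟶ b) :
    kToBuiltMap K e ∈ (quivK K).dg.gr (kToBuiltObj K a) (kToBuiltObj K b) (deg e) :=
  match a, b, e with
  | _, _, .f => ofArr_mem (V := (quivK K).V) (quivK.f K)
  | _, _, .g => ofArr_mem (V := (quivK K).V) (quivK.g K)
  | _, _, .h₁ => ofArr_mem (V := (quivK K).V) (quivK.h₁ K)
  | _, _, .h₂ => ofArr_mem (V := (quivK K).V) (quivK.h₂ K)
  | _, _, .r => ofArr_mem (V := (quivK K).V) (quivK.r K)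

theorem linMap_kToBuilt_comp {a b c : KVert.{u}} (p : a ⟶ b) (q : b ⟶ c) :
    linMap (K := K) (kToBuiltObj K) (kToBuiltMap K) a c (ofArr K p ≫ ofArr K q) =
      kToBuiltMap K p ≫ kToBuiltMap K q :=
  (linMap_comp _ _ _ _).trans (congrArg₂ _ (linMap_ofArr _ _ p) (linMap_ofArr _ _ q))

theorem linMap_kToBuilt ⦃a b : KVert.{u}⦄ (e : a ⟶ b) :
    linMap (K := K) (kToBuiltObj K) (kToBuiltMap K) a b (kD K e) =
      (quivK K).dg.d _ _ (kToBuiltMap K e) := by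
  have key : ∀ {x y : (quivK K).V} (e : x ⟶ y), (quivK K).δ e =
      (quivK K).dg.d _ _ (ofArr (V := (quivK K).V) K e) :=
    fun e => (dLin_ofArr (V := (quivK K).V) _ e).symm
  match a, b, e with
  | _, _, .f => exact (map_zero _).trans ((quivK.δ_f K).symm.trans (key _))
  | _, _, .g => exact (map_zero _).trans ((quivK.δ_g K).symm.trans (key _))
  | _, _, .h₁ =>
    refine (map_sub _ _ _).trans (Eq.trans ?_ ((quivK.δ_h₁ K).symm.trans (key _)))
    exact congrArg₂ _ (linMap_kToBuilt_comp K KVert.f KVert.g) (linMap_id _ _ _)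
  | _, _, .h₂ =>
    refine (map_sub _ _ _).trans (Eq.trans ?_ ((quivK.δ_h₂ K).symm.trans (key _)))
    exact congrArg₂ _ (linMap_kToBuilt_comp K KVert.g KVert.f) (linMap_id _ _ _)
  | _, _, .r =>
    refine (map_sub _ _ _).trans (Eq.trans ?_ ((quivK.δ_r K).symm.trans (key _)))
    exact congrArg₂ _ (linMap_kToBuilt_comp K KVert.f KVert.h₂)
      (linMap_kToBuilt_comp K KVert.h₁ KVert.f)

/-- The dg functor from `𝒦` to its construction by attaching arrows. -/
noncomputable def kToBuilt : kDG K ⟶ (quivK K).dg :=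
  lift (C := (quivK K).dg) _ (kToBuiltObj K) (kToBuiltMap K) _ _ (kToBuiltMap_mem K)
    (linMap_kToBuilt K)

end DGQuiver

end Generators

/-! ### Comparison with 𝒦, decomposition of σ, and the conclusion. -/

section Generators

open GradedQuiver MorphismProperty

variable (K : Type u) [CommRing K]

namespace DGQuiver

/-- The dg functor to `𝒦` from its construction by attaching arrows, on objects. -/
noncomputable def builtToKObj : (quivK K).V → (kDG K).Obj
  | ⟨⟨⟨⟨⟨⟨.one⟩⟩⟩⟩⟩⟩ => pt (V := KVert) K .one
  | ⟨⟨⟨⟨⟨⟨.two⟩⟩⟩⟩⟩⟩ => pt (V := KVert) K .two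

/-- The dg functor to `𝒦` from its construction by attaching arrows, on arrows. -/
noncomputable def builtToKMap :
    ∀ ⦃a b : (quivK K).V⦄, (a ⟶ b) → (builtToKObj K a ⟶ builtToKObj K b)
  | _, _, .new => ofArr (V := KVert) K KVert.r
  | _, _, .old .new => ofArr (V := KVert) K KVert.h₂
  | _, _, .old (.old .new) => ofArr (V := KVert) K KVert.h₁
  | _, _, .old (.old (.old .new)) => ofArr (V := KVert) K KVert.g
  | _, _, .old (.old (.old (.old .new))) => ofArr (V := KVert) K KVert.f
  | _, _, .old (.old (.old (.old (.old e)))) => PEmpty.elim e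

/-- The match on nested constructors is carried out once, for a predicate with variable ends; the
innermost quiver has no arrows and contributes nothing. -/
theorem quivK_arrow_cases {P : ∀ ⦃a b : (quivK K).V⦄, (a ⟶ b) → Prop} (hf : P (quivK.f K))
    (hg : P (quivK.g K)) (h₁ : P (quivK.h₁ K)) (h₂ : P (quivK.h₂ K)) (hr : P (quivK.r K)) :
    ∀ ⦃a b : (quivK K).V⦄ (e : a ⟶ b), P e
  | _, _, .new => hr
  | _, _, .old .new => h₂
  | _, _, .old (.old .new) => h₁
  | _, _, .old (.old (.old .new)) => hg
  | _, _, .old (.old (.old (.old .new))) => hf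
  | _, _, .old (.old (.old (.old (.old e)))) => PEmpty.elim e

theorem builtToKMap_mem ⦃a b : (quivK K).V⦄ (e : a ⟶ b) :
    builtToKMap K e ∈ (kDG K).gr (builtToKObj K a) (builtToKObj K b) (deg e) :=
  quivK_arrow_cases K
    (P := fun a b e => builtToKMap K e ∈ (kDG K).gr (builtToKObj K a) (builtToKObj K b) (deg e))
    (ofArr_mem KVert.f) (ofArr_mem KVert.g) (ofArr_mem KVert.h₁) (ofArr_mem KVert.h₂)
    (ofArr_mem KVert.r) e

theorem linMap_builtToK_comp {a b c : (quivK K).V} (p : a ⟶ b) (q : b ⟶ c) :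
    linMap (K := K) (V := (quivK K).V) (builtToKObj K) (builtToKMap K) a c
      (ofArr (V := (quivK K).V) K p ≫ ofArr (V := (quivK K).V) K q) =
      builtToKMap K p ≫ builtToKMap K q :=
  (linMap_comp _ _ _ _).trans (congrArg₂ _ (linMap_ofArr _ _ p) (linMap_ofArr _ _ q))

theorem linMap_builtToK ⦃a b : (quivK K).V⦄ (e : a ⟶ b) :
    linMap (K := K) (V := (quivK K).V) (builtToKObj K) (builtToKMap K) a b ((quivK K).δ e) =
      (kDG K).d _ _ (builtToKMap K e) := by
  have key : ∀ {x y : KVert.{u}} (e : x ⟶ y), kD K e = (kDG K).d _ _ (ofArr (V := KVert) K e) :=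
    fun e => (dLin_ofArr (V := KVert) _ e).symm
  refine quivK_arrow_cases K (P := fun a b e =>
    linMap (K := K) (V := (quivK K).V) (builtToKObj K) (builtToKMap K) a b ((quivK K).δ e) =
      (kDG K).d _ _ (builtToKMap K e)) ?_ ?_ ?_ ?_ ?_ e
  · exact (congrArg _ (quivK.δ_f K)).trans ((map_zero _).trans (key KVert.f))
  · exact (congrArg _ (quivK.δ_g K)).trans ((map_zero _).trans (key KVert.g))
  · refine (congrArg _ (quivK.δ_h₁ K)).trans ((map_sub _ _ _).trans (Eq.trans ?_ (key KVert.h₁)))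
    exact congrArg₂ _ (linMap_builtToK_comp K _ _) (linMap_id _ _ _)
  · refine (congrArg _ (quivK.δ_h₂ K)).trans ((map_sub _ _ _).trans (Eq.trans ?_ (key KVert.h₂)))
    exact congrArg₂ _ (linMap_builtToK_comp K _ _) (linMap_id _ _ _)
  · refine (congrArg _ (quivK.δ_r K)).trans ((map_sub _ _ _).trans (Eq.trans ?_ (key KVert.r)))
    exact congrArg₂ _ (linMap_builtToK_comp K _ _) (linMap_builtToK_comp K _ _)

/-- The dg functor to `𝒦` from its construction by attaching arrows. -/
noncomputable def builtToK : (quivK K).dg ⟶ kDG K :=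
  lift (V := (quivK K).V) (C := kDG K) _ (builtToKObj K) (builtToKMap K) _ _ (builtToKMap_mem K)
    (linMap_builtToK K)

theorem kToBuilt_map {a b : KVert.{u}} (e : a ⟶ b) :
    (kToBuilt K).map (ofArr (V := KVert) K e) = kToBuiltMap K e :=
  linMap_ofArr _ (kToBuiltMap K) e

theorem builtToK_map {a b : (quivK K).V} (e : a ⟶ b) :
    (builtToK K).map (ofArr (V := (quivK K).V) K e) = builtToKMap K e :=
  linMap_ofArr _ (builtToKMap K) e

theorem kToBuilt_builtToK : kToBuilt K ≫ builtToK K = 𝟙 _ := by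
  refine dgFunctor_ext (V := KVert) (fun v => by cases v <;> rfl) (fun a b e => ?_)
  refine HEq.trans (heq_of_eq (congrArg (builtToK K).map (kToBuilt_map K e))) ?_
  match a, b, e with
  | _, _, .f => exact heq_of_eq (builtToK_map K (quivK.f K))
  | _, _, .g => exact heq_of_eq (builtToK_map K (quivK.g K))
  | _, _, .h₁ => exact heq_of_eq (builtToK_map K (quivK.h₁ K))
  | _, _, .h₂ => exact heq_of_eq (builtToK_map K (quivK.h₂ K))
  | _, _, .r => exact heq_of_eq (builtToK_map K (quivK.r K))

theorem builtToK_kToBuilt : builtToK K ≫ kToBuilt K = 𝟙 _ := by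
  refine dgFunctor_ext (V := (quivK K).V) (fun v => ?_) (fun a b e => ?_)
  · match v with
    | ⟨⟨⟨⟨⟨⟨.one⟩⟩⟩⟩⟩⟩ => rfl
    | ⟨⟨⟨⟨⟨⟨.two⟩⟩⟩⟩⟩⟩ => rfl
  refine HEq.trans (heq_of_eq (congrArg (kToBuilt K).map (builtToK_map K e))) ?_
  refine quivK_arrow_cases K (P := fun a b e => HEq ((kToBuilt K).map (builtToKMap K e))
    (ofArr (V := (quivK K).V) K e)) ?_ ?_ ?_ ?_ ?_ e
  · exact heq_of_eq (kToBuilt_map K KVert.f)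
  · exact heq_of_eq (kToBuilt_map K KVert.g)
  · exact heq_of_eq (kToBuilt_map K KVert.h₁)
  · exact heq_of_eq (kToBuilt_map K KVert.h₂)
  · exact heq_of_eq (kToBuilt_map K KVert.r)

theorem isIso_builtToK : IsIso (builtToK K) :=
  ⟨kToBuilt K, builtToK_kToBuilt K, kToBuilt_builtToK K⟩

/-- There are eight factors: the second object, f, g, h₁, h₂, r, an identity as padding, and the
isomorphism with 𝒦. Their composite is σ because a dg functor out of K is determined by one object.
-/
theorem twoStep_sigma :
    twoStep (twoStep (twoStep (IsAttach.{u} (generatingI K)))) (sigma K) := by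
  have := isIso_builtToK K
  have aF := isAttach_adjoinIncl (Q := two K) (a := twoFst K) (b := twoSnd K) (n := -1)
    (zero_mem _) (map_zero _)
  have aG := isAttach_adjoinIncl (Q := quivF K) (a := quivF.snd K) (b := quivF.fst K) (n := -1)
    (zero_mem _) (map_zero _)
  have aH₁ := isAttach_adjoinIncl (quivFG.dh₁_mem K)
    (dLin_comp_sub_id _ (quivFG.f K) (quivFG.g K) (quivFG.δ_f K) (quivFG.δ_g K))
  have aH₂ := isAttach_adjoinIncl (quivFGH.dh₂_mem K)
    (dLin_comp_sub_id _ (quivFGH.g K) (quivFGH.f K) (quivFGH.δ_g K) (quivFGH.δ_f K))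
  have aR := isAttach_adjoinIncl (quivFGHH.dr_mem K) (quivFGHH.dLin_dr K)
  have aB : IsAttach.{u} (generatingI K) (builtToK K) := isAttach_of_isIso _ _
  refine ⟨_, _, _, ⟨_, _, _, ⟨_, _, _, isAttach_unitToTwo K, aF, rfl⟩, ⟨_, _, _, aG, aH₁, rfl⟩, rfl⟩,
    ⟨_, _, _, ⟨_, _, _, aH₂, aR, rfl⟩, ⟨_, 𝟙 _, builtToK K, isAttach_of_isIso _ _,
      aB, rfl⟩, rfl⟩, ?_⟩
  exact discreteDG_ext fun _ => rfl

end DGQuiver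

theorem generatingJ_le_twoStep :
    generatingJ K ≤ twoStep (twoStep (twoStep (IsAttach.{u} (generatingI K)))) := by
  rintro _ _ _ (n | _)
  -- Only four factors are needed for ρ_n, so one more layer is added with an identity.
  · exact le_twoStep (twoStep_id (twoStep_id fun X => isAttach_of_isIso _ (𝟙 X))) _
      (DGQuiver.twoStep_rho K n)
  · exact DGQuiver.twoStep_sigma K

/-- Attachments are closed under coproducts and pushouts, and `twoStep` preserves both closures, so
every step of a J-cell is a triple `twoStep` of attachments. The layers are then absorbed one by one
by refining the sequence. -/
theorem cell_generatingJ_le_cell_generatingI : cell (generatingJ K) ≤ cell (generatingI K) := by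
  have hW : (coproducts.{u} (generatingI K)).pushouts = IsAttach.{u} (generatingI K) :=
    pushouts_coproducts_eq_isAttach _
  have hp : (IsAttach.{u} (generatingI K)).pushouts ≤ IsAttach.{u} (generatingI K) := by
    rw [← hW]
    exact (isStableUnderCobaseChange_iff_pushouts_le.1 inferInstance)
  have hc := coproducts_isAttach_le.{u} (generatingI K)
  have h : (coproducts.{u} (generatingJ K)).pushouts ≤
      twoStep (twoStep (twoStep (IsAttach.{u} (generatingI K)))) :=
    (pushouts_monotone ((coproducts_monotone (generatingJ_le_twoStep K)).trans
      (coproducts_twoStep_le (coproducts_twoStep_le (coproducts_twoStep_le hc))))).trans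
      (pushouts_twoStep_le (pushouts_twoStep_le (pushouts_twoStep_le hp)))
  refine (transfiniteCompositionsOfShape_monotone ℕ h).trans ?_
  refine (transfiniteCompositions_twoStep_le _).trans ?_
  refine (transfiniteCompositions_twoStep_le _).trans ?_
  refine (transfiniteCompositions_twoStep_le _).trans ?_
  rw [← hW]
  exact le_rfl

end Generators

theorem mainTheorem7 (K : Type u) [CommRing K] :
    cell (generatingJ K) ≤ cell (generatingI K) ⊓ quasiEquivalences K ∧
    (∀ (n : ℤ) ⦃C C₁ : DGCat.{u} K⦄ (a : twoDG K ⟶ C) (F : C ⟶ C₁) (b : disc K n ⟶ C₁),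
      IsPushout a (rho K n) F b → quasiEquivalences K F) ∧
    (∀ ⦃C C₂ : DGCat.{u} K⦄ (a : unitDG K ⟶ C) (F : C ⟶ C₂) (b : kDG K ⟶ C₂),
      IsPushout a (sigma K) F b → quasiEquivalences K F) :=
  ⟨le_inf (cell_generatingJ_le_cell_generatingI K) cell_generatingJ_le_quasiEquivalences,
    fun n _ _ _ _ _ sq => pushouts_generatingJ_le_quasiEquivalences _ ⟨_, _, _, _, _, .rho n, sq⟩,
    fun _ _ _ _ _ sq => pushouts_generatingJ_le_quasiEquivalences _ ⟨_, _, _, _, _, .sigma, sq⟩⟩
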